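/- **Notation.** Let $N\ge 1$ and $k\ge 2$ be integers. A row vector is acted on by matrices from the right. *Symbols.* $\mathcal P(\mathbb Q)$ is the set of symbols $\pi_r(s)$ with $r\ne s$ in $\mathbb P^1(\mathbb Q)$, with the natural left action of $GL_2(\mathbb Q)$; $\Xi_0$ is the group of divisors of degree $0$ on $\mathcal P(\mathbb Q)$; $[Z_1,Z_2]=\{Z_2\}-\{Z_1\}$; $\{\infty,0\}=[\pi_\infty(0),\pi_0(\infty)]$ and $[0,r]_\infty=[\pi_\infty(0),\pi_\infty(r)]$. *Coefficients.* $V_k(R)=R[x,y]_{k-2}$ is the space of homogeneous polynomials of degree $k-2$, with the right action $(P|\gamma)(x,y)=P(dx-cy,-bx+ay)$ for $\gamma=\begin{pmatrix}a&b\\c&d\end{pmatrix}\in GL_2(\mathbb Q)$, and $V_k=V_k(\mathbb Q)$. $SL_2(\mathbb Z)$ acts on $\mathrm{Hom}(\Xi_0,V_k(\mathbb C))$ by $(\Phi|\gamma)(\delta)=\Phi(\gamma\delta)|\gamma$. *Functions.* $\mathcal F'_{N,k}$ is the space of functions $f:(\mathbb Z/N\mathbb Z)^2\to\mathbb C$,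 with the condition $f(0)=0$ if $k=2$, with the right action $(f|\gamma)(v)=f(v\gamma^{-1})$ of $SL_2(\mathbb Z)$. Put $f^-(v)=f(-v)$ and $\widehat f(n,m)=\frac1N\sum_{(a,b)}f(a,b)e^{2\pi i(am-bn)/N}$. *Eisenstein series.* $\mathcal Eis_k(f)(z)=\frac{(k-1)!}{(-2i\pi)^k}N^{k-1}\sum'_{(c,d)\in\mathbb Z^2}\widehat f(c,d)(cz+d)^{-k}$, the sum being over $(c,d)\neq(0,0)$, and for $k=2$ by Eisenstein summation (first over $d$, then over $c$). *Periods.* For $F$ a modular form of weight $k$ for a congruence subgroup, let $a_0(F)$ be its constant term at $\infty$, $W(F)(\tau)=\int_{i\infty}^\tau(F(t)-a_0(F))(tx+y)^{k-2}dt+a_0(F)\int_0^\tau(tx+y)^{k-2}dt$, and $F|_k\gamma(z)=\det(\gamma)^{k-1}(cz+d)^{-k}F(\gamma z)$ for $\gamma\in GL_2^+(\mathbb Q)$. The homomorphism $\mathcal Per(F)\in\mathrm{Hom}(\Xi_0,V_k(\mathbb C))$ is characterized by $$\mathcal Per(F)([\pi_\infty(0),\gamma^{-1}\pi_\infty(0)])=W(F)(\tau)-W(F|_k\gamma^{-1})(\gamma\tau)|\gamma\qquad(\gamma\in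 GL_2^+(\mathbb Q)),$$ the right side being independent of $\tau$ in the upper half plane. *Distributions.* For $r\in\mathbb Z/N\mathbb Z$ let $\beta_0(r)=N^{-1}$, $\beta_1(r)=-B_1(\langle\frac rN\rangle)-\frac12\delta_{r,0}$ and $\beta_h(r)=-N^{h-1}B_h(\langle\frac rN\rangle)/h$ for $h\ge2$ ($B_h$ the Bernoulli polynomials, $\langle\cdot\rangle$ the fractional part), and $\int g\,d\beta_h=\sum_r g(r)\beta_h(r)$. Let $\int g\,d\beta'_{h-1}=\frac{1}{-2i\pi}L'(2-h,\widehat g^-+(-1)^h\widehat g)$, where for functions on $\mathbb Z/N\mathbb Z$ one puts $\widehat g(n)=\sum_a g(a)e^{-2\pi i an/N}$, $\widehat g^-(n)=\widehat g(-n)$, and $L(s,g)$ is the meromorphic continuation of $\sum_{n\ge1}g(n)n^{-s}$. The notation $\int f\,d\mu\,d\nu$ means integration against $\mu$ in the first and $\nu$ in the second variable. **Theorem (Stevens).** For $f\in\mathcal F'_{N,k}$, $\mathcal Eis_k(f)$ is a modular form of weight $k$ for $\Gamma(N)$, so that $\Psi_k=\mathcal Per\circ\mathcal Eis_k$ is defined.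 The map $$\Psi_k:\mathcal F'_{N,k}\to\mathrm{Hom}(\Xi_0,V_k(\mathbb C))$$ is $\mathbb C$-linear and satisfies $\Psi_k(f|\gamma)=\Psi_k(f)|\gamma$ for $\gamma\in SL_2(\mathbb Z)$. For all $f\in\mathcal F'_{N,k}$, $$\Psi_k(f)(\{\infty,0\})=\sum_{j=0}^{k-2}(-1)^j\binom{k-2}{j}\Big(\int f^-\,d\beta_{k-1-j}\,d\beta_{j+1}\Big)x^jy^{k-2-j}+\Big(\int\widehat f\,d\beta'_{k-1}\,d\beta_0\Big)x^{k-2}-\Big(\int\widehat f\,d\beta_0\,d\beta'_{k-1}\Big)y^{k-2},$$ $$\Psi_k(f)([0,r]_\infty)=\frac1{k-1}\Big(\int f^-\,d\beta_k\,d\beta_0\Big)\frac{(rx+y)^{k-1}-y^{k-1}}{x}\qquad(r\in\mathbb Q),$$ and $\Psi_k$ is the only $SL_2(\mathbb Z)$-equivariant map $\mathcal F'_{N,k}\to\mathrm{Hom}(\Xi_0,V_k(\mathbb C))$ with these values. Moreover, let $\Gamma$ be a subgroup of $SL_2(\mathbb Z)$ containing $\Gamma(N)$ and let $f\in\mathcal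 F'_{N,k}$ be $\mathbb Q$-valued and $\Gamma$-invariant. Then $\Psi_k(f)$ is $\Gamma$-invariant, and for every $Z\in\mathcal P(\mathbb Q)$ the class in $H^1(\Gamma,V_k(\mathbb C))$ of the cocycle $\gamma\mapsto\Psi_k(f)([Z,\gamma^{-1}Z])$ lies in the image of $H^1(\Gamma,V_k)$. -/

import Mathlib

open MatrixGroups UpperHalfPlane ModularForm

noncomputable section

namespace EisensteinDedekind

/-! ### Infinitesimal cusps and their divisors -/

/-- The set `𝒫(ℚ)` of infinitesimal cusps `π_r(s)`, `r ≠ s` in `ℙ¹(ℚ)`: the pair `(r, s)` stands for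
`π_r(s)`. The projective line `ℙ¹(ℚ)` is Mathlib's `OnePoint ℚ`. -/
def InfCusp : Type := {p : OnePoint ℚ × OnePoint ℚ // p.1 ≠ p.2}

/-- The infinitesimal cusp `π_r(s)`. -/
def infCusp (r s : OnePoint ℚ) (h : r ≠ s) : InfCusp := ⟨(r, s), h⟩

/-- The action of `GL₂(ℚ)` on infinitesimal cusps by linear fractional transformations. -/
instance : MulAction (GL (Fin 2) ℚ) InfCusp where
  smul g Z := ⟨(g • Z.1.1, g • Z.1.2), fun h => Z.2 (smul_left_cancel g h)⟩
  one_smul _ := Subtype.ext (Prod.ext (one_smul _ _) (one_smul _ _))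
  mul_smul g h Z := Subtype.ext (Prod.ext (mul_smul g h Z.1.1) (mul_smul g h Z.1.2))

/-- `Z_∞ = π_∞(0)`. -/
def zInfty : InfCusp := infCusp OnePoint.infty ((0 : ℚ) : OnePoint ℚ) (OnePoint.infty_ne_coe 0)

/-- `Ξ₀`: the divisors of degree `0` on the set of infinitesimal cusps. -/
def Xi0 : AddSubgroup (InfCusp →₀ ℤ) :=
  (Finsupp.degree : (InfCusp →₀ ℤ) →+ ℤ).ker

/-- `[Z₁, Z₂] = {Z₂} - {Z₁}` in `Ξ₀`. -/
def bracket (Z₁ Z₂ : InfCusp) : Xi0 :=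
  ⟨Finsupp.single Z₂ 1 - Finsupp.single Z₁ 1, by
    simp [Xi0, AddMonoidHom.mem_ker, Finsupp.degree_single]⟩

/-- The modular symbol `{r, s} = [π_r(s), π_s(r)]`. -/
def modularSymbol (r s : OnePoint ℚ) (h : r ≠ s) : Xi0 :=
  bracket (infCusp r s h) (infCusp s r h.symm)

/-- The infinitesimal symbol `[s, t]_r = [π_r(s), π_r(t)]`. -/
def infinitesimalSymbol (r s t : OnePoint ℚ) (hs : r ≠ s) (ht : r ≠ t) : Xi0 :=
  bracket (infCusp r s hs) (infCusp r t ht)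

/-- The modular symbol `{∞, 0} = [π_∞(0), π_0(∞)]`. -/
def symbolInftyZero : Xi0 :=
  modularSymbol OnePoint.infty ((0 : ℚ) : OnePoint ℚ) (OnePoint.infty_ne_coe 0)

/-- The infinitesimal symbol `[0, r]_∞ = [π_∞(0), π_∞(r)]` for `r ∈ ℚ`. -/
def symbolAtInfty (r : ℚ) : Xi0 :=
  infinitesimalSymbol OnePoint.infty ((0 : ℚ) : OnePoint ℚ) (r : OnePoint ℚ)
    (OnePoint.infty_ne_coe 0) (OnePoint.infty_ne_coe r)

/-- The action of `GL₂(ℚ)` on `Ξ₀` induced by its action on infinitesimal cusps. -/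
def xiAct (g : GL (Fin 2) ℚ) : Xi0 →+ Xi0 where
  toFun δ := ⟨Finsupp.mapDomain (fun Z : InfCusp => g • Z) δ.1, by
    have h : Finsupp.degree δ.1 = 0 := δ.2
    simpa [Xi0, AddMonoidHom.mem_ker, Finsupp.degree_mapDomain] using h⟩
  map_zero' := Subtype.ext (Finsupp.mapDomain_zero (f := fun Z : InfCusp => g • Z))
  map_add' _ _ := Subtype.ext (Finsupp.mapDomain_add (f := fun Z : InfCusp => g • Z))

/-! ### The coefficient module `V_k` -/

/-- `V_k(R) = R[x, y]_{k-2}`: homogeneous polynomials of degree `k - 2` in `x = X 0`, `y = X 1`. -/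
abbrev V (k : ℕ) (R : Type) [CommRing R] : Type :=
  MvPolynomial.homogeneousSubmodule (Fin 2) R (k - 2)

/-- The substitution `x ↦ d x - c y`, `y ↦ -b x + a y` for `g = (a b; c d)`. -/
def substHom (R : Type) [CommRing R] [Algebra ℚ R] (g : GL (Fin 2) ℚ) :
    MvPolynomial (Fin 2) R →ₐ[R] MvPolynomial (Fin 2) R :=
  MvPolynomial.aeval
    ![MvPolynomial.C (algebraMap ℚ R (g 1 1)) * MvPolynomial.X 0
        - MvPolynomial.C (algebraMap ℚ R (g 1 0)) * MvPolynomial.X 1,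
      -MvPolynomial.C (algebraMap ℚ R (g 0 1)) * MvPolynomial.X 0
        + MvPolynomial.C (algebraMap ℚ R (g 0 0)) * MvPolynomial.X 1]

lemma substHom_homogeneous {R : Type} [CommRing R] [Algebra ℚ R] (g : GL (Fin 2) ℚ) {n : ℕ}
    {P : MvPolynomial (Fin 2) R} (hP : P.IsHomogeneous n) : (substHom R g P).IsHomogeneous n := by
  unfold substHom
  rw [← one_mul n]
  refine hP.aeval _ fun i => ?_
  fin_cases i
  · exact (MvPolynomial.isHomogeneous_C_mul_X _ _).sub (MvPolynomial.isHomogeneous_C_mul_X _ _)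
  · have h := (MvPolynomial.isHomogeneous_C_mul_X (-(algebraMap ℚ R (g 0 1))) (0 : Fin 2)).add
      (MvPolynomial.isHomogeneous_C_mul_X (algebraMap ℚ R (g 0 0)) (1 : Fin 2))
    rw [map_neg] at h
    exact h

lemma substHom_one (R : Type) [CommRing R] [Algebra ℚ R] : substHom R 1 = AlgHom.id R _ := by
  apply MvPolynomial.algHom_ext
  intro i
  fin_cases i <;> simp [substHom, -MvPolynomial.algebraMap_apply]

lemma substHom_mul (R : Type) [CommRing R] [Algebra ℚ R] (g h : GL (Fin 2) ℚ) :
    substHom R (g * h) = (substHom R h).comp (substHom R g) := by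
  apply MvPolynomial.algHom_ext
  intro i
  fin_cases i <;>
    simp only [substHom, Matrix.GeneralLinearGroup.coe_mul, Matrix.mul_apply, Fin.sum_univ_two,
      AlgHom.comp_apply, MvPolynomial.aeval_X, MvPolynomial.algHom_C, MvPolynomial.algebraMap_eq,
      map_add, map_sub, map_mul, map_neg, Fin.zero_eta, Fin.mk_one, Matrix.cons_val_zero,
      Matrix.cons_val_one, Matrix.cons_val_fin_one] <;> ring

/-- The right action of `GL₂(ℚ)` on `V_k(R)`:
`(P|g)(x, y) = det(g)^{k-2} P((x, y) g⁻¹) = P(d x - c y, -b x + a y)`. -/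
def vAct (k : ℕ) (R : Type) [CommRing R] [Algebra ℚ R] (g : GL (Fin 2) ℚ) : V k R →ₗ[R] V k R :=
  (substHom R g).toLinearMap.restrict fun _ hP => substHom_homogeneous g hP

/-- `∑_{j=0}^{k-2} (k-2 choose j) c_j x^j y^{k-2-j}`; if `c_j = ∫ t^j dμ(t)` this is the polynomial
`∫ (t x + y)^{k-2} dμ(t)`. -/
def momentPoly (k : ℕ) (c : ℕ → ℂ) : V k ℂ :=
  ⟨∑ j ∈ Finset.range (k - 1), MvPolynomial.C (((k - 2).choose j : ℂ) * c j) *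
      (MvPolynomial.X 0 ^ j * MvPolynomial.X 1 ^ (k - 2 - j)), by
    refine MvPolynomial.IsHomogeneous.sum _ _ _ fun j hj => ?_
    have hj' : j + (k - 2 - j) = k - 2 := by
      have := Finset.mem_range.1 hj
      omega
    have h := ((MvPolynomial.isHomogeneous_X_pow (R := ℂ) (0 : Fin 2) j).mul
      (MvPolynomial.isHomogeneous_X_pow (1 : Fin 2) (k - 2 - j))).C_mul
        (((k - 2).choose j : ℂ) * c j)
    rwa [hj'] at h⟩

/-! ### `Hom(Ξ₀, V_k)` and classes in group cohomology -/

/-- The right action of `SL₂(ℤ)` on `Hom(Ξ₀, V_k(R))`: `(Φ|γ)(δ) = Φ(γ δ)|γ`. -/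
def homSlash (k : ℕ) (R : Type) [CommRing R] [Algebra ℚ R] (γ : SL(2, ℤ)) (Φ : Xi0 →+ V k R) :
    Xi0 →+ V k R :=
  (vAct k R (Matrix.SpecialLinearGroup.mapGL ℚ γ)).toAddMonoidHom.comp
    (Φ.comp (xiAct (Matrix.SpecialLinearGroup.mapGL ℚ γ)))

/-- `Φ ∈ Hom_Γ(Ξ₀, V_k(R))`. -/
def IsGammaInvariant (Γ : Subgroup SL(2, ℤ)) (k : ℕ) (R : Type) [CommRing R] [Algebra ℚ R]
    (Φ : Xi0 →+ V k R) : Prop :=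
  ∀ γ ∈ Γ, homSlash k R γ Φ = Φ

/-- The left representation of `Γ` over `ℚ` on `V_k(R)` attached to the right action:
`γ · P = P|γ⁻¹`. -/
def vRepresentation (Γ : Subgroup SL(2, ℤ)) (k : ℕ) (R : Type) [CommRing R] [Algebra ℚ R] :
    Representation ℚ Γ (V k R) where
  toFun γ := (vAct k R (Matrix.SpecialLinearGroup.mapGL ℚ (γ : SL(2, ℤ))⁻¹)).restrictScalars ℚ
  map_one' := by
    ext P : 1
    apply Subtype.ext
    simp [vAct, substHom_one]
  map_mul' γ γ' := by
    ext P : 1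
    apply Subtype.ext
    simp [vAct, substHom_mul]

/-- `V_k(R)` as an object of the category of representations of `Γ`. -/
abbrev vRep (Γ : Subgroup SL(2, ℤ)) (k : ℕ) (R : Type) [CommRing R] [Algebra ℚ R] : Rep ℚ Γ :=
  Rep.of (vRepresentation Γ k R)

/-- The inclusion `V_k = V_k(ℚ) → V_k(ℂ)`. -/
def vBaseChange (k : ℕ) : V k ℚ →ₗ[ℚ] V k ℂ where
  toFun P := ⟨MvPolynomial.map (algebraMap ℚ ℂ) P.1, P.2.map _⟩
  map_add' P Q := Subtype.ext (map_add _ _ _)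
  map_smul' a P := Subtype.ext (by
    simp [Algebra.smul_def, MvPolynomial.algebraMap_apply])

lemma vBaseChange_vAct (k : ℕ) (g : GL (Fin 2) ℚ) (P : V k ℚ) :
    vBaseChange k (vAct k ℚ g P) = vAct k ℂ g (vBaseChange k P) := by
  apply Subtype.ext
  have h : (MvPolynomial.map (algebraMap ℚ ℂ)).comp (substHom ℚ g).toRingHom
      = (substHom ℂ g).toRingHom.comp (MvPolynomial.map (algebraMap ℚ ℂ)) := by
    apply MvPolynomial.ringHom_ext
    · intro a
      simp
    · intro i
      fin_cases i <;> simp [substHom]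
  exact congrArg (fun φ => φ P.1) h

/-- The inclusion `V_k → V_k(ℂ)` as a morphism of representations of `Γ`. -/
def vRepBaseChange (Γ : Subgroup SL(2, ℤ)) (k : ℕ) : vRep Γ k ℚ ⟶ vRep Γ k ℂ :=
  Rep.ofHom ((vBaseChange k).intertwiningMap_of_isIntertwiningMap _ _
    fun _ P => vBaseChange_vAct k _ P)

/-- The natural map `H¹(Γ, V_k) → H¹(Γ, V_k(ℂ))`. -/
def h1BaseChange (Γ : Subgroup SL(2, ℤ)) (k : ℕ) :
    groupCohomology.H1 (vRep Γ k ℚ) ⟶ groupCohomology.H1 (vRep Γ k ℂ) :=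
  (groupCohomology.functor ℚ Γ 1).map (vRepBaseChange Γ k)

lemma bracket_mul_smul (g h : GL (Fin 2) ℚ) (Z : InfCusp) :
    bracket Z ((g * h) • Z) = bracket Z (g • Z) + xiAct g (bracket Z (h • Z)) := by
  apply Subtype.ext
  have : Finsupp.mapDomain (fun Y : InfCusp => g • Y)
      (Finsupp.single (h • Z) (1 : ℤ) - Finsupp.single Z 1)
      = Finsupp.single (g • h • Z) 1 - Finsupp.single (g • Z) 1 := by
    rw [sub_eq_add_neg, ← Finsupp.single_neg, Finsupp.mapDomain_add, Finsupp.mapDomain_single,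
      Finsupp.mapDomain_single, Finsupp.single_neg, ← sub_eq_add_neg]
  simp [bracket, xiAct, this, mul_smul]

lemma vAct_inv_apply (k : ℕ) (R : Type) [CommRing R] [Algebra ℚ R] (g : GL (Fin 2) ℚ)
    (P : V k R) : vAct k R g⁻¹ (vAct k R g P) = P := by
  apply Subtype.ext
  have h : (substHom R g⁻¹).comp (substHom R g) = AlgHom.id R _ := by
    rw [← substHom_mul, mul_inv_cancel, substHom_one]
  exact congrArg (fun φ => φ P.1) h

/-- The image of `Φ ∈ Hom_Γ(Ξ₀, V_k(R))` in `H¹(Γ, V_k(R))`. For the right action it is the class of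
the cocycle `γ ↦ Φ([Z, γ⁻¹ Z])`; in the convention for left modules this cocycle is
`γ ↦ Φ([Z, γ Z])`. -/
def h1Class (Γ : Subgroup SL(2, ℤ)) (k : ℕ) (R : Type) [CommRing R] [Algebra ℚ R] (Z : InfCusp)
    (Φ : Xi0 →+ V k R) (hΦ : IsGammaInvariant Γ k R Φ) : groupCohomology.H1 (vRep Γ k R) :=
  groupCohomology.H1π (vRep Γ k R)
    ⟨fun γ => Φ (bracket Z (Matrix.SpecialLinearGroup.mapGL ℚ (γ : SL(2, ℤ)) • Z)), by
      rw [groupCohomology.mem_cocycles₁_iff]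
      intro g h
      have key : ∀ δ : Xi0, Φ (xiAct (Matrix.SpecialLinearGroup.mapGL ℚ (g : SL(2, ℤ))) δ)
          = vAct k R (Matrix.SpecialLinearGroup.mapGL ℚ (g : SL(2, ℤ))⁻¹) (Φ δ) := by
        intro δ
        have h1 : vAct k R (Matrix.SpecialLinearGroup.mapGL ℚ (g : SL(2, ℤ)))
            (Φ (xiAct (Matrix.SpecialLinearGroup.mapGL ℚ (g : SL(2, ℤ))) δ)) = Φ δ :=
          DFunLike.congr_fun (hΦ g.1 g.2) δ
        rw [← h1, map_inv, vAct_inv_apply]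
      have h2 : Φ (bracket Z (Matrix.SpecialLinearGroup.mapGL ℚ ((g * h : Γ) : SL(2, ℤ)) • Z))
          = Φ (bracket Z (Matrix.SpecialLinearGroup.mapGL ℚ (g : SL(2, ℤ)) • Z))
            + vAct k R (Matrix.SpecialLinearGroup.mapGL ℚ (g : SL(2, ℤ))⁻¹)
              (Φ (bracket Z (Matrix.SpecialLinearGroup.mapGL ℚ (h : SL(2, ℤ)) • Z))) := by
        rw [Subgroup.coe_mul, map_mul, bracket_mul_smul, map_add, key]
      exact h2.trans (add_comm _ _)⟩

/-! ### Periods -/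

/-- The weight `k` action `F|_k g (z) = det(g)^{k-1} (c z + d)^{-k} F(g z)` for `g ∈ GL₂⁺(ℚ)`. -/
def ratSlash (k : ℕ) (F : ℍ → ℂ) (g : GL (Fin 2) ℚ) : ℍ → ℂ :=
  F ∣[(k : ℤ)] (Matrix.GeneralLinearGroup.map (algebraMap ℚ ℝ) g)

/-- The Eichler integral
`W(F)(τ) = ∫_{i∞}^τ (F(t) - a₀(F)) (t x + y)^{k-2} dt + a₀(F) ∫_0^τ (t x + y)^{k-2} dt`,
where `a₀(F)` is the value of `F` at `i∞`. The first path is the vertical half-line `t = τ + i u`,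
the second one the segment `t = s τ`. -/
def eichlerIntegral (k : ℕ) (F : ℍ → ℂ) (τ : ℍ) : V k ℂ :=
  momentPoly k fun j =>
    -(∫ u in Set.Ioi (0 : ℝ), (F (ofComplex ((τ : ℂ) + u * Complex.I)) - valueAtInfty F) *
        ((τ : ℂ) + u * Complex.I) ^ j * Complex.I)
      + valueAtInfty F * ∫ s in (0 : ℝ)..1, ((s : ℂ) * τ) ^ j * τ

/-- `W(F)(τ) - (W(F|_k g⁻¹)|g)(τ)`, where `(W|g)(τ) = W(g τ)|g`. For a modular form `F` and
`g ∈ GL₂⁺(ℚ)` it does not depend on `τ`; it is the value at `g` of the cocycle of `F`. -/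
def eichlerDefect (k : ℕ) (F : ℍ → ℂ) (g : GL (Fin 2) ℚ) (τ : ℍ) : V k ℂ :=
  eichlerIntegral k F τ -
    vAct k ℂ g (eichlerIntegral k (ratSlash k F g⁻¹)
      (Matrix.GeneralLinearGroup.map (algebraMap ℚ ℝ) g • τ))

/-- The cocycle of `F`, evaluated at the base point `τ = i`. -/
def cocycle (k : ℕ) (F : ℍ → ℂ) (g : GL (Fin 2) ℚ) : V k ℂ :=
  eichlerDefect k F g UpperHalfPlane.I

lemma exists_smul_zInfty (Z : InfCusp) :
    ∃ g : GL (Fin 2) ℚ, 0 < g.det.val ∧ g⁻¹ • zInfty = Z := by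
  suffices h : ∃ A : Matrix (Fin 2) (Fin 2) ℚ, ∃ hA : A.det = 1,
      (Matrix.GeneralLinearGroup.mkOfDetNeZero A (by simp [hA])) • zInfty = Z by
    obtain ⟨A, hA, hZ⟩ := h
    refine ⟨(Matrix.GeneralLinearGroup.mkOfDetNeZero A (by simp [hA]))⁻¹, ?_, by rwa [inv_inv]⟩
    have hd : (Matrix.GeneralLinearGroup.mkOfDetNeZero A (by simp [hA])).det = 1 :=
      Units.ext hA
    rw [map_inv, hd]
    simp
  obtain ⟨⟨r, s⟩, hrs⟩ := Z
  have aux : ∀ (A : Matrix (Fin 2) (Fin 2) ℚ) (hA : A.det = 1),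
      (if A 1 0 = 0 then OnePoint.infty else ((A 0 0 / A 1 0 : ℚ) : OnePoint ℚ)) = r →
      (if A 1 1 = 0 then OnePoint.infty else ((A 0 1 / A 1 1 : ℚ) : OnePoint ℚ)) = s →
      (Matrix.GeneralLinearGroup.mkOfDetNeZero A (by simp [hA])) • zInfty = ⟨(r, s), hrs⟩ := by
    intro A hA h1 h2
    refine Subtype.ext (Prod.ext ?_ ?_)
    · refine Eq.trans (OnePoint.smul_infty_eq_ite _) ?_
      exact h1
    · refine Eq.trans OnePoint.smul_some_eq_ite ?_
      simpa [Matrix.GeneralLinearGroup.mkOfDetNeZero] using h2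
  induction r using OnePoint.rec with
  | infty =>
    induction s using OnePoint.rec with
    | infty => exact absurd rfl hrs
    | coe s => exact ⟨!![1, s; 0, 1], by simp, aux _ (by simp) (by simp) (by simp)⟩
  | coe r =>
    induction s using OnePoint.rec with
    | infty => exact ⟨!![r, -1; 1, 0], by simp, aux _ (by simp) (by simp) (by simp)⟩
    | coe s =>
      have h : r - s ≠ 0 := sub_ne_zero.2 fun h => hrs (congrArg _ h)
      refine ⟨!![r, s / (r - s); 1, 1 / (r - s)], ?_, aux _ ?_ (by simp) ?_⟩
      · rw [Matrix.det_fin_two_of]; field_simp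
      · rw [Matrix.det_fin_two_of]; field_simp
      · simp [h]

/-- An element `g` of `GL₂⁺(ℚ)` with `g⁻¹ π_∞(0) = Z`. -/
def cuspMatrix (Z : InfCusp) : GL (Fin 2) ℚ := (exists_smul_zInfty Z).choose

/-- The period homomorphism `Per(F) ∈ Hom(Ξ₀, V_k(ℂ))`: the additive map whose value at
`[π_∞(0), g⁻¹ π_∞(0)]` is the cocycle of `F` at `g`. -/
def per (k : ℕ) (F : ℍ → ℂ) : Xi0 →+ V k ℂ :=
  (Finsupp.linearCombination ℤ fun Z : InfCusp => cocycle k F (cuspMatrix Z)).toAddMonoidHom.comp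
    Xi0.subtype

/-! ### Functions on `(ℤ/Nℤ)²` and Eisenstein series -/

/-- Functions from `(ℤ/Nℤ)²` to `ℂ`. -/
abbrev Fn (N : ℕ) : Type := (Fin 2 → ZMod N) → ℂ

/-- The right action of `SL₂(ℤ)` on functions: `(f|γ)(v) = f(v γ⁻¹)`, `v` a row vector. -/
def fnSlash {N : ℕ} (γ : SL(2, ℤ)) (f : Fn N) : Fn N := fun v =>
  f (Matrix.vecMul v ((γ⁻¹ : SL(2, ℤ)).1.map (Int.cast : ℤ → ZMod N)))

/-- The space of functions on `(ℤ/Nℤ)²` with, if `k = 2`, the extra condition `f(0) = 0`. -/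
def Fn' (N k : ℕ) : Submodule ℂ (Fn N) where
  carrier := {f | k = 2 → f 0 = 0}
  zero_mem' _ := rfl
  add_mem' hf hg h := by simp [hf h, hg h]
  smul_mem' c f hf h := by simp [hf h]

/-- The action of `SL₂(ℤ)` on the space `Fn' N k`. -/
def fnSlash' {N k : ℕ} (γ : SL(2, ℤ)) (f : Fn' N k) : Fn' N k :=
  ⟨fnSlash γ f.1, fun h => by simpa [fnSlash] using f.2 h⟩

/-- The Fourier transform
`f^(n, m) = N⁻¹ ∑_{(a, b)} f(a, b) exp((2πi / N) (a m - b n))`. -/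
def fourier {N : ℕ} [NeZero N] (f : Fn N) : Fn N := fun v =>
  (N : ℂ)⁻¹ * ∑ w : Fin 2 → ZMod N, f w * ZMod.stdAddChar (w 0 * v 1 - w 1 * v 0)

/-- The term `f(c, d) (c z + d)^{-k}` for `(c, d) ≠ (0, 0)`, and `0` for `(c, d) = (0, 0)`. -/
def eisTerm {N : ℕ} (k : ℕ) (f : Fn N) (z : ℍ) (c d : ℤ) : ℂ :=
  if c = 0 ∧ d = 0 then 0 else f ![(c : ZMod N), (d : ZMod N)] * (((c : ℂ) * z + d) ^ k)⁻¹

/-- The Eisenstein series `E_{k,f}(z) = ∑' f(c, d) (c z + d)^{-k}`: summation over `ℤ² ∖ {0}` if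
`k > 2`, and Eisenstein's iterated summation (first over `d`, then over `c`) if `k = 2`. -/
def eisensteinSeries {N : ℕ} (k : ℕ) (f : Fn N) (z : ℍ) : ℂ :=
  if k = 2 then ∑' c : ℤ, ∑' d : ℤ, eisTerm k f z c d
  else ∑' p : ℤ × ℤ, eisTerm k f z p.1 p.2

/-- `Eis_k(f) = ((k-1)! / (-2iπ)^k) N^{k-1} E_{k, f^}`. -/
def eis (N k : ℕ) [NeZero N] (f : Fn N) : ℍ → ℂ := fun z =>
  ((k - 1).factorial : ℂ) / (-2 * Complex.I * Real.pi) ^ k * (N : ℂ) ^ (k - 1) *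
    eisensteinSeries k (fourier f) z

/-- `Ψ_k = Per ∘ Eis_k`. -/
def Psi (N k : ℕ) [NeZero N] (f : Fn' N k) : Xi0 →+ V k ℂ := per k (eis N k f.1)

/-- Compatibility with the right actions of `SL₂(ℤ)` of a map from functions on `(ℤ/Nℤ)²` to
`Hom(Ξ₀, V_k(ℂ))`. -/
def IsEquivariant {N k : ℕ} (Φ : Fn' N k → (Xi0 →+ V k ℂ)) : Prop :=
  ∀ (γ : SL(2, ℤ)) (f : Fn' N k), Φ (fnSlash' γ f) = homSlash k ℂ γ (Φ f)

/-! ### Bernoulli distributions -/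

/-- The weights of the Bernoulli distribution `β_h` on `ℤ/Nℤ`; note that `⟨r/N⟩ = r.val / N`. -/
def betaRat {N : ℕ} (h : ℕ) (r : ZMod N) : ℚ :=
  if h = 0 then (N : ℚ)⁻¹
  else if h = 1 then
    -((Polynomial.bernoulli 1).eval ((r.val : ℚ) / N)) - (1 / 2) * (if r = 0 then 1 else 0)
  else -((N : ℚ) ^ (h - 1) * (Polynomial.bernoulli h).eval ((r.val : ℚ) / N) / h)

/-- The complex-valued weights of `β_h`. -/
def beta {N : ℕ} (h : ℕ) (r : ZMod N) : ℂ := (betaRat h r : ℂ)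

/-- `∫ g dβ'_m`, that is, `∫ g dβ'_{h-1} = (1 / (-2iπ)) L'(2 - h, ĝ⁻ + (-1)^h ĝ)` with
`h = m + 1`. Here `ĝ(n) = ∑_a g(a) exp(-2πi a n / N)` is Mathlib's `ZMod.dft g`, `ĝ⁻(n) = ĝ(-n)`, and
`ZMod.LFunction g` is the meromorphic continuation of `L(s, g) = ∑_{n > 0} g(n) n^{-s}`. -/
def betaPrimeIntegral {N : ℕ} [NeZero N] (m : ℕ) (g : ZMod N → ℂ) : ℂ :=
  1 / (-2 * Complex.I * Real.pi) *
    deriv (ZMod.LFunction fun n : ZMod N => ZMod.dft g (-n) + (-1) ^ (m + 1) * ZMod.dft g n)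
      (1 - (m : ℂ))

/-- The weight of `β'_m` at `r`, i.e. its value at the indicator function of `{r}`. -/
def betaPrime {N : ℕ} [NeZero N] (m : ℕ) (r : ZMod N) : ℂ :=
  betaPrimeIntegral m (Pi.single r 1)

/-- `∫_{(ℤ/Nℤ)²} f dμ dν = ∑_{(a, b)} f(a, b) μ(a) ν(b)`. -/
def integral₂ {N : ℕ} [NeZero N] (f : Fn N) (μ ν : ZMod N → ℂ) : ℂ :=
  ∑ v : Fin 2 → ZMod N, f v * μ (v 0) * ν (v 1)

/-- `f⁻(v) = f(-v)`. -/
def reflect {N : ℕ} (f : Fn N) : Fn N := fun v => f (-v)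

end EisensteinDedekind

end

open EisensteinDedekind

namespace EisensteinDedekind

/-! ### Generators of the group of divisors of degree zero -/

/-! Periods obey a cocycle rule, Eisenstein series are permuted by `SL₂(ℤ)`, and `Ξ₀` is generated
over `ℤ[SL₂(ℤ)]` by `{∞, 0}` and the `[0, r]_∞` (`Xi0.mem_of_generators`: `S` and `T` generate
`SL₂(ℤ)`, which is transitive on cusps). Generation gives uniqueness, and reduces rationality to the
two kinds of symbols.

Periods: `W(F)` is a primitive of `F(t)(tx+y)^{k-2} dt`, so the defect defining `Per` is constant in
`τ` (`eichlerDefect_eq`) and satisfies `cocycle_mul`. It vanishes on the diagonal matrices, which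
stabilize `π_∞(0)`, because they fix both base points `i∞` and `0` of the integrals in `W`. Hence
`per` has its characteristic property and is equivariant. The input is `IsRegular`: holomorphy and
exponential approach to a constant at `i∞`, for all transforms under `GL₂⁺(ℚ)`.

Eisenstein series: for `k > 2` equivariance is a reindexing of the lattice. For `k = 2` the
condition `f(0) = 0` says that the Fourier transform of `f` has sum zero, which turns the series
into a combination of values of `℘` at `N`-division points (`eisensteinSeries_two`). Lipschitz's
formula gives the expansion at `i∞` (`eis_eq`), hence regularity and the constant term. In the
period along `[0, r]_∞` the integrals to `i∞` cancel and only the constant term contributes.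

Value at `{∞, 0}`: with base point `i` the coefficients become values `Λ(j+1)` of the completed
`L`-function (`per_symbolInftyZero`). For `Re s > k`, `Λ` is a combination of products of a zeta
function of a residue class and a periodic zeta function. Hurwitz's functional equation replaces the
latter by zeta functions at `1 - s`, at the price of the factor `e^{πis} - e^{-πis}`
(`Λ_eis_eq_hurwitzSum`). This factor vanishes at integers `n`, so the identity is differentiated
there. Zeta values at `1 - n` are Bernoulli weights, and by parity the derivatives of zeta cancel
except for `n = 1` and `n = k - 1`. The survivors are the `β'` terms (`Λ_eis_natCast`).

Rationality: the `β'` terms are removed by the equivariant function on cusps that extends `(∫ f̂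
dβ'_{k-1} dβ_0) x^{k-2}` from `∞`. Adding its boundary makes the values on generators rational and
changes the cocycle by a coboundary (`h1Class_mem_range`). -/

lemma InfCusp.smul_fst (g : GL (Fin 2) ℚ) (Z : InfCusp) : (g • Z).1.1 = g • Z.1.1 := rfl

lemma InfCusp.smul_snd (g : GL (Fin 2) ℚ) (Z : InfCusp) : (g • Z).1.2 = g • Z.1.2 := rfl

lemma bracket_self (Z : InfCusp) : bracket Z Z = 0 := by
  apply Subtype.ext; simp [bracket]

lemma bracket_add (Z₁ Z₂ Z₃ : InfCusp) : bracket Z₁ Z₂ + bracket Z₂ Z₃ = bracket Z₁ Z₃ := by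
  apply Subtype.ext; simp [bracket]

lemma xiAct_bracket (g : GL (Fin 2) ℚ) (Z₁ Z₂ : InfCusp) :
    xiAct g (bracket Z₁ Z₂) = bracket (g • Z₁) (g • Z₂) := by
  apply Subtype.ext
  simp only [bracket, xiAct, AddMonoidHom.coe_mk, ZeroHom.coe_mk]
  rw [sub_eq_add_neg, ← Finsupp.single_neg, Finsupp.mapDomain_add, Finsupp.mapDomain_single,
      Finsupp.mapDomain_single, Finsupp.single_neg, ← sub_eq_add_neg]

/-- The multiples of `{Z}` on the right add up to the degree of `δ`, which is zero. -/
lemma Xi0.eq_sum_bracket (Z : InfCusp) (δ : Xi0) :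
    δ = δ.1.sum fun Y n => n • bracket Z Y := by
  apply Subtype.ext
  have h : (δ.1.sum fun _ n => n) = 0 := by
    have : Finsupp.degree δ.1 = 0 := δ.2
    rwa [Finsupp.degree_apply] at this
  rw [Finsupp.sum, AddSubgroup.val_finsetSum]
  simp only [AddSubgroup.coe_zsmul, bracket, smul_sub, Finset.sum_sub_distrib, Finsupp.smul_single,
    smul_eq_mul, mul_one]
  rw [← Finsupp.single_finsetSum]
  rw [Finsupp.sum] at h
  rw [h, Finsupp.single_zero, sub_zero]
  exact (Finsupp.sum_single δ.1).symm

lemma Xi0.mem_of_bracket_mem (A : AddSubgroup Xi0) (Z : InfCusp) (h : ∀ Y, bracket Z Y ∈ A)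
    (δ : Xi0) : δ ∈ A := by
  rw [Xi0.eq_sum_bracket Z δ]
  exact A.sum_mem fun Y _ => A.zsmul_mem (h Y) _

lemma addMonoidHom_Xi0_ext {M : Type*} [AddCommGroup M] {Φ Ψ : Xi0 →+ M} (Z : InfCusp)
    (h : ∀ Y, Φ (bracket Z Y) = Ψ (bracket Z Y)) : Φ = Ψ := by
  ext δ
  have : δ ∈ (Φ - Ψ).ker := Xi0.mem_of_bracket_mem _ Z (fun Y => by
    simp [AddMonoidHom.mem_ker, h Y]) δ
  rw [AddMonoidHom.mem_ker] at this
  simpa [sub_eq_zero] using this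

abbrev toGL (γ : SL(2, ℤ)) : GL (Fin 2) ℚ := Matrix.SpecialLinearGroup.mapGL ℚ γ

lemma toGL_apply (γ : SL(2, ℤ)) (i j : Fin 2) : toGL γ i j = (γ i j : ℚ) := by
  simp [toGL]

/-- Hence `{∞, 0}` is the bracket from `π_∞(0)` to its image under the generator `S`. -/
lemma smul_S_zInfty :
    toGL ModularGroup.S • zInfty
      = infCusp ((0 : ℚ) : OnePoint ℚ) OnePoint.infty (OnePoint.infty_ne_coe 0).symm := by
  apply Subtype.ext
  apply Prod.ext
  · rw [InfCusp.smul_fst]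
    refine (OnePoint.smul_infty_eq_ite _).trans ?_
    simp only [toGL_apply]
    simp [ModularGroup.S, infCusp]
  · rw [InfCusp.smul_snd]
    refine (OnePoint.smul_some_eq_ite).trans ?_
    simp only [toGL_apply]
    simp [ModularGroup.S, infCusp]

/-- Hence the generator `T` contributes `[0, 1]_∞`. -/
lemma smul_T_zInfty :
    toGL ModularGroup.T • zInfty
      = infCusp OnePoint.infty ((1 : ℚ) : OnePoint ℚ) (OnePoint.infty_ne_coe 1) := by
  apply Subtype.ext
  apply Prod.ext
  · rw [InfCusp.smul_fst]
    refine (OnePoint.smul_infty_eq_ite _).trans ?_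
    simp only [toGL_apply]
    simp [ModularGroup.T, infCusp]
  · rw [InfCusp.smul_snd]
    refine (OnePoint.smul_some_eq_ite).trans ?_
    simp only [toGL_apply]
    simp [ModularGroup.T, infCusp]

lemma exists_smul_infty_eq (r : OnePoint ℚ) : ∃ γ : SL(2, ℤ), toGL γ • OnePoint.infty = r := by
  obtain ⟨γ, hγ⟩ := OnePoint.exists_mem_SL2 ℤ r
  exact ⟨γ, hγ⟩

/-- `Ξ₀` is generated over `ℤ[SL₂(ℤ)]` by `{∞, 0}` and the symbols `[0, r]_∞`. -/
theorem Xi0.mem_of_generators (A : AddSubgroup Xi0) (h0 : symbolInftyZero ∈ A)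
    (hr : ∀ r : ℚ, symbolAtInfty r ∈ A) (hγ : ∀ (γ : SL(2, ℤ)), ∀ δ ∈ A, xiAct (toGL γ) δ ∈ A)
    (δ : Xi0) : δ ∈ A := by
  have hmul : ∀ γ γ' : SL(2, ℤ), bracket zInfty (toGL γ • zInfty) ∈ A →
      bracket zInfty (toGL γ' • zInfty) ∈ A → bracket zInfty (toGL (γ * γ') • zInfty) ∈ A := by
    intro γ γ' h h'
    rw [toGL, map_mul, bracket_mul_smul]
    exact A.add_mem h (hγ γ _ h')
  -- By `bracket_mul_smul` and the stability of `A`, the condition on `γ` is closed under products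
  -- and inverses, so it only has to be checked on `S` and `T`.
  let H : Subgroup SL(2, ℤ) :=
    { carrier := {γ | bracket zInfty (toGL γ • zInfty) ∈ A}
      one_mem' := by simp [bracket_self]
      mul_mem' := fun {a b} ha hb => hmul a b ha hb
      inv_mem' := fun {γ} h => by
        have h1 := hγ γ⁻¹ _ h
        rw [xiAct_bracket] at h1
        simp only [toGL, map_inv, inv_smul_smul] at h1
        have h2 := bracket_add zInfty ((toGL γ)⁻¹ • zInfty) zInfty
        rw [bracket_self] at h2
        show bracket zInfty (toGL γ⁻¹ • zInfty) ∈ A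
        rw [toGL, map_inv, eq_neg_of_add_eq_zero_left h2]
        exact A.neg_mem h1 }
  have hH : H = ⊤ := by
    rw [eq_top_iff, ← _root_.SpecialLinearGroup.SL2Z_generators, Subgroup.closure_le]
    rintro γ (rfl | rfl)
    · show bracket zInfty (toGL ModularGroup.S • zInfty) ∈ A
      rw [smul_S_zInfty]; exact h0
    · show bracket zInfty (toGL ModularGroup.T • zInfty) ∈ A
      rw [smul_T_zInfty]; exact hr 1
  refine Xi0.mem_of_bracket_mem A zInfty (fun Z => ?_) δ
  -- Moving `Z` to a point `π_∞(s)` over `∞` gives `[π_∞(0), Z] = [π_∞(0), γ π_∞(0)] + γ [0, s]_∞`.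
  obtain ⟨γ, hγZ⟩ := exists_smul_infty_eq Z.1.1
  have h1 : bracket zInfty (toGL γ • zInfty) ∈ A := by
    have : γ ∈ H := hH ▸ Subgroup.mem_top γ
    exact this
  have h2 : ((toGL γ)⁻¹ • Z).1.1 = OnePoint.infty := by
    rw [InfCusp.smul_fst, ← hγZ, inv_smul_smul]
  obtain ⟨s, hs⟩ : ∃ s : ℚ, ((s : ℚ) : OnePoint ℚ) = ((toGL γ)⁻¹ • Z).1.2 :=
    OnePoint.ne_infty_iff_exists.1 fun h => ((toGL γ)⁻¹ • Z).2 (h2.trans h.symm)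
  have h3 : bracket zInfty ((toGL γ)⁻¹ • Z) = symbolAtInfty s := by
    have : (toGL γ)⁻¹ • Z = infCusp OnePoint.infty (s : OnePoint ℚ) (OnePoint.infty_ne_coe s) :=
      Subtype.ext (Prod.ext h2 hs.symm)
    rw [this]; rfl
  have h4 := hγ γ _ (h3 ▸ hr s)
  rw [xiAct_bracket, smul_inv_smul] at h4
  rw [← bracket_add _ _ Z]
  exact A.add_mem h1 h4

/-! ### The action on `V_k` -/

lemma vAct_one (k : ℕ) (R : Type) [CommRing R] [Algebra ℚ R] (P : V k R) : vAct k R 1 P = P := by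
  apply Subtype.ext
  simp [vAct, substHom_one]

lemma vAct_mul (k : ℕ) (R : Type) [CommRing R] [Algebra ℚ R] (g h : GL (Fin 2) ℚ) (P : V k R) :
    vAct k R (g * h) P = vAct k R h (vAct k R g P) := by
  apply Subtype.ext
  show substHom R (g * h) P.1 = substHom R h (substHom R g P.1)
  rw [substHom_mul, AlgHom.comp_apply]

lemma vAct_inv_apply' (k : ℕ) (R : Type) [CommRing R] [Algebra ℚ R] (g : GL (Fin 2) ℚ)
    (P : V k R) : vAct k R g (vAct k R g⁻¹ P) = P := by
  rw [← vAct_mul, inv_mul_cancel, vAct_one]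

lemma vAct_injective (k : ℕ) (R : Type) [CommRing R] [Algebra ℚ R] (g : GL (Fin 2) ℚ) :
    Function.Injective (vAct k R g) :=
  Function.LeftInverse.injective (vAct_inv_apply k R g)

lemma homSlash_apply (k : ℕ) (R : Type) [CommRing R] [Algebra ℚ R] (γ : SL(2, ℤ))
    (Φ : Xi0 →+ V k R) (δ : Xi0) :
    homSlash k R γ Φ δ = vAct k R (toGL γ) (Φ (xiAct (toGL γ) δ)) := rfl

/-- Translating `δ` by `γ` replaces `f` by `f|γ`. Agreement is therefore required for all `f` at
once, which makes the subgroup of good `δ` stable under `SL₂(ℤ)`. -/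
theorem eq_of_isEquivariant {N k : ℕ} {Φ Ψ : Fn' N k → (Xi0 →+ V k ℂ)} (hΦ : IsEquivariant Φ)
    (hΨ : IsEquivariant Ψ) (h0 : ∀ f, Φ f symbolInftyZero = Ψ f symbolInftyZero)
    (hr : ∀ f (r : ℚ), Φ f (symbolAtInfty r) = Ψ f (symbolAtInfty r)) : Φ = Ψ := by
  funext f
  ext1 δ
  let A : AddSubgroup Xi0 := ⨅ f, (Φ f - Ψ f).ker
  have hA : ∀ δ, δ ∈ A ↔ ∀ f, Φ f δ = Ψ f δ := by
    intro δ
    simp [A, AddSubgroup.mem_iInf, AddMonoidHom.mem_ker, sub_eq_zero]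
  refine (hA δ).1 (Xi0.mem_of_generators A ((hA _).2 h0) (fun r => (hA _).2 fun f => hr f r) ?_ δ) f
  intro γ δ hδ
  rw [hA] at hδ ⊢
  intro f
  have h1 := hδ (fnSlash' γ f)
  rw [hΦ, hΨ, homSlash_apply, homSlash_apply] at h1
  exact vAct_injective k ℂ _ h1

/-! ### Functions on `(ℤ/N)²` -/

/-- The reduction of `γ` modulo `N`. -/
def matMod (N : ℕ) (γ : SL(2, ℤ)) : Matrix (Fin 2) (Fin 2) (ZMod N) :=
  γ.1.map (Int.cast : ℤ → ZMod N)

lemma matMod_mul (N : ℕ) (γ γ' : SL(2, ℤ)) : matMod N (γ * γ') = matMod N γ * matMod N γ' := by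
  have := Matrix.map_mul (L := γ.1) (M := γ'.1) (f := Int.castRingHom (ZMod N))
  exact this

lemma matMod_one (N : ℕ) : matMod N 1 = 1 := by
  show (1 : Matrix (Fin 2) (Fin 2) ℤ).map (Int.cast : ℤ → ZMod N) = 1
  simp

lemma fnSlash_apply {N : ℕ} (γ : SL(2, ℤ)) (f : Fn N) (v : Fin 2 → ZMod N) :
    fnSlash γ f v = f (Matrix.vecMul v (matMod N γ⁻¹)) := rfl

lemma fnSlash_mul {N : ℕ} (γ γ' : SL(2, ℤ)) (f : Fn N) :
    fnSlash (γ * γ') f = fnSlash γ' (fnSlash γ f) := by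
  funext v
  simp only [fnSlash_apply, Matrix.vecMul_vecMul, mul_inv_rev, matMod_mul]

lemma fnSlash_one {N : ℕ} (f : Fn N) : fnSlash 1 f = f := by
  funext v
  simp only [fnSlash_apply, inv_one, matMod_one, Matrix.vecMul_one]

lemma fnSlash'_mul {N k : ℕ} (γ γ' : SL(2, ℤ)) (f : Fn' N k) :
    fnSlash' (γ * γ') f = fnSlash' γ' (fnSlash' γ f) :=
  Subtype.ext (fnSlash_mul γ γ' f.1)

/-- The permutation `v ↦ v γ` of `(ℤ/N)²`. -/
def vecMulEquiv (N : ℕ) (γ : SL(2, ℤ)) : (Fin 2 → ZMod N) ≃ (Fin 2 → ZMod N) where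
  toFun v := Matrix.vecMul v (matMod N γ)
  invFun v := Matrix.vecMul v (matMod N γ⁻¹)
  left_inv v := by
    simp only [Matrix.vecMul_vecMul, ← matMod_mul, mul_inv_cancel, matMod_one, Matrix.vecMul_one]
  right_inv v := by
    simp only [Matrix.vecMul_vecMul, ← matMod_mul, inv_mul_cancel, matMod_one, Matrix.vecMul_one]

lemma fnSlash_vecMulEquiv {N : ℕ} (γ : SL(2, ℤ)) (f : Fn N) (v : Fin 2 → ZMod N) :
    fnSlash γ f (vecMulEquiv N γ v) = f v :=
  congrArg f ((vecMulEquiv N γ).symm_apply_apply v)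

lemma vecMulEquiv_apply_zero {N : ℕ} (γ : SL(2, ℤ)) (v : Fin 2 → ZMod N) :
    vecMulEquiv N γ v 0 = v 0 * (γ 0 0 : ℤ) + v 1 * (γ 1 0 : ℤ) := by
  simp [vecMulEquiv, matMod, Matrix.vecMul, dotProduct, Fin.sum_univ_two]

lemma vecMulEquiv_apply_one {N : ℕ} (γ : SL(2, ℤ)) (v : Fin 2 → ZMod N) :
    vecMulEquiv N γ v 1 = v 0 * (γ 0 1 : ℤ) + v 1 * (γ 1 1 : ℤ) := by
  simp [vecMulEquiv, matMod, Matrix.vecMul, dotProduct, Fin.sum_univ_two]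

/-- The pairing `am - bn` in the exponent is a determinant, invariant when `SL₂` acts on both row
vectors. -/
lemma fourier_fnSlash {N : ℕ} [NeZero N] (γ : SL(2, ℤ)) (f : Fn N) :
    fourier (fnSlash γ f) = fnSlash γ (fourier f) := by
  funext v
  obtain ⟨v, rfl⟩ := (vecMulEquiv N γ).surjective v
  rw [fnSlash_vecMulEquiv, fourier, fourier, ← (vecMulEquiv N γ).sum_comp]
  congr 1
  refine Finset.sum_congr rfl fun w _ => ?_
  rw [fnSlash_vecMulEquiv]
  congr 2
  simp only [vecMulEquiv_apply_zero, vecMulEquiv_apply_one]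
  have h : ((γ 0 0 : ℤ) : ZMod N) * (γ 1 1 : ℤ) - (γ 0 1 : ℤ) * (γ 1 0 : ℤ) = 1 := by
    have := γ.det_coe
    rw [Matrix.det_fin_two] at this
    exact_mod_cast congrArg (Int.cast : ℤ → ZMod N) this
  linear_combination (w 0 * v 1 - w 1 * v 0) * h

end EisensteinDedekind

namespace EisensteinDedekind

/-! ### Rationality of cohomology classes -/

/-- The homomorphism `[Z₁, Z₂] ↦ U(Z₂) - U(Z₁)`. -/
noncomputable def divisorHom {M : Type*} [AddCommGroup M] (U : InfCusp → M) : Xi0 →+ M :=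
  (Finsupp.linearCombination ℤ U).toAddMonoidHom.comp Xi0.subtype

lemma divisorHom_bracket {M : Type*} [AddCommGroup M] (U : InfCusp → M) (Z₁ Z₂ : InfCusp) :
    divisorHom U (bracket Z₁ Z₂) = U Z₂ - U Z₁ := by
  simp [divisorHom, bracket]

/-! ### Equivariant functions on the cusps -/

section Boundary

variable {N k : ℕ} (u : Fn' N k → V k ℂ)

/-- The extension of `u` from the cusp `∞` to all cusps by `SL₂(ℤ)`-equivariance. -/
noncomputable def boundaryCochain (f : Fn' N k) (Z : InfCusp) : V k ℂ :=
  vAct k ℂ (toGL (exists_smul_infty_eq Z.1.1).choose⁻¹)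
    (u (fnSlash' (exists_smul_infty_eq Z.1.1).choose f))

variable {u}
  (hu : ∀ (γ : SL(2, ℤ)) (f : Fn' N k), toGL γ • (OnePoint.infty : OnePoint ℚ) = OnePoint.infty →
    u (fnSlash' γ f) = vAct k ℂ (toGL γ) (u f))

include hu

/-- Two matrices carrying `∞` to the same cusp differ on the right by an element of the stabilizer
of `∞`, and `hu` absorbs that element. So the chosen matrix is immaterial. -/
lemma boundaryCochain_eq (f : Fn' N k) (Z : InfCusp) (γ : SL(2, ℤ))
    (h : toGL γ • OnePoint.infty = Z.1.1) :
    boundaryCochain u f Z = vAct k ℂ (toGL γ⁻¹) (u (fnSlash' γ f)) := by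
  set σ := (exists_smul_infty_eq Z.1.1).choose with hσ
  have h1 : toGL σ • OnePoint.infty = Z.1.1 := (exists_smul_infty_eq Z.1.1).choose_spec
  have h2 : toGL (γ⁻¹ * σ) • (OnePoint.infty : OnePoint ℚ) = OnePoint.infty := by
    rw [toGL, map_mul, map_inv, mul_smul, h1, ← h, inv_smul_smul]
  have h3 := hu (γ⁻¹ * σ) (fnSlash' γ f) h2
  rw [← fnSlash'_mul, mul_inv_cancel_left] at h3
  rw [boundaryCochain, ← hσ, h3, ← vAct_mul, toGL, toGL, toGL, ← map_mul]
  congr 2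
  group

/-- If `σ` carries `∞` to the cusp under `Z`, then `γ σ` serves for `γ Z`. -/
lemma vAct_boundaryCochain (γ : SL(2, ℤ)) (f : Fn' N k) (Z : InfCusp) :
    vAct k ℂ (toGL γ) (boundaryCochain u f (toGL γ • Z))
      = boundaryCochain u (fnSlash' γ f) Z := by
  obtain ⟨σ, hσ⟩ := exists_smul_infty_eq Z.1.1
  rw [boundaryCochain_eq hu _ Z σ hσ, boundaryCochain_eq hu f (toGL γ • Z) (γ * σ), ← vAct_mul,
    ← fnSlash'_mul, toGL, toGL, toGL, ← map_mul]
  · congr 2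
    group
  · rw [toGL, map_mul, mul_smul, hσ, InfCusp.smul_fst]

lemma isEquivariant_divisorHom :
    IsEquivariant fun f : Fn' N k => divisorHom (boundaryCochain u f) := by
  intro γ f
  apply addMonoidHom_Xi0_ext zInfty
  intro Z
  rw [homSlash_apply, xiAct_bracket, divisorHom_bracket, divisorHom_bracket, map_sub,
    vAct_boundaryCochain hu, vAct_boundaryCochain hu]

lemma divisorHom_symbolInftyZero (f : Fn' N k) :
    divisorHom (boundaryCochain u f) symbolInftyZero
      = vAct k ℂ (toGL ModularGroup.S⁻¹) (u (fnSlash' ModularGroup.S f)) - u f := by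
  have h : symbolInftyZero = bracket zInfty (toGL ModularGroup.S • zInfty) := by
    rw [smul_S_zInfty]; rfl
  rw [h, divisorHom_bracket, boundaryCochain_eq hu f zInfty 1,
    boundaryCochain_eq hu f (toGL ModularGroup.S • zInfty) ModularGroup.S rfl]
  · congr 1
    have h2 : fnSlash' 1 f = f := Subtype.ext (fnSlash_one f.1)
    rw [h2, inv_one, toGL, map_one, vAct_one]
  · rw [toGL, map_one, one_smul]; rfl

/-- Both ends lie over the cusp `∞`, and the cochain only sees the cusp. The correction thus leaves
these values untouched. -/
lemma divisorHom_symbolAtInfty (f : Fn' N k) (r : ℚ) :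
    divisorHom (boundaryCochain u f) (symbolAtInfty r) = 0 := by
  rw [symbolAtInfty, infinitesimalSymbol, divisorHom_bracket, sub_eq_zero]
  rw [boundaryCochain_eq hu f _ 1, boundaryCochain_eq hu f _ 1]
  · rw [toGL, map_one, one_smul]; rfl
  · rw [toGL, map_one, one_smul]; rfl

end Boundary

/-! ### Descent to rational coefficients -/

lemma vBaseChange_injective (k : ℕ) : Function.Injective (vBaseChange k) := by
  intro P Q h
  apply Subtype.ext
  exact MvPolynomial.map_injective _ (algebraMap ℚ ℂ).injective (congrArg Subtype.val h)

lemma homSlash_add (k : ℕ) (γ : SL(2, ℤ)) (Φ Ψ : Xi0 →+ V k ℂ) :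
    homSlash k ℂ γ (Φ + Ψ) = homSlash k ℂ γ Φ + homSlash k ℂ γ Ψ := by
  ext1 δ
  simp [homSlash_apply]

/-- `f` has rational values. -/
def IsRationalFn {N : ℕ} (f : Fn N) : Prop := ∀ v, ∃ q : ℚ, f v = (q : ℂ)

lemma IsRationalFn.slash {N : ℕ} {f : Fn N} (hf : IsRationalFn f) (γ : SL(2, ℤ)) :
    IsRationalFn (fnSlash γ f) := fun _ => hf _

/-- The device of `eq_of_isEquivariant` again: rational-valued functions are stable under `SL₂(ℤ)`,
so quantifying over all of them gives a stable subgroup of `Ξ₀`. -/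
theorem mem_range_of_isEquivariant {N k : ℕ} {Φ : Fn' N k → (Xi0 →+ V k ℂ)} (hΦ : IsEquivariant Φ)
    (h0 : ∀ f : Fn' N k, IsRationalFn f.1 → Φ f symbolInftyZero ∈ LinearMap.range (vBaseChange k))
    (hr : ∀ (f : Fn' N k) (r : ℚ), IsRationalFn f.1 →
      Φ f (symbolAtInfty r) ∈ LinearMap.range (vBaseChange k))
    (f : Fn' N k) (hf : IsRationalFn f.1) (δ : Xi0) :
    Φ f δ ∈ LinearMap.range (vBaseChange k) := by
  let A : AddSubgroup Xi0 := ⨅ f : {f : Fn' N k // IsRationalFn f.1},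
    (LinearMap.range (vBaseChange k)).toAddSubgroup.comap (Φ f.1)
  have hA : ∀ δ, δ ∈ A ↔ ∀ f : Fn' N k, IsRationalFn f.1 →
      Φ f δ ∈ LinearMap.range (vBaseChange k) := by
    intro δ
    simp [A, AddSubgroup.mem_iInf]
  refine (hA δ).1 (Xi0.mem_of_generators A ((hA _).2 h0) (fun r => (hA _).2 fun f => hr f r) ?_ δ)
    f hf
  intro γ δ hδ
  rw [hA] at hδ ⊢
  intro f hf
  obtain ⟨P, hP⟩ := hδ (fnSlash' γ f) (hf.slash γ)
  rw [hΦ, homSlash_apply] at hP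
  refine ⟨vAct k ℚ (toGL γ)⁻¹ P, ?_⟩
  rw [vBaseChange_vAct, hP, vAct_inv_apply]

lemma isGammaInvariant_of_isEquivariant {N k : ℕ} {Φ : Fn' N k → (Xi0 →+ V k ℂ)}
    (hΦ : IsEquivariant Φ) {Γ : Subgroup SL(2, ℤ)} {f : Fn' N k}
    (hf : ∀ γ ∈ Γ, fnSlash γ f.1 = f.1) : IsGammaInvariant Γ k ℂ (Φ f) := by
  intro γ hγ
  rw [← hΦ]
  congr 1
  exact Subtype.ext (hf γ hγ)

lemma h1BaseChange_h1Class (Γ : Subgroup SL(2, ℤ)) (k : ℕ) (Z : InfCusp) (Φ : Xi0 →+ V k ℚ)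
    (hΦ : IsGammaInvariant Γ k ℚ Φ) (Ψ : Xi0 →+ V k ℂ) (hΨ : IsGammaInvariant Γ k ℂ Ψ)
    (h : ∀ δ, vBaseChange k (Φ δ) = Ψ δ) :
    h1BaseChange Γ k (h1Class Γ k ℚ Z Φ hΦ) = h1Class Γ k ℂ Z Ψ hΨ := by
  have e : h1BaseChange Γ k = groupCohomology.map (MonoidHom.id Γ)
    (A := vRep Γ k ℚ) (B := vRep Γ k ℂ) (vRepBaseChange Γ k) 1 := rfl
  rw [h1Class, h1Class, e]
  have h1 := fun x => groupCohomology.H1π_comp_map_apply (MonoidHom.id Γ)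
    (A := vRep Γ k ℚ) (B := vRep Γ k ℂ) (vRepBaseChange Γ k) x
  rw [h1]
  congr 1
  apply Subtype.ext
  funext γ
  exact h _

/-- On `[Z, γ Z]` the added term is `U(γ Z) - U(Z)`, and the invariance `hU` identifies it with the
coboundary of `U(Z)`. -/
lemma h1Class_add_divisorHom (Γ : Subgroup SL(2, ℤ)) (k : ℕ) (Z : InfCusp) (Φ Ψ : Xi0 →+ V k ℂ)
    (hΦ : IsGammaInvariant Γ k ℂ Φ) (hΨ : IsGammaInvariant Γ k ℂ Ψ) (U : InfCusp → V k ℂ)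
    (hU : ∀ γ ∈ Γ, ∀ Y, vAct k ℂ (toGL γ) (U (toGL γ • Y)) = U Y)
    (h : Ψ = Φ + divisorHom U) :
    h1Class Γ k ℂ Z Ψ hΨ = h1Class Γ k ℂ Z Φ hΦ := by
  rw [h1Class, h1Class, groupCohomology.H1π_eq_iff]
  refine ⟨U Z, ?_⟩
  funext γ
  have h1 := congrArg (fun Θ : Xi0 →+ V k ℂ => Θ (bracket Z (toGL γ • Z))) h
  simp only [AddMonoidHom.add_apply, divisorHom_bracket] at h1
  have h2 : vAct k ℂ (toGL (γ : SL(2, ℤ))⁻¹) (U Z) = U (toGL γ • Z) := by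
    conv_lhs => rw [← hU γ γ.2 Z]
    rw [toGL, map_inv, vAct_inv_apply]
  have h3 : vAct k ℂ (toGL (γ : SL(2, ℤ))⁻¹) (U Z) - U Z
      = Ψ (bracket Z (toGL γ • Z)) - Φ (bracket Z (toGL γ • Z)) := by
    rw [h2, h1]; abel
  exact h3

/-- By `h0` and `hr`, adding the boundary of the cochain extending `u` gives rational values on
generators. The modified homomorphism then descends to `V_k`, and its class is still that of `Ψ f`.
-/
theorem h1Class_mem_range {N k : ℕ} {Ψ : Fn' N k → (Xi0 →+ V k ℂ)} (hΨ : IsEquivariant Ψ)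
    {u : Fn' N k → V k ℂ}
    (hu : ∀ (γ : SL(2, ℤ)) (f : Fn' N k),
      toGL γ • (OnePoint.infty : OnePoint ℚ) = OnePoint.infty →
      u (fnSlash' γ f) = vAct k ℂ (toGL γ) (u f))
    (h0 : ∀ f : Fn' N k, IsRationalFn f.1 → Ψ f symbolInftyZero +
      (vAct k ℂ (toGL ModularGroup.S⁻¹) (u (fnSlash' ModularGroup.S f)) - u f)
        ∈ LinearMap.range (vBaseChange k))
    (hr : ∀ (f : Fn' N k) (r : ℚ), IsRationalFn f.1 →
      Ψ f (symbolAtInfty r) ∈ LinearMap.range (vBaseChange k))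
    (Γ : Subgroup SL(2, ℤ)) (f : Fn' N k) (hf : IsRationalFn f.1)
    (hΓ : ∀ γ ∈ Γ, fnSlash γ f.1 = f.1) (hinv : IsGammaInvariant Γ k ℂ (Ψ f)) (Z : InfCusp) :
    h1Class Γ k ℂ Z (Ψ f) hinv ∈ Set.range (h1BaseChange Γ k) := by
  let R : Fn' N k → (Xi0 →+ V k ℂ) := fun f => Ψ f + divisorHom (boundaryCochain u f)
  have hR : IsEquivariant R := by
    intro γ f
    have h := isEquivariant_divisorHom hu γ f
    simp only at h
    simp only [R]
    rw [homSlash_add, hΨ, h]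
  have hmem := mem_range_of_isEquivariant hR
    (fun f hf => by
      simpa only [R, AddMonoidHom.add_apply, divisorHom_symbolInftyZero hu] using h0 f hf)
    (fun f r hf => by
      simpa only [R, AddMonoidHom.add_apply, divisorHom_symbolAtInfty hu, add_zero] using hr f r hf)
    f hf
  -- The rational preimages are unique since base change is injective, so additivity and
  -- `Γ`-invariance are inherited.
  choose F hF using hmem
  let Φ : Xi0 →+ V k ℚ :=
    { toFun := F
      map_zero' := vBaseChange_injective k (by rw [hF, map_zero, map_zero])
      map_add' := fun a b => vBaseChange_injective k (by rw [hF, map_add, map_add, hF, hF]) }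
  have hRinv : IsGammaInvariant Γ k ℂ (R f) := isGammaInvariant_of_isEquivariant hR hΓ
  have hΦ : IsGammaInvariant Γ k ℚ Φ := by
    intro γ hγ
    ext1 δ
    apply vBaseChange_injective k
    rw [homSlash_apply, vBaseChange_vAct]
    show vAct k ℂ (toGL γ) (vBaseChange k (F _)) = vBaseChange k (F δ)
    rw [hF, hF, ← homSlash_apply, hRinv γ hγ]
  refine ⟨h1Class Γ k ℚ Z Φ hΦ, ?_⟩
  rw [h1BaseChange_h1Class Γ k Z Φ hΦ (R f) hRinv hF]
  refine h1Class_add_divisorHom Γ k Z (Ψ f) (R f) hinv hRinv (boundaryCochain u f) ?_ rfl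
  intro γ hγ Y
  rw [vAct_boundaryCochain hu]
  congr 1
  exact Subtype.ext (hΓ γ hγ)

end EisensteinDedekind

namespace EisensteinDedekind

/-! ### Integrals along vertical half-lines -/

section Vertical

open Complex MeasureTheory Set Filter Topology

/-- One term of the exponential series: `(c(K+u))^j / j! ≤ exp(c(K+u))`. -/
lemma add_pow_mul_exp_le {c K u : ℝ} (hc : 0 < c) (hK : 0 ≤ K) (hu : 0 ≤ u) (j : ℕ) :
    (K + u) ^ j * Real.exp (-c * u) ≤ j.factorial / c ^ j * Real.exp (c * K) := by
  have h := Real.pow_div_factorial_le_exp (c * (K + u)) (by positivity) j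
  have hj : (0 : ℝ) < j.factorial := by positivity
  rw [mul_pow, div_le_iff₀ hj] at h
  calc (K + u) ^ j * Real.exp (-c * u)
      = (c ^ j * (K + u) ^ j) * (Real.exp (-c * u) / c ^ j) := by field_simp
    _ ≤ (Real.exp (c * (K + u)) * j.factorial) * (Real.exp (-c * u) / c ^ j) := by
        gcongr
    _ = j.factorial / c ^ j * (Real.exp (c * (K + u)) * Real.exp (-c * u)) := by ring
    _ = j.factorial / c ^ j * Real.exp (c * K) := by
        rw [← Real.exp_add]; congr 2; ring

/-- Up to height `U` compactness gives a bound. Above it half of the decay rate absorbs the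
polynomial factor, and the other half, `c / 2`, remains. -/
lemma exists_bound_vertical {f : ℂ → ℂ} (hf : ContinuousOn f {z | 0 < z.im}) {c C A : ℝ}
    (hc : 0 < c) (hb : ∀ z : ℂ, 0 < z.im → A ≤ z.im → ‖f z‖ ≤ C * Real.exp (-c * z.im))
    (j : ℕ) {K : Set ℂ} (hK : IsCompact K) (hKH : K ⊆ {z | 0 < z.im}) :
    ∃ M, ∀ z ∈ K, ∀ u : ℝ, 0 ≤ u → ‖f (z + u * Complex.I) * (z + u * Complex.I) ^ j‖
      ≤ M * Real.exp (-(c / 2) * u) := by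
  obtain ⟨R, hR⟩ := hK.isBounded.exists_norm_le
  set U : ℝ := max A 0
  have hcomp : IsCompact ((fun p : ℂ × ℝ => p.1 + p.2 * Complex.I) '' (K ×ˢ Icc 0 U)) :=
    (hK.prod isCompact_Icc).image (by fun_prop)
  have hsub : ((fun p : ℂ × ℝ => p.1 + p.2 * Complex.I) '' (K ×ˢ Icc 0 U)) ⊆ {z : ℂ | 0 < z.im} := by
    rintro _ ⟨⟨z, u⟩, ⟨hz, hu⟩, rfl⟩
    have := hKH hz
    simp only [mem_ofPred_eq] at this ⊢
    simp
    linarith [hu.1]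
  have hg : ContinuousOn (fun z : ℂ => f z * z ^ j) {z | 0 < z.im} := by fun_prop
  obtain ⟨M₁, hM₁⟩ := hcomp.exists_bound_of_continuousOn (hg.mono hsub)
  have hR0 : 0 ≤ max R 0 := le_max_right _ _
  refine ⟨max M₁ 0 * Real.exp (c / 2 * U)
    + max C 0 * (j.factorial / (c / 2) ^ j * Real.exp (c / 2 * max R 0)), fun z hz u hu => ?_⟩
  have hz' : 0 < z.im := hKH hz
  have him : (z + u * Complex.I).im = z.im + u := by simp
  rw [add_mul]
  rcases le_total u U with h | h
  · have h1 := hM₁ (z + u * Complex.I) ⟨(z, u), ⟨hz, hu, h⟩, rfl⟩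
    have h2 : max M₁ 0 ≤ max M₁ 0 * Real.exp (c / 2 * U) * Real.exp (-(c / 2) * u) := by
      rw [mul_assoc, ← Real.exp_add]
      apply le_mul_of_one_le_right (le_max_right _ _)
      apply Real.one_le_exp
      nlinarith
    have h3 : 0 ≤ max C 0 * (j.factorial / (c / 2) ^ j * Real.exp (c / 2 * max R 0))
        * Real.exp (-(c / 2) * u) := by
      have : 0 ≤ max C 0 := le_max_right _ _
      positivity
    linarith [le_max_left M₁ 0]
  · have h1 := hb (z + u * Complex.I) (by rw [him]; linarith) (by
      rw [him]; linarith [le_max_left A 0])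
    have h2 : ‖z + u * Complex.I‖ ≤ max R 0 + u := by
      refine (norm_add_le _ _).trans ?_
      have := (hR z hz).trans (le_max_left R 0)
      have h4 : ‖(u : ℂ) * Complex.I‖ = u := by simp [abs_of_nonneg hu]
      rw [h4]; linarith
    have h3 : 0 ≤ max M₁ 0 * Real.exp (c / 2 * U) * Real.exp (-(c / 2) * u) := by
      have : 0 ≤ max M₁ 0 := le_max_right _ _
      positivity
    have h5 : ‖f (z + u * Complex.I)‖ ≤ max C 0 * (Real.exp (-(c / 2) * u) * Real.exp (-(c / 2) * u)) := by
      refine h1.trans ?_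
      rw [← Real.exp_add]
      have : Real.exp (-c * (z + u * Complex.I).im) ≤ Real.exp (-(c / 2) * u + -(c / 2) * u) := by
        rw [him]; apply Real.exp_le_exp.2; nlinarith
      gcongr
      exact le_max_left _ _
    have h6 := add_pow_mul_exp_le (half_pos hc) hR0 hu j
    rw [norm_mul, norm_pow]
    have h7 : ‖f (z + u * Complex.I)‖ * ‖z + u * Complex.I‖ ^ j ≤
        max C 0 * (Real.exp (-(c / 2) * u) * Real.exp (-(c / 2) * u)) * (max R 0 + u) ^ j := by
      have : 0 ≤ max C 0 := le_max_right _ _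
      gcongr
    have h8 : max C 0 * (Real.exp (-(c / 2) * u) * Real.exp (-(c / 2) * u)) * (max R 0 + u) ^ j
        ≤ max C 0 * (j.factorial / (c / 2) ^ j * Real.exp (c / 2 * max R 0))
          * Real.exp (-(c / 2) * u) := by
      calc _ = max C 0 * ((max R 0 + u) ^ j * Real.exp (-(c / 2) * u))
              * Real.exp (-(c / 2) * u) := by ring
        _ ≤ _ := by
          have : 0 ≤ max C 0 := le_max_right _ _
          gcongr
    linarith

lemma integrableOn_of_exp_bound {g : ℝ → ℂ} {c M : ℝ} (hc : 0 < c)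
    (hg : ContinuousOn g (Ici 0)) (hM : ∀ u, 0 ≤ u → ‖g u‖ ≤ M * Real.exp (-c * u)) :
    IntegrableOn g (Ioi 0) := by
  refine Integrable.mono' ((exp_neg_integrableOn_Ioi 0 hc).const_mul M)
    ((hg.mono Ioi_subset_Ici_self).aestronglyMeasurable measurableSet_Ioi) ?_
  filter_upwards [ae_restrict_mem measurableSet_Ioi] with u hu
  exact hM u (le_of_lt hu)

lemma continuousOn_vertical {g : ℂ → ℂ} (hg : ContinuousOn g {z | 0 < z.im}) {z : ℂ}
    (hz : 0 < z.im) : ContinuousOn (fun u : ℝ => g (z + u * Complex.I)) (Ici 0) := by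
  refine hg.comp (by fun_prop) fun u hu => ?_
  have : (0 : ℝ) ≤ u := hu
  simp
  linarith

/-- The derivative of `z ↦ ∫_z^{z + i∞} g`, up to the factor `i`. -/
lemma hasDerivAt_integral_vertical {g : ℂ → ℂ} (hg : DifferentiableOn ℂ g {z | 0 < z.im})
    {c : ℝ} (hc : 0 < c)
    (hb : ∀ K : Set ℂ, IsCompact K → K ⊆ {z | 0 < z.im} → ∃ M, ∀ z ∈ K, ∀ u : ℝ, 0 ≤ u →
      ‖g (z + u * Complex.I)‖ ≤ M * Real.exp (-c * u)) {z₀ : ℂ} (hz₀ : 0 < z₀.im) :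
    HasDerivAt (fun z => ∫ u in Ioi (0 : ℝ), g (z + u * Complex.I)) (Complex.I * g z₀) z₀ := by
  have hopen : IsOpen {z : ℂ | 0 < z.im} := isOpen_lt continuous_const continuous_im
  have hd : ∀ z : ℂ, 0 < z.im → DifferentiableAt ℂ g z := fun z hz =>
    (hg z hz).differentiableAt (hopen.mem_nhds hz)
  -- Radius `2ε` leaves room for discs of radius `ε` around every point of the `ε`-ball, so that
  -- Cauchy's estimate carries the bound from `g` to `deriv g`.
  obtain ⟨ε, hε, hball⟩ : ∃ ε > 0, Metric.closedBall z₀ (2 * ε) ⊆ {z : ℂ | 0 < z.im} := by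
    obtain ⟨ε, hε, h⟩ := Metric.nhds_basis_closedBall.mem_iff.1 (hopen.mem_nhds hz₀)
    exact ⟨ε / 2, by positivity, by rwa [mul_div_cancel₀ _ two_ne_zero]⟩
  obtain ⟨M, hM⟩ := hb _ (isCompact_closedBall z₀ (2 * ε)) hball
  have him : ∀ z : ℂ, ∀ u : ℝ, (z + u * Complex.I).im = z.im + u := by intro z u; simp
  have hderivbound : ∀ z ∈ Metric.ball z₀ ε, ∀ u : ℝ, 0 ≤ u →
      ‖deriv g (z + u * Complex.I)‖ ≤ M * Real.exp (-c * u) / ε := by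
    intro z hz u hu
    have hsub : ∀ w ∈ Metric.closedBall (z + u * Complex.I) ε,
        w - u * Complex.I ∈ Metric.closedBall z₀ (2 * ε) := by
      intro w hw
      rw [mem_closedBall_iff_norm] at hw ⊢
      rw [mem_ball_iff_norm] at hz
      calc ‖w - u * Complex.I - z₀‖ = ‖(w - (z + u * Complex.I)) + (z - z₀)‖ := by congr 1; ring
        _ ≤ ε + ε := (norm_add_le _ _).trans (by linarith)
        _ = 2 * ε := by ring
    refine norm_deriv_le_of_forall_mem_sphere_norm_le hε ?_ ?_
    · apply DifferentiableOn.diffContOnCl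
      rw [closure_ball _ hε.ne']
      intro w hw
      apply (hd w _).differentiableWithinAt
      have h1 := hball (hsub w hw)
      simp only [mem_ofPred_eq, sub_im, mul_im, ofReal_re, Complex.I_im, mul_one, ofReal_im, Complex.I_re, mul_zero,
        add_zero] at h1
      linarith
    · intro w hw
      have := hM _ (hsub w (Metric.sphere_subset_closedBall hw)) u hu
      rwa [sub_add_cancel] at this
  have hM0 : ∀ u : ℝ, 0 ≤ u → ‖g (z₀ + u * Complex.I)‖ ≤ M * Real.exp (-c * u) :=
    hM z₀ (Metric.mem_closedBall_self (by positivity))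
  have hgc := hg.continuousOn
  have hgd : ContinuousOn (deriv g) {z | 0 < z.im} := (hg.deriv hopen).continuousOn
  have hint : IntegrableOn (fun u : ℝ => deriv g (z₀ + u * Complex.I)) (Ioi 0) := by
    refine integrableOn_of_exp_bound hc (continuousOn_vertical hgd hz₀) (M := M / ε)
      fun u hu => ?_
    refine (hderivbound z₀ (Metric.mem_ball_self hε) u hu).trans (le_of_eq (by ring))
  have key := hasDerivAt_integral_of_dominated_loc_of_deriv_le
    (μ := volume.restrict (Ioi (0 : ℝ))) (F := fun z (u : ℝ) => g (z + u * Complex.I))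
    (F' := fun z (u : ℝ) => deriv g (z + u * Complex.I)) (x₀ := z₀)
    (bound := fun u => M * Real.exp (-c * u) / ε) (Metric.ball_mem_nhds z₀ hε) ?_ ?_ ?_ ?_ ?_ ?_
  · have h2 := key.2
    -- Along the half-line `deriv g` has the primitive `-i g`, which tends to zero. Only the lower
    -- endpoint contributes.
    have hI : ∫ u in Ioi (0 : ℝ), deriv g (z₀ + u * Complex.I) = Complex.I * g z₀ := by
      have h3 : ∀ u ∈ Ioi (0 : ℝ), HasDerivAt (fun u : ℝ => -Complex.I * g (z₀ + u * Complex.I))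
          (deriv g (z₀ + u * Complex.I)) u := by
        intro u hu
        have h4 : HasDerivAt g (deriv g (z₀ + u * Complex.I)) (z₀ + u * Complex.I) :=
          (hd _ (by rw [him]; have : (0 : ℝ) < u := hu; linarith)).hasDerivAt
        have h5 : HasDerivAt (fun u : ℝ => z₀ + (u : ℂ) * Complex.I) Complex.I u := by
          simpa using ((ofRealCLM.hasDerivAt (x := u)).mul_const Complex.I).const_add z₀
        have h6 := (h4.comp u h5).const_mul (-Complex.I)
        convert! h6 using 1
        linear_combination (deriv g (z₀ + u * Complex.I)) * Complex.I_mul_I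
      have hcont : ContinuousWithinAt (fun u : ℝ => -Complex.I * g (z₀ + u * Complex.I)) (Ici 0) 0 :=
        (continuousOn_const.mul (continuousOn_vertical hgc hz₀)) 0 self_mem_Ici
      have htend : Tendsto (fun u : ℝ => -Complex.I * g (z₀ + u * Complex.I)) atTop (𝓝 0) := by
        apply squeeze_zero_norm' (a := fun u : ℝ => M * Real.exp (-c * u))
        · filter_upwards [eventually_ge_atTop 0] with u hu
          simpa using hM0 u hu
        · rw [← mul_zero M]
          apply Tendsto.const_mul
          apply Real.tendsto_exp_atBot.comp
          exact tendsto_id.const_mul_atTop_of_neg (neg_lt_zero.2 hc)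
      rw [integral_Ioi_of_hasDerivAt_of_tendsto hcont h3 hint htend]
      simp
    rwa [hI] at h2
  · filter_upwards [Metric.ball_mem_nhds z₀ hε] with z hz
    have hz' : 0 < z.im :=
      hball (Metric.ball_subset_closedBall (Metric.ball_subset_ball (by linarith) hz))
    exact ((continuousOn_vertical hgc hz').mono Ioi_subset_Ici_self).aestronglyMeasurable
      measurableSet_Ioi
  · exact integrableOn_of_exp_bound hc (continuousOn_vertical hgc hz₀) hM0
  · exact hint.aestronglyMeasurable
  · filter_upwards [ae_restrict_mem measurableSet_Ioi] with u hu z hz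
    exact hderivbound z hz u (le_of_lt hu)
  · exact ((exp_neg_integrableOn_Ioi 0 hc).const_mul M).div_const ε
  · filter_upwards [ae_restrict_mem measurableSet_Ioi] with u hu z hz
    have hz' : 0 < z.im :=
      hball (Metric.ball_subset_closedBall (Metric.ball_subset_ball (by linarith) hz))
    have h4 : HasDerivAt g (deriv g (z + u * Complex.I)) (z + u * Complex.I) :=
      (hd _ (by rw [him]; have : (0 : ℝ) < u := hu; linarith)).hasDerivAt
    exact h4.comp_add_const z (u * Complex.I)

end Vertical

end EisensteinDedekind

namespace EisensteinDedekind

/-! ### Eichler integrals -/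

section Eichler

open Complex MeasureTheory Set Filter Topology

/-- `F` is holomorphic and `F - a` decays exponentially at `i∞` for some constant `a`. -/
structure IsRegularAtInfty (F : ℍ → ℂ) : Prop where
  holo : DifferentiableOn ℂ (F ∘ ofComplex) {z | 0 < z.im}
  decay : ∃ a : ℂ, ∃ c > 0, ∃ C A : ℝ, ∀ z : ℍ, A ≤ z.im → ‖F z - a‖ ≤ C * Real.exp (-c * z.im)

lemma tendsto_of_exp_decay {F : ℍ → ℂ} {a : ℂ} {c C A : ℝ} (hc : 0 < c)
    (h : ∀ z : ℍ, A ≤ z.im → ‖F z - a‖ ≤ C * Real.exp (-c * z.im)) :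
    Tendsto F atImInfty (𝓝 a) := by
  rw [tendsto_iff_norm_sub_tendsto_zero]
  have h1 : Tendsto (fun z : ℍ => C * Real.exp (-c * z.im)) atImInfty (𝓝 0) := by
    rw [← mul_zero C]
    refine ((Real.tendsto_exp_atBot.comp
      (tendsto_id.const_mul_atTop_of_neg (neg_lt_zero.2 hc))).comp tendsto_comap (f := UpperHalfPlane.im)).const_mul C
  refine squeeze_zero' (Eventually.of_forall fun _ => norm_nonneg _) ?_ h1
  filter_upwards [(tendsto_comap (f := UpperHalfPlane.im)).eventually_ge_atTop A] with z hz using h z hz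

lemma valueAtInfty_eq_of_tendsto {F : ℍ → ℂ} {a : ℂ} (h : Tendsto F atImInfty (𝓝 a)) :
    valueAtInfty F = a := h.limUnder_eq

lemma IsRegularAtInfty.tendsto {F : ℍ → ℂ} (hF : IsRegularAtInfty F) :
    Tendsto F atImInfty (𝓝 (valueAtInfty F)) := by
  obtain ⟨a, c, hc, C, A, h⟩ := hF.decay
  have := tendsto_of_exp_decay hc h
  rwa [valueAtInfty_eq_of_tendsto this]

lemma IsRegularAtInfty.exists_decay {F : ℍ → ℂ} (hF : IsRegularAtInfty F) :
    ∃ c > 0, ∃ C A : ℝ, ∀ z : ℍ, A ≤ z.im →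
      ‖F z - valueAtInfty F‖ ≤ C * Real.exp (-c * z.im) := by
  obtain ⟨a, c, hc, C, A, h⟩ := hF.decay
  refine ⟨c, hc, C, A, ?_⟩
  rwa [valueAtInfty_eq_of_tendsto (tendsto_of_exp_decay hc h)]

lemma IsRegularAtInfty.exists_bound {F : ℍ → ℂ} (hF : IsRegularAtInfty F) :
    ∃ c > 0, ∀ (j : ℕ) (K : Set ℂ), IsCompact K → K ⊆ {z | 0 < z.im} →
      ∃ M, ∀ z ∈ K, ∀ u : ℝ, 0 ≤ u →
        ‖(F (ofComplex (z + u * Complex.I)) - valueAtInfty F) * (z + u * Complex.I) ^ j‖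
          ≤ M * Real.exp (-c * u) := by
  obtain ⟨c, hc, C, A, h⟩ := hF.exists_decay
  refine ⟨c / 2, half_pos hc, fun j K hK hKH => ?_⟩
  refine exists_bound_vertical (f := fun z => F (ofComplex z) - valueAtInfty F)
    (hF.holo.continuousOn.sub continuousOn_const) hc (C := C) (A := A) (fun z hz hA => ?_) j hK hKH
  have := h ⟨z, hz⟩ hA
  rw [← ofComplex_apply_of_im_pos hz] at this
  refine this.trans (le_of_eq ?_)
  rw [ofComplex_apply_of_im_pos hz]
  rfl

lemma IsRegularAtInfty.differentiableOn {F : ℍ → ℂ} (hF : IsRegularAtInfty F) (j : ℕ) :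
    DifferentiableOn ℂ (fun z => (F (ofComplex z) - valueAtInfty F) * z ^ j) {z | 0 < z.im} :=
  (hF.holo.sub (differentiableOn_const _)).mul (differentiableOn_pow j)

lemma IsRegularAtInfty.integrableOn {F : ℍ → ℂ} (hF : IsRegularAtInfty F) (j : ℕ) {z : ℂ}
    (hz : 0 < z.im) : IntegrableOn (fun u : ℝ =>
      (F (ofComplex (z + u * Complex.I)) - valueAtInfty F) * (z + u * Complex.I) ^ j) (Ioi 0) := by
  obtain ⟨c, hc, hb⟩ := hF.exists_bound
  obtain ⟨M, hM⟩ := hb j {z} isCompact_singleton (by simpa using hz)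
  exact integrableOn_of_exp_bound hc
    (continuousOn_vertical (hF.differentiableOn j).continuousOn hz) (hM z rfl)

/-- The coefficients of the Eichler integral. -/
noncomputable def eichlerMoment (F : ℍ → ℂ) (j : ℕ) (τ : ℂ) : ℂ :=
  -(∫ u in Set.Ioi (0 : ℝ), (F (ofComplex (τ + u * Complex.I)) - valueAtInfty F) *
        (τ + u * Complex.I) ^ j * Complex.I)
      + valueAtInfty F * ∫ s in (0 : ℝ)..1, ((s : ℂ) * τ) ^ j * τ

lemma eichlerIntegral_eq (k : ℕ) (F : ℍ → ℂ) (τ : ℍ) :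
    eichlerIntegral k F τ = momentPoly k fun j => eichlerMoment F j τ := rfl

lemma integral_segment (j : ℕ) (τ : ℂ) :
    ∫ s in (0 : ℝ)..1, ((s : ℂ) * τ) ^ j * τ = τ ^ (j + 1) / (j + 1) := by
  have h : ∀ s : ℝ, ((s : ℂ) * τ) ^ j * τ = ((s ^ j : ℝ) : ℂ) * τ ^ (j + 1) := by
    intro s; push_cast; ring
  simp_rw [h]
  rw [intervalIntegral.integral_mul_const, intervalIntegral.integral_ofReal, integral_pow]
  push_cast
  simp
  ring

/-- The tail contributes `(F - a₀) τ^j` and the segment `a₀ τ^j`. The subtraction made for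
convergence cancels. -/
lemma hasDerivAt_eichlerMoment {F : ℍ → ℂ} (hF : IsRegularAtInfty F) (j : ℕ) {τ : ℂ}
    (hτ : 0 < τ.im) : HasDerivAt (eichlerMoment F j) (F (ofComplex τ) * τ ^ j) τ := by
  obtain ⟨c, hc, hb⟩ := hF.exists_bound
  have h1 := hasDerivAt_integral_vertical (hF.differentiableOn j) hc (hb j) hτ
  have h2 : HasDerivAt (fun τ : ℂ => τ ^ (j + 1) / ((j : ℂ) + 1)) (τ ^ j) τ := by
    have := (hasDerivAt_pow (j + 1) τ).div_const ((j : ℂ) + 1)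
    convert! this using 1
    have : (j : ℂ) + 1 ≠ 0 := by exact_mod_cast j.succ_ne_zero
    push_cast
    field_simp
  have h3 := ((h1.mul_const Complex.I).neg).add (h2.const_mul (valueAtInfty F))
  have h4 : eichlerMoment F j = fun τ => -((∫ u in Ioi (0 : ℝ),
      (F (ofComplex (τ + u * Complex.I)) - valueAtInfty F) * (τ + u * Complex.I) ^ j) * Complex.I)
      + valueAtInfty F * (τ ^ (j + 1) / ((j : ℂ) + 1)) := by
    funext τ
    rw [eichlerMoment, integral_segment, MeasureTheory.integral_mul_const]
  rw [h4]
  convert! h3 using 1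
  linear_combination ((F (ofComplex τ) - valueAtInfty F) * τ ^ j) * Complex.I_mul_I

/-- Evaluation of an element of `V_k(ℂ)`. -/
noncomputable def evalV {k : ℕ} (x y : ℂ) (P : V k ℂ) : ℂ :=
  MvPolynomial.eval ![x, y] (P : MvPolynomial (Fin 2) ℂ)

lemma evalV_ext {k : ℕ} {P Q : V k ℂ} (h : ∀ x y, evalV x y P = evalV x y Q) : P = Q := by
  apply Subtype.ext
  apply MvPolynomial.funext
  intro v
  have : v = ![v 0, v 1] := by ext i; fin_cases i <;> rfl
  rw [this]
  exact h _ _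

lemma evalV_add {k : ℕ} (x y : ℂ) (P Q : V k ℂ) : evalV x y (P + Q) = evalV x y P + evalV x y Q := by
  simp [evalV]

lemma evalV_sub {k : ℕ} (x y : ℂ) (P Q : V k ℂ) : evalV x y (P - Q) = evalV x y P - evalV x y Q := by
  simp [evalV]

lemma evalV_smul {k : ℕ} (x y c : ℂ) (P : V k ℂ) : evalV x y (c • P) = c * evalV x y P := by
  simp [evalV]

lemma evalV_zero {k : ℕ} (x y : ℂ) : evalV x y (0 : V k ℂ) = 0 := by
  simp [evalV]

lemma evalV_momentPoly (k : ℕ) (c : ℕ → ℂ) (x y : ℂ) :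
    evalV x y (momentPoly k c)
      = ∑ j ∈ Finset.range (k - 1), ((k - 2).choose j : ℂ) * c j * (x ^ j * y ^ (k - 2 - j)) := by
  simp [evalV, momentPoly, map_sum]

lemma evalV_vAct (k : ℕ) (g : GL (Fin 2) ℚ) (P : V k ℂ) (x y : ℂ) :
    evalV x y (vAct k ℂ g P)
      = evalV ((g 1 1 : ℂ) * x - (g 1 0 : ℂ) * y) (-(g 0 1 : ℂ) * x + (g 0 0 : ℂ) * y) P := by
  show MvPolynomial.eval ![x, y] (substHom ℂ g P.1) = _
  have h : (MvPolynomial.eval ![x, y]).comp (substHom ℂ g).toRingHom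
      = MvPolynomial.eval ![(g 1 1 : ℂ) * x - (g 1 0 : ℂ) * y,
          -(g 0 1 : ℂ) * x + (g 0 0 : ℂ) * y] := by
    apply MvPolynomial.ringHom_ext
    · intro a; simp
    · intro i; fin_cases i <;> simp [substHom]
  exact congrArg (fun φ => φ P.1) h

lemma sum_choose_mul (k : ℕ) (hk : 2 ≤ k) (t x y : ℂ) :
    ∑ j ∈ Finset.range (k - 1), ((k - 2).choose j : ℂ) * t ^ j * (x ^ j * y ^ (k - 2 - j))
      = (t * x + y) ^ (k - 2) := by
  rw [add_pow, show k - 2 + 1 = k - 1 by omega]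
  refine Finset.sum_congr rfl fun j _ => ?_
  rw [mul_pow]; ring

/-- The evaluation of the Eichler integral as a function on `ℂ`. -/
noncomputable def eichlerEval (k : ℕ) (F : ℍ → ℂ) (x y τ : ℂ) : ℂ :=
  ∑ j ∈ Finset.range (k - 1),
    ((k - 2).choose j : ℂ) * eichlerMoment F j τ * (x ^ j * y ^ (k - 2 - j))

lemma evalV_eichlerIntegral (k : ℕ) (F : ℍ → ℂ) (τ : ℍ) (x y : ℂ) :
    evalV x y (eichlerIntegral k F τ) = eichlerEval k F x y τ := by
  rw [eichlerIntegral_eq, evalV_momentPoly]; rfl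

/-- The binomial theorem reassembles the moments into a primitive of the period integrand, which is
what makes defects independent of the base point. -/
lemma hasDerivAt_eichlerEval {k : ℕ} (hk : 2 ≤ k) {F : ℍ → ℂ} (hF : IsRegularAtInfty F)
    (x y : ℂ) {τ : ℂ} (hτ : 0 < τ.im) :
    HasDerivAt (eichlerEval k F x y) (F (ofComplex τ) * (τ * x + y) ^ (k - 2)) τ := by
  have h := HasDerivAt.fun_sum (u := Finset.range (k - 1)) fun j _ =>
    ((hasDerivAt_eichlerMoment hF j hτ).const_mul ((k - 2).choose j : ℂ)).mul_const
      (x ^ j * y ^ (k - 2 - j))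
  unfold eichlerEval
  convert! h using 1
  rw [← sum_choose_mul k hk, Finset.mul_sum]
  exact Finset.sum_congr rfl fun j _ => by ring

/-- For use with translations, which mix the separate moments but act simply on `tx + y`. -/
lemma eichlerEval_eq_integral {k : ℕ} (hk : 2 ≤ k) {F : ℍ → ℂ} (hF : IsRegularAtInfty F)
    (x y : ℂ) {τ : ℂ} (hτ : 0 < τ.im) :
    eichlerEval k F x y τ =
      -(∫ u in Set.Ioi (0 : ℝ), (F (ofComplex (τ + u * Complex.I)) - valueAtInfty F) *
        ((τ + u * Complex.I) * x + y) ^ (k - 2) * Complex.I)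
      + valueAtInfty F * ∑ j ∈ Finset.range (k - 1),
          ((k - 2).choose j : ℂ) * (τ ^ (j + 1) / (j + 1)) * (x ^ j * y ^ (k - 2 - j)) := by
  have h1 : ∀ u : ℝ, (F (ofComplex (τ + u * Complex.I)) - valueAtInfty F) *
        ((τ + u * Complex.I) * x + y) ^ (k - 2) * Complex.I
      = ∑ j ∈ Finset.range (k - 1), (((k - 2).choose j : ℂ) * (x ^ j * y ^ (k - 2 - j)) * Complex.I)
        * ((F (ofComplex (τ + u * Complex.I)) - valueAtInfty F) * (τ + u * Complex.I) ^ j) := by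
    intro u
    rw [← sum_choose_mul k hk, Finset.mul_sum, Finset.sum_mul]
    exact Finset.sum_congr rfl fun j _ => by ring
  simp_rw [h1]
  rw [integral_finsetSum _ fun j _ => (hF.integrableOn j hτ).const_mul _, Finset.mul_sum,
    ← Finset.sum_neg_distrib, ← Finset.sum_add_distrib, eichlerEval]
  refine Finset.sum_congr rfl fun j _ => ?_
  rw [eichlerMoment, integral_segment, MeasureTheory.integral_mul_const,
    MeasureTheory.integral_const_mul]
  ring

lemma choose_mul_eq {k : ℕ} (j : ℕ) (hk : 2 ≤ k) :
    ((k - 2).choose j : ℂ) / (j + 1) = ((k - 1).choose (j + 1) : ℂ) / (k - 1) := by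
  have h1 : (j : ℂ) + 1 ≠ 0 := by exact_mod_cast j.succ_ne_zero
  have h2 : (k : ℂ) - 1 ≠ 0 := by
    rw [sub_ne_zero]; exact_mod_cast (by omega : k ≠ 1)
  rw [div_eq_div_iff h1 h2]
  have := Nat.add_one_mul_choose_eq (k - 2) j
  rw [show k - 2 + 1 = k - 1 by omega] at this
  have h3 : ((k - 1 : ℕ) : ℂ) * ((k - 2).choose j : ℂ) = ((k - 1).choose (j + 1) : ℂ) * (j + 1) := by
    exact_mod_cast this
  rw [Nat.cast_sub (by omega : 1 ≤ k), Nat.cast_one] at h3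
  linear_combination h3

/-- `x ∫_0^τ (t x + y)^{k-2} dt = ((τ x + y)^{k-1} - y^{k-1}) / (k-1)`. -/
lemma mul_sum_choose_segment {k : ℕ} (hk : 2 ≤ k) (τ x y : ℂ) :
    x * ∑ j ∈ Finset.range (k - 1),
      ((k - 2).choose j : ℂ) * (τ ^ (j + 1) / (j + 1)) * (x ^ j * y ^ (k - 2 - j))
    = 1 / ((k : ℂ) - 1) * ((τ * x + y) ^ (k - 1) - y ^ (k - 1)) := by
  rw [add_pow, Finset.sum_range_succ', Finset.mul_sum]
  simp only [pow_zero, Nat.sub_zero, one_mul, Nat.choose_zero_right, Nat.cast_one, mul_one,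
    add_sub_cancel_right]
  rw [Finset.mul_sum]
  refine Finset.sum_congr rfl fun j hj => ?_
  have := choose_mul_eq j hk
  rw [show k - 1 - (j + 1) = k - 2 - j by omega]
  calc _ = ((k - 2).choose j : ℂ) / (j + 1) * ((τ * x) ^ (j + 1) * y ^ (k - 2 - j)) := by ring
    _ = _ := by rw [this]; ring

end Eichler

end EisensteinDedekind

namespace EisensteinDedekind

/-! ### The cocycle of a regular function -/

section Cocycle

open Complex MeasureTheory Set Filter Topology

/-- The inclusion of `GL₂(ℚ)` into `GL₂(ℝ)`. -/
noncomputable abbrev ratGL (g : GL (Fin 2) ℚ) : GL (Fin 2) ℝ :=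
  Matrix.GeneralLinearGroup.map (algebraMap ℚ ℝ) g

lemma ratGL_det (g : GL (Fin 2) ℚ) : (ratGL g).det.val = ((g.det.val : ℚ) : ℝ) := by
  simp [ratGL, Matrix.GeneralLinearGroup.map_det]

lemma ratGL_det_pos {g : GL (Fin 2) ℚ} (hg : 0 < g.det.val) : 0 < (ratGL g).det.val := by
  rw [ratGL_det]; exact_mod_cast hg

lemma denom_ratGL (g : GL (Fin 2) ℚ) (z : ℂ) : denom (ratGL g) z = (g 1 0 : ℂ) * z + (g 1 1 : ℂ) := by
  simp [denom]

lemma num_ratGL (g : GL (Fin 2) ℚ) (z : ℂ) : num (ratGL g) z = (g 0 0 : ℂ) * z + (g 0 1 : ℂ) := by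
  simp [num]

lemma coe_ratGL_smul {g : GL (Fin 2) ℚ} (hg : 0 < g.det.val) (τ : ℍ) :
    ((ratGL g • τ : ℍ) : ℂ)
      = ((g 0 0 : ℂ) * τ + (g 0 1 : ℂ)) / ((g 1 0 : ℂ) * τ + (g 1 1 : ℂ)) := by
  rw [coe_smul_of_det_pos (ratGL_det_pos hg), num_ratGL, denom_ratGL]

lemma denom_ne_zero_rat (g : GL (Fin 2) ℚ) {z : ℂ} (hz : 0 < z.im) :
    (g 1 0 : ℂ) * z + (g 1 1 : ℂ) ≠ 0 := by
  rw [← denom_ratGL]; exact denom_ne_zero_of_im _ hz.ne'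

lemma ratSlash_apply {k : ℕ} (hk : 1 ≤ k) (F : ℍ → ℂ) {g : GL (Fin 2) ℚ} (hg : 0 < g.det.val)
    (τ : ℍ) : ratSlash k F g τ
      = F (ratGL g • τ) * ((g.det.val : ℚ) : ℂ) ^ (k - 1)
        * (((g 1 0 : ℂ) * τ + (g 1 1 : ℂ)) ^ k)⁻¹ := by
  have h1 := ratGL_det_pos hg
  have h1' := h1
  rw [ratGL_det] at h1'
  rw [ratSlash, ModularForm.slash_apply, denom_ratGL, σ, if_pos h1, ratGL_det, abs_of_pos h1']
  simp only [zpow_neg, zpow_natCast]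
  congr 2
  rw [show ((k : ℤ) - 1) = ((k - 1 : ℕ) : ℤ) by omega, zpow_natCast]
  simp

lemma ratSlash_mul (k : ℕ) (F : ℍ → ℂ) (g h : GL (Fin 2) ℚ) :
    ratSlash k F (g * h) = ratSlash k (ratSlash k F g) h := by
  rw [ratSlash, ratSlash, ratSlash, map_mul, SlashAction.slash_mul]

lemma ratSlash_one (k : ℕ) (F : ℍ → ℂ) : ratSlash k F 1 = F := by
  rw [ratSlash, map_one, SlashAction.slash_one]

lemma ratSlash_add (k : ℕ) (F G : ℍ → ℂ) (g : GL (Fin 2) ℚ) :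
    ratSlash k (F + G) g = ratSlash k F g + ratSlash k G g := by
  rw [ratSlash, SlashAction.add_slash]; rfl

lemma ratSlash_smul (k : ℕ) (c : ℂ) (F : ℍ → ℂ) {g : GL (Fin 2) ℚ} (hg : 0 < g.det.val) :
    ratSlash k (c • F) g = c • ratSlash k F g := by
  rw [ratSlash, ModularForm.smul_slash, σ, if_pos (ratGL_det_pos hg)]; rfl

lemma det_inv_pos {g : GL (Fin 2) ℚ} (hg : 0 < g.det.val) : 0 < (g⁻¹).det.val := by
  rw [map_inv]; simpa using hg

lemma det_mul_pos {g h : GL (Fin 2) ℚ} (hg : 0 < g.det.val) (hh : 0 < h.det.val) :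
    0 < (g * h).det.val := by
  rw [map_mul]; exact mul_pos hg hh

/-- All transforms of `F` under `GL₂⁺(ℚ)` are regular at `i∞`. -/
def IsRegular (k : ℕ) (F : ℍ → ℂ) : Prop :=
  ∀ g : GL (Fin 2) ℚ, 0 < g.det.val → IsRegularAtInfty (ratSlash k F g)

lemma IsRegular.slash {k : ℕ} {F : ℍ → ℂ} (hF : IsRegular k F) {g : GL (Fin 2) ℚ}
    (hg : 0 < g.det.val) : IsRegular k (ratSlash k F g) := fun h hh => by
  rw [← ratSlash_mul]; exact hF _ (det_mul_pos hg hh)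

lemma IsRegular.atInfty {k : ℕ} {F : ℍ → ℂ} (hF : IsRegular k F) : IsRegularAtInfty F := by
  have := hF 1 (by simp)
  rwa [ratSlash_one] at this

lemma evalV_eichlerDefect (k : ℕ) (F : ℍ → ℂ) {g : GL (Fin 2) ℚ} (hg : 0 < g.det.val) (τ : ℍ)
    (x y : ℂ) : evalV x y (eichlerDefect k F g τ) = eichlerEval k F x y τ -
      eichlerEval k (ratSlash k F g⁻¹) ((g 1 1 : ℂ) * x - (g 1 0 : ℂ) * y)
        (-(g 0 1 : ℂ) * x + (g 0 0 : ℂ) * y)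
        (((g 0 0 : ℂ) * τ + (g 0 1 : ℂ)) / ((g 1 0 : ℂ) * τ + (g 1 1 : ℂ))) := by
  rw [eichlerDefect, evalV_sub, evalV_vAct, evalV_eichlerIntegral, evalV_eichlerIntegral,
    ← coe_ratGL_smul hg]

lemma det_eq (g : GL (Fin 2) ℚ) : (g.det.val : ℂ)
    = (g 0 0 : ℂ) * (g 1 1 : ℂ) - (g 0 1 : ℂ) * (g 1 0 : ℂ) := by
  have : g.det.val = g 0 0 * g 1 1 - g 0 1 * g 1 0 := by
    rw [Matrix.GeneralLinearGroup.val_det_apply, Matrix.det_fin_two]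
  rw [this]; push_cast; ring

/-- The period of a regular function does not depend on the base point. -/
theorem eichlerDefect_eq {k : ℕ} (hk : 2 ≤ k) {F : ℍ → ℂ} (hF : IsRegular k F)
    {g : GL (Fin 2) ℚ} (hg : 0 < g.det.val) (τ τ' : ℍ) :
    eichlerDefect k F g τ = eichlerDefect k F g τ' := by
  refine evalV_ext fun x y => ?_
  rw [evalV_eichlerDefect k F hg, evalV_eichlerDefect k F hg]
  set G := ratSlash k F g⁻¹ with hG
  have hFG : F = ratSlash k G g := by rw [hG, ← ratSlash_mul, inv_mul_cancel, ratSlash_one]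
  have hGr : IsRegularAtInfty G := hF _ (det_inv_pos hg)
  have hopen : IsOpen {z : ℂ | 0 < z.im} := isOpen_lt continuous_const continuous_im
  have hconn : IsPreconnected {z : ℂ | 0 < z.im} :=
    (convex_halfSpace_im_gt 0).isPreconnected
  -- The defect is extended to complex `z`; it remains to see that its derivative vanishes on the
  -- convex upper half plane.
  set E : ℂ → ℂ := fun z => eichlerEval k F x y z -
      eichlerEval k G ((g 1 1 : ℂ) * x - (g 1 0 : ℂ) * y)
        (-(g 0 1 : ℂ) * x + (g 0 0 : ℂ) * y)
        (((g 0 0 : ℂ) * z + (g 0 1 : ℂ)) / ((g 1 0 : ℂ) * z + (g 1 1 : ℂ))) with hE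
  have hder : ∀ z : ℂ, 0 < z.im → HasDerivAt E 0 z := by
    intro z hz
    have hd := denom_ne_zero_rat g hz
    have hw : ((ratGL g • (⟨z, hz⟩ : ℍ) : ℍ) : ℂ) = _ := coe_ratGL_smul hg ⟨z, hz⟩
    simp only at hw
    have hw' : 0 < (((g 0 0 : ℂ) * z + (g 0 1 : ℂ)) / ((g 1 0 : ℂ) * z + (g 1 1 : ℂ))).im := by
      rw [← hw]; exact (ratGL g • (⟨z, hz⟩ : ℍ)).im_pos
    have h1 := hasDerivAt_eichlerEval hk hF.atInfty x y hz
    have h2 := hasDerivAt_eichlerEval hk hGr ((g 1 1 : ℂ) * x - (g 1 0 : ℂ) * y)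
        (-(g 0 1 : ℂ) * x + (g 0 0 : ℂ) * y) hw'
    have h3 : HasDerivAt (fun z : ℂ => ((g 0 0 : ℂ) * z + (g 0 1 : ℂ))
        / ((g 1 0 : ℂ) * z + (g 1 1 : ℂ)))
        ((g.det.val : ℂ) / ((g 1 0 : ℂ) * z + (g 1 1 : ℂ)) ^ 2) z := by
      have ha := ((hasDerivAt_id z).const_mul (g 0 0 : ℂ)).add_const (g 0 1 : ℂ)
      have hb := ((hasDerivAt_id z).const_mul (g 1 0 : ℂ)).add_const (g 1 1 : ℂ)
      convert! ha.div hb hd using 1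
      rw [det_eq]
      simp only [id]
      ring
    have h4 := h1.sub (h2.comp z h3)
    convert! h4 using 1
    have h5 : F (ofComplex z) = G (ratGL g • (⟨z, hz⟩ : ℍ)) * ((g.det.val : ℚ) : ℂ) ^ (k - 1)
        * (((g 1 0 : ℂ) * z + (g 1 1 : ℂ)) ^ k)⁻¹ := by
      conv_lhs => rw [hFG, ofComplex_apply_of_im_pos hz]
      exact ratSlash_apply (by omega) G hg _
    have h6 : ofComplex (((g 0 0 : ℂ) * z + (g 0 1 : ℂ)) / ((g 1 0 : ℂ) * z + (g 1 1 : ℂ)))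
        = ratGL g • (⟨z, hz⟩ : ℍ) := by
      rw [← hw, ofComplex_apply]
    rw [h5, h6]
    -- The linear form transforms by `det(g) / (cz+d)`. Its power `k - 2`, times the derivative
    -- `det(g) / (cz+d)²` of the Möbius map, is exactly the weight factor `det(g)^{k-1}
    -- (cz+d)^{-k}`.
    have h7 : ((g 0 0 : ℂ) * z + (g 0 1 : ℂ)) / ((g 1 0 : ℂ) * z + (g 1 1 : ℂ))
        * ((g 1 1 : ℂ) * x - (g 1 0 : ℂ) * y) + (-(g 0 1 : ℂ) * x + (g 0 0 : ℂ) * y)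
        = (g.det.val : ℂ) * (z * x + y) / ((g 1 0 : ℂ) * z + (g 1 1 : ℂ)) := by
      rw [det_eq, eq_div_iff hd, add_mul, div_mul_eq_mul_div, div_mul_cancel₀ _ hd]
      ring
    rw [h7, div_pow, mul_pow]
    obtain ⟨m, rfl⟩ : ∃ m, k = m + 2 := ⟨k - 2, by omega⟩
    simp only [Nat.add_sub_cancel, show m + 2 - 1 = m + 1 by omega]
    field_simp
    ring
  have := hopen.is_const_of_deriv_eq_zero hconn (f := E)
    (fun z hz => (hder z hz).differentiableAt.differentiableWithinAt)
    (fun z hz => (hder z hz).deriv) (x := (τ : ℂ)) (y := (τ' : ℂ)) τ.im_pos τ'.im_pos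
  exact this

/-- With the inner defect based at `g · i` instead of `i`, the two middle Eichler integrals are
equal and cancel. -/
lemma cocycle_mul {k : ℕ} (hk : 2 ≤ k) {F : ℍ → ℂ} (hF : IsRegular k F)
    {g h : GL (Fin 2) ℚ} (hg : 0 < g.det.val) (hh : 0 < h.det.val) :
    cocycle k F (h * g) = cocycle k F g + vAct k ℂ g (cocycle k (ratSlash k F g⁻¹) h) := by
  unfold cocycle
  rw [eichlerDefect_eq hk (hF.slash (det_inv_pos hg)) hh UpperHalfPlane.I
    (ratGL g • UpperHalfPlane.I)]
  simp only [eichlerDefect, map_sub]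
  rw [← vAct_mul, mul_inv_rev, ratSlash_mul, map_mul, mul_smul]
  abel

end Cocycle

end EisensteinDedekind

namespace EisensteinDedekind

/-! ### The period homomorphism -/

section Period

open Complex MeasureTheory Set Filter Topology

lemma im_ratGL_smul {g : GL (Fin 2) ℚ} (hg : 0 < g.det.val) (h10 : g 1 0 = 0) (τ : ℍ) :
    (ratGL g • τ).im = ((g 0 0 / g 1 1 : ℚ) : ℝ) * τ.im := by
  have h1 := coe_ratGL_smul hg τ
  rw [h10] at h1
  have h2 : ((ratGL g • τ : ℍ) : ℂ)
      = (((g 0 0 / g 1 1 : ℚ) : ℝ) : ℂ) * τ + (((g 0 1 / g 1 1 : ℚ) : ℝ) : ℂ) := by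
    rw [h1]; push_cast; ring
  have h3 := congrArg Complex.im h2
  rw [Complex.add_im, Complex.im_ofReal_mul, Complex.ofReal_im, add_zero] at h3
  exact h3

lemma diag_mul_pos {g : GL (Fin 2) ℚ} (hg : 0 < g.det.val) (h10 : g 1 0 = 0) :
    0 < g 0 0 * g 1 1 := by
  rw [Matrix.GeneralLinearGroup.val_det_apply, Matrix.det_fin_two, h10, mul_zero, sub_zero] at hg
  exact hg

lemma diag_div_pos {g : GL (Fin 2) ℚ} (hg : 0 < g.det.val) (h10 : g 1 0 = 0) :
    0 < g 0 0 / g 1 1 := by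
  have := diag_mul_pos hg h10
  rw [div_eq_mul_inv]
  rcases pos_and_pos_or_neg_and_neg_of_mul_pos this with h | h
  · exact mul_pos h.1 (inv_pos.2 h.2)
  · exact mul_pos_of_neg_of_neg h.1 (inv_lt_zero.2 h.2)

lemma tendsto_ratGL_smul_atImInfty {g : GL (Fin 2) ℚ} (hg : 0 < g.det.val) (h10 : g 1 0 = 0) :
    Tendsto (fun τ : ℍ => ratGL g • τ) atImInfty atImInfty := by
  rw [atImInfty, tendsto_comap_iff]
  have h : (UpperHalfPlane.im ∘ fun τ : ℍ => ratGL g • τ)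
      = fun τ => ((g 0 0 / g 1 1 : ℚ) : ℝ) * τ.im := funext fun τ => im_ratGL_smul hg h10 τ
  rw [h]
  have : (0 : ℝ) < ((g 0 0 / g 1 1 : ℚ) : ℝ) := by exact_mod_cast diag_div_pos hg h10
  exact tendsto_comap.const_mul_atTop this

lemma ratSlash_apply_of_upper {k : ℕ} (hk : 1 ≤ k) (F : ℍ → ℂ) {g : GL (Fin 2) ℚ}
    (hg : 0 < g.det.val) (h10 : g 1 0 = 0) (τ : ℍ) : ratSlash k F g τ
      = ((((g 0 0 * g 1 1) ^ (k - 1) * (g 1 1 ^ k)⁻¹ : ℚ)) : ℂ) * F (ratGL g • τ) := by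
  rw [ratSlash_apply hk F hg, h10, det_eq, h10]
  push_cast
  ring

lemma valueAtInfty_ratSlash_of_upper {k : ℕ} (hk : 1 ≤ k) {F : ℍ → ℂ} (hF : IsRegularAtInfty F)
    {g : GL (Fin 2) ℚ} (hg : 0 < g.det.val) (h10 : g 1 0 = 0) :
    valueAtInfty (ratSlash k F g)
      = ((((g 0 0 * g 1 1) ^ (k - 1) * (g 1 1 ^ k)⁻¹ : ℚ)) : ℂ) * valueAtInfty F := by
  apply valueAtInfty_eq_of_tendsto
  have h : ratSlash k F g = fun τ =>
      ((((g 0 0 * g 1 1) ^ (k - 1) * (g 1 1 ^ k)⁻¹ : ℚ)) : ℂ) * F (ratGL g • τ) :=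
    funext fun τ => ratSlash_apply_of_upper hk F hg h10 τ
  rw [h]
  exact (hF.tendsto.comp (tendsto_ratGL_smul_atImInfty hg h10)).const_mul _

/-- The map `z ↦ (az+b)/d` preserves `i∞` and multiplies the decay rate by `a/d > 0`. -/
lemma IsRegularAtInfty.ratSlash_of_upper {k : ℕ} (hk : 1 ≤ k) {F : ℍ → ℂ}
    (hF : IsRegularAtInfty F) {g : GL (Fin 2) ℚ} (hg : 0 < g.det.val) (h10 : g 1 0 = 0) :
    IsRegularAtInfty (ratSlash k F g) := by
  set q : ℚ := (g 0 0 * g 1 1) ^ (k - 1) * (g 1 1 ^ k)⁻¹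
  have h : ratSlash k F g = fun τ => (q : ℂ) * F (ratGL g • τ) :=
    funext fun τ => ratSlash_apply_of_upper hk F hg h10 τ
  set r : ℝ := ((g 0 0 / g 1 1 : ℚ) : ℝ) with hr
  have hr0 : 0 < r := by rw [hr]; exact_mod_cast diag_div_pos hg h10
  rw [h]
  constructor
  · have h1 : DifferentiableOn ℂ (fun z : ℂ => (q : ℂ) * (F ∘ ofComplex)
        (((g 0 0 : ℂ) * z + (g 0 1 : ℂ)) / (g 1 1 : ℂ))) {z | 0 < z.im} := by
      refine DifferentiableOn.const_mul (hF.holo.comp (by fun_prop) fun z hz => ?_) _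
      have h2 := coe_ratGL_smul hg ⟨z, hz⟩
      simp only [h10, Rat.cast_zero, zero_mul, zero_add] at h2
      rw [mem_ofPred_eq, ← h2]
      exact (ratGL g • (⟨z, hz⟩ : ℍ)).im_pos
    refine h1.congr fun z hz => ?_
    have h2 := coe_ratGL_smul hg ⟨z, hz⟩
    simp only [h10, Rat.cast_zero, zero_mul, zero_add] at h2
    simp only [Function.comp_apply, ← h2, ofComplex_apply]
    rw [ofComplex_apply_of_im_pos hz]
  · obtain ⟨a, c, hc, C, A, hb⟩ := hF.decay
    refine ⟨q * a, c * r, mul_pos hc hr0, ‖(q : ℂ)‖ * C, A / r, fun z hz => ?_⟩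
    rw [← mul_sub, norm_mul, mul_assoc]
    have h3 := hb (ratGL g • z) (by
      rw [im_ratGL_smul hg h10, ← hr]; rwa [div_le_iff₀' hr0] at hz)
    rw [im_ratGL_smul hg h10, ← hr] at h3
    rw [show -(c * r) * z.im = -c * (r * z.im) by ring]
    gcongr

/-- A diagonal matrix acts by `t ↦ rt`, fixing both base points `i∞` and `0`. Each integral then
scales by `r^{j+1}`. -/
lemma eichlerMoment_ratSlash_of_diag {k : ℕ} (hk : 1 ≤ k) {F : ℍ → ℂ} (hF : IsRegularAtInfty F)
    {g : GL (Fin 2) ℚ} (hg : 0 < g.det.val) (h10 : g 1 0 = 0) (h01 : g 0 1 = 0) (j : ℕ) {τ : ℂ}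
    (hτ : 0 < τ.im) :
    eichlerMoment F j ((((g 0 0 / g 1 1 : ℚ) : ℝ) : ℂ) * τ)
      = ((((g 0 0 / g 1 1 : ℚ) : ℝ) : ℂ)) ^ (j + 1) *
        ((((g 0 0 * g 1 1) ^ (k - 1) * (g 1 1 ^ k)⁻¹ : ℚ)) : ℂ)⁻¹ *
          eichlerMoment (ratSlash k F g) j τ := by
  set q : ℚ := (g 0 0 * g 1 1) ^ (k - 1) * (g 1 1 ^ k)⁻¹ with hq
  set r : ℝ := ((g 0 0 / g 1 1 : ℚ) : ℝ) with hr
  have hr0 : 0 < r := by rw [hr]; exact_mod_cast diag_div_pos hg h10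
  have hprod := diag_mul_pos hg h10
  have h11 : g 1 1 ≠ 0 := right_ne_zero_of_mul hprod.ne'
  have hq0 : (q : ℂ) ≠ 0 := by
    have : q ≠ 0 := mul_ne_zero (pow_ne_zero _ hprod.ne') (inv_ne_zero (pow_ne_zero _ h11))
    exact_mod_cast this
  have hsmul : ∀ z : ℂ, 0 < z.im → F (ofComplex ((r : ℂ) * z)) =
      (q : ℂ)⁻¹ * ratSlash k F g (ofComplex z) := by
    intro z hz
    rw [ofComplex_apply_of_im_pos hz, ratSlash_apply_of_upper hk F hg h10, ← hq,
      inv_mul_cancel_left₀ hq0]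
    congr 1
    have h2 := coe_ratGL_smul hg ⟨z, hz⟩
    simp only [h10, h01, Rat.cast_zero, zero_mul, zero_add, add_zero] at h2
    rw [← ofComplex_apply (ratGL g • (⟨z, hz⟩ : ℍ)), h2, hr]
    congr 1
    push_cast
    ring
  have hval := valueAtInfty_ratSlash_of_upper hk hF hg h10
  rw [← hq] at hval
  unfold eichlerMoment
  rw [integral_segment, integral_segment, hval]
  have h1 := integral_comp_mul_left_Ioi (fun u : ℝ =>
    (F (ofComplex ((r : ℂ) * τ + u * Complex.I)) - valueAtInfty F) *
        ((r : ℂ) * τ + u * Complex.I) ^ j * Complex.I) 0 hr0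
  rw [mul_zero] at h1
  have h2 : ∀ u ∈ Ioi (0 : ℝ), (F (ofComplex ((r : ℂ) * τ + ((r * u : ℝ) : ℂ) * Complex.I))
        - valueAtInfty F) * ((r : ℂ) * τ + ((r * u : ℝ) : ℂ) * Complex.I) ^ j * Complex.I
      = ((r : ℂ) ^ j * (q : ℂ)⁻¹) * ((ratSlash k F g (ofComplex (τ + u * Complex.I))
          - q * valueAtInfty F) * (τ + u * Complex.I) ^ j * Complex.I) := by
    intro u hu
    have hu' : (0 : ℝ) < u := hu
    have h3 : (r : ℂ) * τ + ((r * u : ℝ) : ℂ) * Complex.I = (r : ℂ) * (τ + u * Complex.I) := by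
      push_cast; ring
    rw [h3, hsmul _ (by simp; linarith), mul_pow]
    field_simp
  rw [setIntegral_congr_fun measurableSet_Ioi h2, integral_const_mul] at h1
  have h4 : (∫ u in Ioi (0 : ℝ), (F (ofComplex ((r : ℂ) * τ + u * Complex.I)) - valueAtInfty F) *
        ((r : ℂ) * τ + u * Complex.I) ^ j * Complex.I)
      = (r : ℂ) * (((r : ℂ) ^ j * (q : ℂ)⁻¹) * ∫ u in Ioi (0 : ℝ),
        (ratSlash k F g (ofComplex (τ + u * Complex.I))
          - q * valueAtInfty F) * (τ + u * Complex.I) ^ j * Complex.I) := by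
    rw [h1, Complex.real_smul, ← mul_assoc, ofReal_inv, mul_inv_cancel₀, one_mul]
    exact_mod_cast hr0.ne'
  rw [h4]
  generalize (∫ u in Ioi (0 : ℝ), (ratSlash k F g (ofComplex (τ + u * Complex.I))
    - q * valueAtInfty F) * (τ + u * Complex.I) ^ j * Complex.I) = J
  field_simp
  ring

/-- The stabilizer of `π_∞(0)` consists of the diagonal matrices. -/
lemma diag_of_smul_zInfty {h : GL (Fin 2) ℚ} (hh : h • zInfty = zInfty) :
    h 1 0 = 0 ∧ h 0 1 = 0 := by
  have h1 : h • (OnePoint.infty : OnePoint ℚ) = OnePoint.infty :=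
    congrArg (fun Z : InfCusp => Z.1.1) hh
  have h2 : h • ((0 : ℚ) : OnePoint ℚ) = ((0 : ℚ) : OnePoint ℚ) :=
    congrArg (fun Z : InfCusp => Z.1.2) hh
  have h10 : h 1 0 = 0 := by
    rw [OnePoint.smul_infty_eq_ite] at h1
    by_contra hne
    rw [if_neg hne] at h1
    exact OnePoint.coe_ne_infty _ h1
  refine ⟨h10, ?_⟩
  rw [OnePoint.smul_some_eq_ite] at h2
  have hdet : h 0 0 * h 1 1 ≠ 0 := by
    have := h.det.ne_zero
    rw [Matrix.GeneralLinearGroup.val_det_apply, Matrix.det_fin_two, h10, mul_zero, sub_zero]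
      at this
    exact this
  have h11 := right_ne_zero_of_mul hdet
  rw [mul_zero, zero_add, mul_zero, zero_add, if_neg h11, OnePoint.coe_eq_coe, div_eq_zero_iff]
    at h2
  exact h2.resolve_right h11

/-- The base point `0` for the constant term plays the role of the `0` in `π_∞(0)`: the stabilizer
of this infinitesimal cusp has no period. -/
lemma eichlerDefect_of_diag {k : ℕ} (hk : 2 ≤ k) {F : ℍ → ℂ} (hF : IsRegular k F)
    {h : GL (Fin 2) ℚ} (hdet : 0 < h.det.val) (hh : h • zInfty = zInfty) (τ : ℍ) :
    eichlerDefect k F h τ = 0 := by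
  refine evalV_ext fun x y => ?_
  obtain ⟨h10, h01⟩ := diag_of_smul_zInfty hh
  rw [evalV_eichlerDefect k F hdet, evalV_zero, sub_eq_zero]
  set G := ratSlash k F h⁻¹ with hG
  have hGr : IsRegularAtInfty G := hF _ (det_inv_pos hdet)
  have hFG : ratSlash k G h = F := by rw [hG, ← ratSlash_mul, inv_mul_cancel, ratSlash_one]
  have hprod := diag_mul_pos hdet h10
  have h11 : (h 1 1 : ℂ) ≠ 0 := by exact_mod_cast right_ne_zero_of_mul hprod.ne'
  have h00 : (h 0 0 : ℂ) ≠ 0 := by exact_mod_cast left_ne_zero_of_mul hprod.ne'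
  have hτ : ((h 0 0 : ℂ) * τ + (h 0 1 : ℂ)) / ((h 1 0 : ℂ) * τ + (h 1 1 : ℂ))
      = (((h 0 0 / h 1 1 : ℚ) : ℝ) : ℂ) * τ := by
    rw [h10, h01]; push_cast; ring
  rw [hτ, eichlerEval, eichlerEval]
  refine Finset.sum_congr rfl fun j hj => ?_
  rw [eichlerMoment_ratSlash_of_diag (k := k) (by omega) hGr hdet h10 h01 j τ.im_pos, hFG, h10, h01]
  -- With `h = diag(a, d)` the powers of `a` and `d` coming from `x^j y^m`, from `(a/d)^{j+1}` and
  -- from the weight factor multiply to one.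
  obtain ⟨m, hm⟩ : ∃ m, k = m + j + 2 := ⟨k - 2 - j, by
    have := Finset.mem_range.1 hj; omega⟩
  subst hm
  simp only [show m + j + 2 - 1 = m + j + 1 by omega, show m + j + 2 - 2 - j = m by omega]
  push_cast
  simp only [zero_mul, sub_zero, neg_zero, zero_add, mul_pow, div_pow]
  field_simp
  ring

lemma per_bracket (k : ℕ) (F : ℍ → ℂ) (Z₁ Z₂ : InfCusp) :
    per k F (bracket Z₁ Z₂) = cocycle k F (cuspMatrix Z₂) - cocycle k F (cuspMatrix Z₁) := by
  simp [per, bracket]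

lemma cuspMatrix_spec (Z : InfCusp) :
    0 < (cuspMatrix Z).det.val ∧ (cuspMatrix Z)⁻¹ • zInfty = Z :=
  (exists_smul_zInfty Z).choose_spec

/-- The two matrices differ by a diagonal factor on the left. This makes the choice in `cuspMatrix`
harmless. -/
lemma cocycle_eq_of_smul_eq {k : ℕ} (hk : 2 ≤ k) {F : ℍ → ℂ} (hF : IsRegular k F)
    {g g' : GL (Fin 2) ℚ} (hg : 0 < g.det.val) (hg' : 0 < g'.det.val)
    (h : g⁻¹ • zInfty = g'⁻¹ • zInfty) : cocycle k F g = cocycle k F g' := by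
  have h1 : (g * g'⁻¹) • zInfty = zInfty := by rw [mul_smul, ← h, smul_inv_smul]
  have h2 := cocycle_mul hk hF hg' (det_mul_pos hg (det_inv_pos hg'))
  rw [inv_mul_cancel_right] at h2
  rw [h2, cocycle, cocycle, eichlerDefect_of_diag hk (hF.slash (det_inv_pos hg'))
    (det_mul_pos hg (det_inv_pos hg')) h1, map_zero, add_zero]

/-- The characteristic property of the period homomorphism. -/
theorem per_bracket_zInfty {k : ℕ} (hk : 2 ≤ k) {F : ℍ → ℂ} (hF : IsRegular k F)
    {g : GL (Fin 2) ℚ} (hg : 0 < g.det.val) :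
    per k F (bracket zInfty (g⁻¹ • zInfty)) = cocycle k F g := by
  rw [per_bracket]
  have h1 := cuspMatrix_spec zInfty
  have h2 := cuspMatrix_spec (g⁻¹ • zInfty)
  have h3 : (cuspMatrix zInfty) • zInfty = zInfty := by
    have := congrArg (fun Z => cuspMatrix zInfty • Z) h1.2
    rw [smul_inv_smul] at this
    exact this.symm
  rw [cocycle_eq_of_smul_eq hk hF h2.1 hg h2.2, cocycle, cocycle,
    eichlerDefect_of_diag hk hF h1.1 h3, sub_zero]

theorem per_bracket_eq_eichlerDefect {k : ℕ} (hk : 2 ≤ k) {F : ℍ → ℂ} (hF : IsRegular k F)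
    {g : GL (Fin 2) ℚ} (hg : 0 < g.det.val) (τ : ℍ) :
    per k F (bracket zInfty (g⁻¹ • zInfty)) = eichlerDefect k F g τ := by
  rw [per_bracket_zInfty hk hF hg, cocycle, eichlerDefect_eq hk hF hg]

/-- The period homomorphism is equivariant under `GL₂⁺(ℚ)`. -/
theorem per_ratSlash {k : ℕ} (hk : 2 ≤ k) {F : ℍ → ℂ} (hF : IsRegular k F)
    {γ : GL (Fin 2) ℚ} (hγ : 0 < γ.det.val) (δ : Xi0) :
    per k (ratSlash k F γ) δ = vAct k ℂ γ (per k F (xiAct γ δ)) := by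
  have h : per k (ratSlash k F γ)
      = (vAct k ℂ γ).toAddMonoidHom.comp ((per k F).comp (xiAct γ)) := by
    refine addMonoidHom_Xi0_ext zInfty fun Y => ?_
    obtain ⟨g, hg, rfl⟩ := exists_smul_zInfty Y
    rw [per_bracket_zInfty hk (hF.slash hγ) hg]
    show _ = vAct k ℂ γ (per k F (xiAct γ (bracket zInfty (g⁻¹ • zInfty))))
    -- Both brackets on the right start at `π_∞(0)`, so the claim becomes the cocycle rule for the
    -- product `g γ⁻¹`.
    have h1 : xiAct γ (bracket zInfty (g⁻¹ • zInfty))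
        = bracket zInfty ((g * γ⁻¹)⁻¹ • zInfty) - bracket zInfty ((γ⁻¹)⁻¹ • zInfty) := by
      rw [xiAct_bracket, mul_inv_rev, inv_inv, mul_smul, eq_sub_iff_add_eq', bracket_add]
    have hγi := det_inv_pos hγ
    rw [h1, map_sub, per_bracket_zInfty hk hF (det_mul_pos hg hγi), per_bracket_zInfty hk hF hγi,
      cocycle_mul hk hF hγi hg, add_sub_cancel_left, vAct_inv_apply', inv_inv]
  rw [h]; rfl

/-! ### Linearity of the period homomorphism -/

lemma IsRegularAtInfty.add {F G : ℍ → ℂ} (hF : IsRegularAtInfty F) (hG : IsRegularAtInfty G) :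
    valueAtInfty (F + G) = valueAtInfty F + valueAtInfty G :=
  valueAtInfty_eq_of_tendsto (hF.tendsto.add hG.tendsto)

lemma IsRegularAtInfty.smul {F : ℍ → ℂ} (hF : IsRegularAtInfty F) (c : ℂ) :
    valueAtInfty (c • F) = c * valueAtInfty F :=
  valueAtInfty_eq_of_tendsto (hF.tendsto.const_mul c)

lemma eichlerMoment_add {F G : ℍ → ℂ} (hF : IsRegularAtInfty F) (hG : IsRegularAtInfty G) (j : ℕ)
    {τ : ℂ} (hτ : 0 < τ.im) :
    eichlerMoment (F + G) j τ = eichlerMoment F j τ + eichlerMoment G j τ := by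
  have h : ∀ u : ℝ, ((F + G) (ofComplex (τ + u * Complex.I)) - valueAtInfty (F + G)) *
        (τ + u * Complex.I) ^ j = (F (ofComplex (τ + u * Complex.I)) - valueAtInfty F) *
        (τ + u * Complex.I) ^ j + (G (ofComplex (τ + u * Complex.I)) - valueAtInfty G) *
        (τ + u * Complex.I) ^ j := by
    intro u
    rw [hF.add hG, Pi.add_apply]; ring
  unfold eichlerMoment
  simp_rw [h]
  simp only [MeasureTheory.integral_mul_const]
  rw [integral_add (hF.integrableOn j hτ) (hG.integrableOn j hτ), hF.add hG]
  ring

lemma eichlerMoment_smul {F : ℍ → ℂ} (hF : IsRegularAtInfty F) (c : ℂ) (j : ℕ) (τ : ℂ) :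
    eichlerMoment (c • F) j τ = c * eichlerMoment F j τ := by
  have h : ∀ u : ℝ, ((c • F) (ofComplex (τ + u * Complex.I)) - valueAtInfty (c • F)) *
        (τ + u * Complex.I) ^ j = c * ((F (ofComplex (τ + u * Complex.I)) - valueAtInfty F) *
        (τ + u * Complex.I) ^ j) := by
    intro u
    rw [hF.smul, Pi.smul_apply, smul_eq_mul]; ring
  unfold eichlerMoment
  simp_rw [h]
  simp only [MeasureTheory.integral_mul_const, MeasureTheory.integral_const_mul]
  rw [hF.smul]
  ring

lemma eichlerEval_add (k : ℕ) {F G : ℍ → ℂ} (hF : IsRegularAtInfty F) (hG : IsRegularAtInfty G)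
    (x y : ℂ) {τ : ℂ} (hτ : 0 < τ.im) :
    eichlerEval k (F + G) x y τ = eichlerEval k F x y τ + eichlerEval k G x y τ := by
  simp only [eichlerEval, eichlerMoment_add hF hG _ hτ, ← Finset.sum_add_distrib]
  exact Finset.sum_congr rfl fun j _ => by ring

lemma eichlerEval_smul (k : ℕ) {F : ℍ → ℂ} (hF : IsRegularAtInfty F) (c : ℂ) (x y τ : ℂ) :
    eichlerEval k (c • F) x y τ = c * eichlerEval k F x y τ := by
  simp only [eichlerEval, eichlerMoment_smul hF, Finset.mul_sum]
  exact Finset.sum_congr rfl fun j _ => by ring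

lemma im_pos_moebius {g : GL (Fin 2) ℚ} (hg : 0 < g.det.val) (τ : ℍ) :
    0 < (((g 0 0 : ℂ) * τ + (g 0 1 : ℂ)) / ((g 1 0 : ℂ) * τ + (g 1 1 : ℂ))).im := by
  rw [← coe_ratGL_smul hg]; exact (ratGL g • τ).im_pos

theorem per_add {k : ℕ} {F G : ℍ → ℂ} (hF : IsRegular k F) (hG : IsRegular k G) :
    per k (F + G) = per k F + per k G := by
  have h : ∀ Z, cocycle k (F + G) (cuspMatrix Z)
      = cocycle k F (cuspMatrix Z) + cocycle k G (cuspMatrix Z) := by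
    intro Z
    have hd := (cuspMatrix_spec Z).1
    refine evalV_ext fun x y => ?_
    rw [evalV_add, cocycle, cocycle, cocycle, evalV_eichlerDefect k _ hd,
      evalV_eichlerDefect k _ hd, evalV_eichlerDefect k _ hd,
      eichlerEval_add k hF.atInfty hG.atInfty x y UpperHalfPlane.I.im_pos, ratSlash_add,
      eichlerEval_add k (hF _ (det_inv_pos hd)) (hG _ (det_inv_pos hd)) _ _ (im_pos_moebius hd _)]
    ring
  refine addMonoidHom_Xi0_ext zInfty fun Y => ?_
  rw [AddMonoidHom.add_apply, per_bracket, per_bracket, per_bracket, h, h]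
  abel

theorem per_smul {k : ℕ} {F : ℍ → ℂ} (hF : IsRegular k F) (c : ℂ) :
    per k (c • F) = c • per k F := by
  have h : ∀ Z, cocycle k (c • F) (cuspMatrix Z) = c • cocycle k F (cuspMatrix Z) := by
    intro Z
    have hd := (cuspMatrix_spec Z).1
    refine evalV_ext fun x y => ?_
    rw [evalV_smul, cocycle, cocycle, evalV_eichlerDefect k _ hd,
      evalV_eichlerDefect k _ hd, eichlerEval_smul k hF.atInfty,
      ratSlash_smul k c F (det_inv_pos hd), eichlerEval_smul k (hF _ (det_inv_pos hd))]
    ring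
  refine addMonoidHom_Xi0_ext zInfty fun Y => ?_
  rw [AddMonoidHom.smul_apply, per_bracket, per_bracket, h, h, smul_sub]

/-- The translation by `r`. -/
def translationGL (r : ℚ) : GL (Fin 2) ℚ :=
  Matrix.GeneralLinearGroup.mkOfDetNeZero !![1, r; 0, 1] (by simp)

lemma translationGL_inv (r : ℚ) : (translationGL (-r))⁻¹ = translationGL r := by
  rw [inv_eq_iff_mul_eq_one]
  ext i j
  fin_cases i <;> fin_cases j <;>
    simp [translationGL, Matrix.GeneralLinearGroup.mkOfDetNeZero, Matrix.mul_apply]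

lemma translationGL_apply (r : ℚ) : (translationGL r 0 0 = 1 ∧ translationGL r 0 1 = r) ∧
    translationGL r 1 0 = 0 ∧ translationGL r 1 1 = 1 := by
  simp [translationGL, Matrix.GeneralLinearGroup.mkOfDetNeZero]

lemma translationGL_det (r : ℚ) : (translationGL r).det.val = 1 := by
  rw [Matrix.GeneralLinearGroup.val_det_apply, Matrix.det_fin_two]
  obtain ⟨⟨h1, h2⟩, h3, h4⟩ := translationGL_apply r
  rw [h1, h2, h3, h4]; ring

lemma translationGL_smul_zInfty (r : ℚ) : translationGL r • zInfty
    = infCusp OnePoint.infty (r : OnePoint ℚ) (OnePoint.infty_ne_coe r) := by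
  obtain ⟨⟨h1, h2⟩, h3, h4⟩ := translationGL_apply r
  refine Subtype.ext (Prod.ext ?_ ?_)
  · rw [InfCusp.smul_fst]
    refine (OnePoint.smul_infty_eq_ite _).trans ?_
    rw [h3, if_pos rfl]; rfl
  · rw [InfCusp.smul_snd]
    refine (OnePoint.smul_some_eq_ite).trans ?_
    rw [h2, h3, h4]; simp [infCusp]

/-- The value of the period homomorphism at `[0, r]_∞`. -/
theorem mul_per_symbolAtInfty {k : ℕ} (hk : 2 ≤ k) {F : ℍ → ℂ} (hF : IsRegular k F) (r : ℚ) :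
    MvPolynomial.X 0 * (per k F (symbolAtInfty r) : MvPolynomial (Fin 2) ℂ) =
      MvPolynomial.C (1 / ((k : ℂ) - 1) * valueAtInfty F) *
        ((MvPolynomial.C (r : ℂ) * MvPolynomial.X 0 + MvPolynomial.X 1) ^ (k - 1)
          - MvPolynomial.X 1 ^ (k - 1)) := by
  have hsym : symbolAtInfty r = bracket zInfty ((translationGL (-r))⁻¹ • zInfty) := by
    rw [translationGL_inv, translationGL_smul_zInfty]; rfl
  have hd : 0 < (translationGL (-r)).det.val := by rw [translationGL_det]; exact one_pos
  have hd' : 0 < (translationGL r).det.val := by rw [translationGL_det]; exact one_pos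
  rw [hsym, per_bracket_eq_eichlerDefect hk hF hd UpperHalfPlane.I]
  apply MvPolynomial.funext
  intro v
  obtain ⟨x, hx⟩ : ∃ x, v 0 = x := ⟨_, rfl⟩
  obtain ⟨y, hy⟩ : ∃ y, v 1 = y := ⟨_, rfl⟩
  have hv : v = ![x, y] := by ext i; fin_cases i <;> simp [hx, hy]
  have h0 := evalV_eichlerDefect k F hd UpperHalfPlane.I x y
  rw [evalV, ← hv] at h0
  rw [map_mul, h0]
  obtain ⟨⟨h1, h2⟩, h3, h4⟩ := translationGL_apply (-r)
  obtain ⟨⟨h1', h2'⟩, h3', h4'⟩ := translationGL_apply r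
  rw [h1, h2, h3, h4, translationGL_inv]
  have hI : ((UpperHalfPlane.I : ℍ) : ℂ) = Complex.I := rfl
  have hval := valueAtInfty_ratSlash_of_upper (k := k) (by omega) hF.atInfty hd' h3'
  rw [h1', h4'] at hval
  norm_num at hval
  have hG : IsRegularAtInfty (ratSlash k F (translationGL r)) := hF _ hd'
  set τ : ℂ := ((UpperHalfPlane.I : ℍ) : ℂ) with hτdef
  have hτ : 0 < τ.im := UpperHalfPlane.I.im_pos
  have hτ' : (((1 : ℚ) : ℂ) * τ + ((-r : ℚ) : ℂ)) / (((0 : ℚ) : ℂ) * τ + ((1 : ℚ) : ℂ)) = τ - r := by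
    push_cast; ring
  rw [hτ', eichlerEval_eq_integral hk hF.atInfty x y hτ,
    eichlerEval_eq_integral hk hG _ _ (by simpa using hτ), hval]
  -- The tail of `F|T_r` at `τ - r` is that of `F` at `τ`, so the tails cancel and only the segments
  -- from `0` remain.
  have hint : ∀ u ∈ Ioi (0 : ℝ), (ratSlash k F (translationGL r) (ofComplex (τ - r + u * Complex.I))
      - valueAtInfty F) * ((τ - r + u * Complex.I) * (((1 : ℚ) : ℂ) * x - ((0 : ℚ) : ℂ) * y)
        + (-((-r : ℚ) : ℂ) * x + ((1 : ℚ) : ℂ) * y)) ^ (k - 2) * Complex.I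
      = (F (ofComplex (τ + u * Complex.I)) - valueAtInfty F) *
        ((τ + u * Complex.I) * x + y) ^ (k - 2) * Complex.I := by
    intro u hu
    have hu' : (0 : ℝ) < u := hu
    have him : 0 < (τ - r + u * Complex.I).im := by simp; linarith
    congr 3
    · rw [ofComplex_apply_of_im_pos him, ratSlash_apply_of_upper (by omega) F hd' h3', h1', h4']
      norm_num
      congr 1
      have h5 := coe_ratGL_smul hd' ⟨_, him⟩
      rw [← ofComplex_apply (ratGL (translationGL r) • (⟨_, him⟩ : ℍ)), h5, h1', h2', h3', h4']
      congr 1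
      push_cast
      ring
    · push_cast; ring
  rw [setIntegral_congr_fun measurableSet_Ioi hint]
  have e1 := mul_sum_choose_segment hk τ x y
  have e2 := mul_sum_choose_segment hk (τ - r) (((1 : ℚ) : ℂ) * x - ((0 : ℚ) : ℂ) * y)
    (-((-r : ℚ) : ℂ) * x + ((1 : ℚ) : ℂ) * y)
  have e3 : ((1 : ℚ) : ℂ) * x - ((0 : ℚ) : ℂ) * y = x := by push_cast; ring
  have e4 : -((-r : ℚ) : ℂ) * x + ((1 : ℚ) : ℂ) * y = r * x + y := by push_cast; ring
  rw [e3, e4] at e2 ⊢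
  rw [show (τ - r) * x + (r * x + y) = τ * x + y by ring] at e2
  simp only [MvPolynomial.eval_X, map_mul, map_sub, map_add, map_pow, MvPolynomial.eval_C, hx, hy]
  -- The terms `(τx+y)^{k-1}` cancel, leaving `(rx+y)^{k-1} - y^{k-1}`.
  linear_combination valueAtInfty F * (e1 - e2)

end Period

end EisensteinDedekind

namespace EisensteinDedekind

/-! ### The period of a regular function between `∞` and `0` -/

section SValue

open Complex MeasureTheory Set Filter Topology

lemma IsRegularAtInfty.isBigO_atTop {F : ℍ → ℂ} (hF : IsRegularAtInfty F) (r : ℝ) :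
    (fun t : ℝ => F (ofComplex (Complex.I * t)) - valueAtInfty F) =O[atTop] (fun t : ℝ => t ^ r) := by
  obtain ⟨c, hc, C, A, h⟩ := hF.exists_decay
  refine (Asymptotics.IsBigO.of_bound C ?_).trans
    (isLittleO_exp_neg_mul_rpow_atTop hc r).isBigO
  filter_upwards [eventually_gt_atTop 0, eventually_ge_atTop A] with t ht htA
  have him : 0 < (Complex.I * (t : ℂ)).im := by simpa using ht
  have h1 := h (ofComplex (Complex.I * t)) (by rw [ofComplex_apply_of_im_pos him]; simpa using htA)
  rw [Real.norm_eq_abs, Real.abs_exp]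
  convert! h1 using 3
  rw [ofComplex_apply_of_im_pos him]
  simp

lemma IsRegularAtInfty.continuousOn_imag {F : ℍ → ℂ} (hF : IsRegularAtInfty F) :
    ContinuousOn (fun t : ℝ => F (ofComplex (Complex.I * t))) (Ioi 0) :=
  hF.holo.continuousOn.comp (f := fun t : ℝ => Complex.I * (t : ℂ)) (by fun_prop)
    fun t ht => by simpa using ht

lemma det_toGL (γ : SL(2, ℤ)) : (toGL γ).det.val = 1 := by
  simp [toGL]

lemma det_toGL_pos (γ : SL(2, ℤ)) : 0 < (toGL γ).det.val := by
  rw [det_toGL]; exact one_pos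

lemma toGL_S_apply : (toGL ModularGroup.S 0 0 = 0 ∧ toGL ModularGroup.S 0 1 = -1) ∧
    toGL ModularGroup.S 1 0 = 1 ∧ toGL ModularGroup.S 1 1 = 0 := by
  have h (i j : Fin 2) : toGL ModularGroup.S i j = ((!![0, -1; 1, 0] : Matrix (Fin 2) (Fin 2) ℤ) i j : ℚ) :=
    toGL_apply _ i j
  simp [h]

lemma toGL_S_inv_apply : ((toGL ModularGroup.S)⁻¹ 0 0 = 0 ∧ (toGL ModularGroup.S)⁻¹ 0 1 = 1) ∧
    (toGL ModularGroup.S)⁻¹ 1 0 = -1 ∧ (toGL ModularGroup.S)⁻¹ 1 1 = 0 := by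
  have h (i j : Fin 2) : (toGL ModularGroup.S)⁻¹ i j
      = ((!![0, 1; -1, 0] : Matrix (Fin 2) (Fin 2) ℤ) i j : ℚ) := by
    rw [← map_inv, toGL_apply, Matrix.SpecialLinearGroup.coe_inv, ModularGroup.coe_S,
      Matrix.adjugate_fin_two]
    fin_cases i <;> fin_cases j <;> simp
  simp [h]

/-- The functional equation data of a regular function `F` and `F|_k S` on the imaginary axis. -/
noncomputable def periodPair {k : ℕ} (hk : 1 ≤ k) {F : ℍ → ℂ} (hF : IsRegular k F) : WeakFEPair ℂ where
  f t := F (ofComplex (Complex.I * t))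
  g t := ratSlash k F (toGL ModularGroup.S) (ofComplex (Complex.I * t))
  k := k
  hk := by exact_mod_cast hk
  -- From `(F|S)(it) = (it)^{-k} F(i/t)`.
  ε := Complex.I ^ k
  hε := pow_ne_zero _ Complex.I_ne_zero
  f₀ := valueAtInfty F
  g₀ := valueAtInfty (ratSlash k F (toGL ModularGroup.S))
  hf_int := hF.atInfty.continuousOn_imag.locallyIntegrableOn measurableSet_Ioi
  hg_int := (hF _ (det_toGL_pos _)).continuousOn_imag.locallyIntegrableOn measurableSet_Ioi
  h_feq t ht := by
    have ht' : 0 < t := ht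
    have ht0 : (t : ℂ) ≠ 0 := by exact_mod_cast ht'.ne'
    have him : 0 < (Complex.I * (t : ℂ)).im := by simpa using ht'
    obtain ⟨⟨h1, h2⟩, h3, h4⟩ := toGL_S_apply
    rw [ofComplex_apply_of_im_pos him, ratSlash_apply hk F (det_toGL_pos _), det_toGL, h3, h4]
    have h5 := coe_ratGL_smul (det_toGL_pos ModularGroup.S) ⟨_, him⟩
    rw [h1, h2, h3, h4] at h5
    have h6 : (ratGL (toGL ModularGroup.S) • (⟨_, him⟩ : ℍ))
        = ofComplex (Complex.I * ((1 / t : ℝ) : ℂ)) := by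
      rw [← ofComplex_apply (ratGL (toGL ModularGroup.S) • (⟨_, him⟩ : ℍ)), h5]
      congr 1
      push_cast
      simp only [zero_mul, zero_add, one_mul, add_zero, one_div]
      field_simp
      simp
    rw [h6, Real.rpow_natCast]
    push_cast
    simp only [one_mul, add_zero, one_pow, mul_one, smul_eq_mul, mul_pow]
    have : Complex.I ^ k ≠ 0 := pow_ne_zero _ Complex.I_ne_zero
    field_simp
  hf_top r := hF.atInfty.isBigO_atTop r
  hg_top r := (hF _ (det_toGL_pos _)).isBigO_atTop r

/-- The half-line above `i` is the imaginary axis beyond `1`, so the moment is the outer half of a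
Mellin integral at `s = j + 1`. -/
lemma eichlerMoment_I {F : ℍ → ℂ} (j : ℕ) :
    eichlerMoment F j Complex.I = Complex.I ^ (j + 1) *
      (-(∫ t in Ioi (1 : ℝ), (t : ℂ) ^ (((j + 1 : ℕ) : ℂ) - 1) *
        (F (ofComplex (Complex.I * t)) - valueAtInfty F)) + valueAtInfty F / ((j + 1 : ℕ) : ℂ)) := by
  rw [eichlerMoment, integral_segment]
  have h := (measurePreserving_add_left volume (1 : ℝ)).setIntegral_preimage_emb
    (measurableEmbedding_addLeft 1) (fun t : ℝ => (t : ℂ) ^ (((j + 1 : ℕ) : ℂ) - 1) *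
        (F (ofComplex (Complex.I * t)) - valueAtInfty F)) (Ioi 1)
  have hpre : (fun x : ℝ => 1 + x) ⁻¹' Ioi 1 = Ioi 0 := by ext; simp
  rw [hpre] at h
  rw [← h]
  have h2 : ∀ u : ℝ, (F (ofComplex (Complex.I + u * Complex.I)) - valueAtInfty F) *
        (Complex.I + u * Complex.I) ^ j * Complex.I = Complex.I ^ (j + 1) *
        (((1 + u : ℝ) : ℂ) ^ (((j + 1 : ℕ) : ℂ) - 1) *
          (F (ofComplex (Complex.I * ((1 + u : ℝ) : ℂ))) - valueAtInfty F)) := by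
    intro u
    have : Complex.I + u * Complex.I = Complex.I * ((1 + u : ℝ) : ℂ) := by push_cast; ring
    rw [this, Nat.cast_succ, add_sub_cancel_right, cpow_natCast]
    ring
  simp_rw [h2]
  rw [integral_const_mul]
  push_cast
  ring

/-- Riemann's argument: the substitution `t ↦ 1/t` and the functional equation fold `(0, 1)` onto
`(1, ∞)`. -/
lemma WeakFEPair.Λ₀_eq_integrals (P : WeakFEPair ℂ) (s : ℂ) :
    P.Λ₀ s = (∫ t in Ioi (1 : ℝ), (t : ℂ) ^ (s - 1) * (P.f t - P.f₀))
      + P.ε * ∫ t in Ioi (1 : ℝ), (t : ℂ) ^ ((P.k : ℂ) - s - 1) * (P.g t - P.g₀) := by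
  have hconv : MellinConvergent P.f_modif s :=
    (P.isStrongFEPair_toStrongFEPair.hasMellin s).1
  have h01 : Ioc (0 : ℝ) 1 ∪ Ioi 1 = Ioi 0 := Ioc_union_Ioi_eq_Ioi zero_le_one
  have hi : IntegrableOn (fun t : ℝ => (t : ℂ) ^ (s - 1) • P.f_modif t) (Ioc 0 1 ∪ Ioi 1) := by
    rw [h01]; exact hconv
  have e1 : P.Λ₀ s = (∫ t in Ioc (0 : ℝ) 1, (t : ℂ) ^ (s - 1) • P.f_modif t)
      + ∫ t in Ioi (1 : ℝ), (t : ℂ) ^ (s - 1) • P.f_modif t := by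
    rw [← setIntegral_union (Ioc_disjoint_Ioi le_rfl) measurableSet_Ioi hi.left_of_union
      hi.right_of_union, h01]
    rfl
  rw [e1, add_comm]
  congr 1
  · refine setIntegral_congr_fun measurableSet_Ioi fun t ht => ?_
    have ht' : (1 : ℝ) < t := ht
    simp [WeakFEPair.f_modif, ht', not_lt.2 ht'.le]
  · have e2 : (∫ t in Ioc (0 : ℝ) 1, (t : ℂ) ^ (s - 1) • P.f_modif t)
        = mellin ((Ioo 0 1).indicator P.f_modif) s := by
      rw [integral_Ioc_eq_integral_Ioo, mellin]
      have : ∀ t : ℝ, (t : ℂ) ^ (s - 1) • (Ioo 0 1).indicator P.f_modif t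
          = (Ioo 0 1).indicator (fun t : ℝ => (t : ℂ) ^ (s - 1) • P.f_modif t) t := by
        intro t
        by_cases h : t ∈ Ioo (0 : ℝ) 1 <;> simp [h]
      simp_rw [this]
      rw [setIntegral_indicator measurableSet_Ioo]
      congr 2
      ext t; simp
    have e3 := mellin_comp_inv ((Ioo 0 1).indicator P.f_modif) (-s)
    rw [neg_neg] at e3
    rw [e2, ← e3, mellin, ← integral_const_mul]
    have e4 : (∫ t in Ioi (1 : ℝ), P.ε * ((t : ℂ) ^ ((P.k : ℂ) - s - 1) * (P.g t - P.g₀)))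
        = ∫ t in Ioi (0 : ℝ), (Ioi 1).indicator
          (fun t : ℝ => P.ε * ((t : ℂ) ^ ((P.k : ℂ) - s - 1) * (P.g t - P.g₀))) t := by
      rw [setIntegral_indicator measurableSet_Ioi]
      congr 2
      ext t; simp
    rw [e4]
    refine setIntegral_congr_fun measurableSet_Ioi fun t ht => ?_
    have ht' : (0 : ℝ) < t := ht
    by_cases h1 : 1 < t
    · have hmem : t⁻¹ ∈ Ioo (0 : ℝ) 1 := ⟨inv_pos.2 ht', inv_lt_one_of_one_lt₀ h1⟩
      have h5 := P.hf_modif_FE t ht'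
      have h6 : P.g_modif t = P.g t - P.g₀ := by
        simp [WeakFEPair.g_modif, h1, not_lt.2 h1.le]
      rw [one_div, h6] at h5
      simp only [indicator_of_mem hmem, indicator_of_mem (mem_Ioi.2 h1), h5, smul_eq_mul]
      have ht0 : (t : ℂ) ≠ 0 := by exact_mod_cast ht'.ne'
      rw [ofReal_cpow ht'.le, show (P.k : ℂ) - s - 1 = (-s - 1) + P.k by ring,
        cpow_add _ _ ht0]
      ring
    · have hmem : t⁻¹ ∉ Ioo (0 : ℝ) 1 := fun h => by
        have := (inv_lt_one₀ ht').1 h.2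
        exact h1 this
      simp [hmem, h1]

/-- The coefficients of the period between `∞` and `0` are values of the completed `L`-function. -/
lemma eichlerMoment_sub_eq {k : ℕ} (hk : 2 ≤ k) {F : ℍ → ℂ} (hF : IsRegular k F) {j : ℕ}
    (hj : j + 2 ≤ k) :
    eichlerMoment F j Complex.I - (-1) ^ j *
        eichlerMoment (ratSlash k F (toGL ModularGroup.S)) (k - 2 - j) Complex.I
      = -Complex.I ^ (j + 1) * (periodPair (by omega : 1 ≤ k) hF).Λ ((j + 1 : ℕ) : ℂ) := by
  set P := periodPair (by omega : 1 ≤ k) hF with hP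
  obtain ⟨m, rfl⟩ : ∃ m, k = j + m + 2 := ⟨k - 2 - j, by omega⟩
  have hm : j + m + 2 - 2 - j = m := by omega
  -- The segments from `0` in the two moments supply the polar terms `f₀/s` and `ε g₀/(k-s)` by
  -- which `Λ` differs from `Λ₀`.
  rw [WeakFEPair.Λ, WeakFEPair.Λ₀_eq_integrals, eichlerMoment_I, eichlerMoment_I, hm]
  have e1 : ((P.k : ℝ) : ℂ) - ((j + 1 : ℕ) : ℂ) = ((m + 1 : ℕ) : ℂ) := by
    simp only [hP, periodPair]; push_cast; ring
  rw [e1]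
  simp only [hP, periodPair, smul_eq_mul]
  have e2 : Complex.I ^ (j + m + 2) * Complex.I ^ (j + 1) = -(-1) ^ j * Complex.I ^ (m + 1) := by
    have : Complex.I ^ (j + m + 2) * Complex.I ^ (j + 1) = (Complex.I ^ 2) ^ (j + 1) * Complex.I ^ (m + 1) := by
      ring
    rw [this, I_sq]; ring
  have hj0 : ((j + 1 : ℕ) : ℂ) ≠ 0 := by exact_mod_cast j.succ_ne_zero
  have hm0 : ((m + 1 : ℕ) : ℂ) ≠ 0 := by exact_mod_cast m.succ_ne_zero
  generalize (∫ t in Ioi (1 : ℝ), (t : ℂ) ^ (((j + 1 : ℕ) : ℂ) - 1) * (F (ofComplex (Complex.I * t)) - valueAtInfty F)) = A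
  generalize (∫ t in Ioi (1 : ℝ), (t : ℂ) ^ (((m + 1 : ℕ) : ℂ) - 1) *
    (ratSlash (j + m + 2) F (toGL ModularGroup.S) (ofComplex (Complex.I * t)) - valueAtInfty
      (ratSlash (j + m + 2) F (toGL ModularGroup.S)))) = B
  generalize valueAtInfty (ratSlash (j + m + 2) F (toGL ModularGroup.S)) = b
  linear_combination (B - b / ((m + 1 : ℕ) : ℂ)) * e2

/-- The value of the period homomorphism at `{∞, 0}`. -/
theorem per_symbolInftyZero {k : ℕ} (hk : 2 ≤ k) {F : ℍ → ℂ} (hF : IsRegular k F) :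
    per k F symbolInftyZero = momentPoly k fun j =>
      -Complex.I ^ (j + 1) * (periodPair (by omega : 1 ≤ k) hF).Λ ((j + 1 : ℕ) : ℂ) := by
  have hd := det_inv_pos (det_toGL_pos ModularGroup.S)
  have hsym : symbolInftyZero = bracket zInfty (((toGL ModularGroup.S)⁻¹)⁻¹ • zInfty) := by
    rw [inv_inv, smul_S_zInfty]; rfl
  refine evalV_ext fun x y => ?_
  rw [hsym, per_bracket_eq_eichlerDefect hk hF hd UpperHalfPlane.I, evalV_eichlerDefect k F hd,
    evalV_momentPoly, inv_inv]
  obtain ⟨⟨h1, h2⟩, h3, h4⟩ := toGL_S_inv_apply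
  rw [h1, h2, h3, h4, UpperHalfPlane.coe_I]
  have hI : (((0 : ℚ) : ℂ) * Complex.I + ((1 : ℚ) : ℂ)) / (((-1 : ℚ) : ℂ) * Complex.I + ((0 : ℚ) : ℂ))
      = Complex.I := by
    push_cast
    rw [div_eq_iff (by simp)]
    ring_nf
    simp
  rw [hI]
  have hx : ((0 : ℚ) : ℂ) * x - ((-1 : ℚ) : ℂ) * y = y := by push_cast; ring
  have hy : -((1 : ℚ) : ℂ) * x + ((0 : ℚ) : ℂ) * y = -x := by push_cast; ring
  -- `S⁻¹` sends `(x, y)` to `(y, -x)`, hence the reversal `j ↦ k - 2 - j` in the second sum.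
  rw [hx, hy, eichlerEval, eichlerEval, show k - 1 = k - 2 + 1 by omega,
    ← Finset.sum_range_reflect (fun j => ((k - 2).choose j : ℂ) *
      eichlerMoment (ratSlash k F (toGL ModularGroup.S)) j Complex.I * (y ^ j * (-x) ^ (k - 2 - j))),
    ← Finset.sum_sub_distrib]
  refine Finset.sum_congr rfl fun j hj => ?_
  have hj' : j + 2 ≤ k := by have := Finset.mem_range.1 hj; omega
  rw [← eichlerMoment_sub_eq hk hF hj', show k - 2 + 1 - 1 - j = k - 2 - j by omega,
    Nat.choose_symm (by omega), show k - 2 - (k - 2 - j) = j by omega, neg_pow x]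
  ring

end SValue

end EisensteinDedekind

namespace EisensteinDedekind

/-! ### Fourier expansions of Eisenstein series -/

section EisensteinExpansion

open Complex Filter Topology

variable {N : ℕ} [NeZero N]

/-- Division with remainder by `N`. -/
def residueEquiv (N : ℕ) [NeZero N] : ZMod N × ℤ ≃ ℤ where
  toFun p := (p.1.val : ℤ) + N * p.2
  invFun d := ((d : ZMod N), d / N)
  left_inv p := by
    have hN : (N : ℤ) ≠ 0 := by exact_mod_cast NeZero.ne N
    refine Prod.ext (by simp) ?_
    have h := ZMod.val_lt p.1
    show ((p.1.val : ℤ) + N * p.2) / N = p.2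
    rw [Int.add_mul_ediv_left _ _ hN, Int.ediv_eq_zero_of_lt (by positivity) (by exact_mod_cast h),
      zero_add]
  right_inv d := by
    show (((d : ZMod N).val : ℕ) : ℤ) + N * (d / N) = d
    rw [ZMod.val_intCast, Int.emod_add_mul_ediv]

lemma tsum_eq_sum_residue {g : ℤ → ℂ} (hg : Summable g) :
    ∑' d, g d = ∑ j : ZMod N, ∑' n : ℤ, g ((j.val : ℤ) + N * n) := by
  have h := ((residueEquiv N).summable_iff.2 hg).tsum_prod
  exact ((residueEquiv N).tsum_eq g).symm.trans (h.trans (tsum_fintype _))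

lemma sum_fn_eq (F : (Fin 2 → ZMod N) → ℂ) :
    ∑ v, F v = ∑ a : ZMod N, ∑ b : ZMod N, F ![a, b] := by
  rw [← Fintype.sum_prod_type' (f := fun a b => F ![a, b])]
  exact Fintype.sum_equiv (finTwoArrowEquiv _) _ _ fun v => by
    congr 1
    ext i
    fin_cases i <;> rfl

lemma exists_bound_fn (f : Fn N) : ∃ M, 0 ≤ M ∧ ∀ v, ‖f v‖ ≤ M := by
  refine ⟨∑ v, ‖f v‖, by positivity, fun v => ?_⟩
  exact Finset.single_le_sum (f := fun v => ‖f v‖) (fun _ _ => norm_nonneg _) (Finset.mem_univ v)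

lemma norm_stdAddChar (j : ZMod N) : ‖(ZMod.stdAddChar j : ℂ)‖ = 1 := by
  rw [ZMod.stdAddChar_apply, Circle.norm_coe]

/-- The coefficients of the expansion of an Eisenstein series: a partial Fourier transform. -/
noncomputable def eisCoeff (f : Fn N) (m c : ZMod N) : ℂ :=
  (N : ℂ)⁻¹ * ∑ b, f ![-m, b] * ZMod.stdAddChar (-(b * c))

/-- Orthogonality of characters in the second variable undoes one half of the two-dimensional
Fourier transform. -/
lemma sum_fourier_mul_stdAddChar (f : Fn N) (m c : ZMod N) :
    (N : ℂ)⁻¹ * ∑ j, fourier f ![c, j] * ZMod.stdAddChar (j * m) = eisCoeff f m c := by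
  have hN : (N : ℂ) ≠ 0 := by exact_mod_cast NeZero.ne N
  have h1 : ∀ j, fourier f ![c, j] * ZMod.stdAddChar (j * m) = (N : ℂ)⁻¹ * ∑ a, ∑ b,
      f ![a, b] * ZMod.stdAddChar (-(b * c)) * ZMod.stdAddChar (j * (a + m)) := by
    intro j
    rw [fourier, sum_fn_eq, mul_assoc, Finset.sum_mul]
    congr 1
    refine Finset.sum_congr rfl fun a _ => ?_
    rw [Finset.sum_mul]
    refine Finset.sum_congr rfl fun b _ => ?_
    rw [mul_assoc, mul_assoc, ← AddChar.map_add_eq_mul, ← AddChar.map_add_eq_mul]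
    congr 2
    simp
    ring
  simp_rw [h1]
  rw [← Finset.mul_sum, Finset.sum_comm]
  have h2 : ∀ a, ∑ j, ∑ b, f ![a, b] * (ZMod.stdAddChar (-(b * c)) : ℂ) * ZMod.stdAddChar (j * (a + m))
      = if a = -m then N * ∑ b, f ![a, b] * ZMod.stdAddChar (-(b * c)) else 0 := by
    intro a
    rw [Finset.sum_comm]
    simp_rw [← Finset.mul_sum, AddChar.sum_mulShift (a + m) (ZMod.isPrimitive_stdAddChar N),
      ← Finset.sum_mul]
    simp only [add_eq_zero_iff_eq_neg, ZMod.card]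
    split_ifs
    · rw [mul_comm]
    · simp
  simp_rw [h2]
  rw [Finset.sum_ite_eq' Finset.univ (-m), if_pos (Finset.mem_univ _), eisCoeff]
  field_simp

/-- The excluded pair needs no case distinction: there the factor is the inverse of `0^k = 0`, which
is `0` by convention. -/
lemma eisTerm_eq {N k : ℕ} (hk : k ≠ 0) (φ : Fn N) (z : ℍ) (c d : ℤ) :
    eisTerm k φ z c d = φ ![(c : ZMod N), (d : ZMod N)] * (((c : ℂ) * z + d) ^ k)⁻¹ := by
  rw [eisTerm]
  split_ifs with h
  · simp [h.1, h.2, hk]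
  · rfl

lemma summable_eisTerm {k : ℕ} (hk : 2 ≤ k) (φ : Fn N) (z : ℍ) (c : ℤ) :
    Summable (eisTerm k φ z c) := by
  obtain ⟨M, hM0, hM⟩ := exists_bound_fn φ
  have h := EisensteinSeries.linear_right_summable z c (k := k) (by exact_mod_cast hk)
  refine Summable.of_norm_bounded (h.norm.mul_left M) fun d => ?_
  rw [eisTerm_eq (by omega), norm_mul, zpow_natCast]
  gcongr
  exact hM _

/-- The constant in the definition of `Eis_k`. -/
noncomputable def eisConst (N k : ℕ) : ℂ :=
  ((k - 1).factorial : ℂ) / (-2 * Complex.I * Real.pi) ^ k * (N : ℂ) ^ (k - 1)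

lemma eisConst_ne_zero (N k : ℕ) [NeZero N] : eisConst N k ≠ 0 := by
  have hN : (N : ℂ) ≠ 0 := by exact_mod_cast NeZero.ne N
  have hπ : (Real.pi : ℂ) ≠ 0 := by exact_mod_cast Real.pi_ne_zero
  have := Nat.factorial_ne_zero (k - 1)
  unfold eisConst
  simp [hN, hπ, this]

/-- The local parameter at `i∞`. -/
noncomputable def qParamN (N : ℕ) (z : ℂ) : ℂ := cexp (2 * Real.pi * Complex.I * z / N)

lemma norm_qParamN_lt_one {z : ℂ} (hz : 0 < z.im) : ‖qParamN N z‖ < 1 := by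
  have hN : (0 : ℝ) < N := by exact_mod_cast Nat.pos_of_ne_zero (NeZero.ne N)
  have h : (2 * Real.pi * Complex.I * z / N).re = -(2 * Real.pi * z.im / N) := by
    rw [show 2 * Real.pi * Complex.I * z / N = ((2 * Real.pi / N : ℝ) : ℂ) * (Complex.I * z) by
      push_cast; ring, re_ofReal_mul]
    simp
    ring
  rw [qParamN, norm_exp, h, Real.exp_lt_one_iff, neg_lt_zero]
  have := Real.pi_pos
  positivity

/-- Lipschitz's formula at `(cz+j)/N` handles each class `d ≡ j` mod `N`. Summing over `j` produces
the partial Fourier transform `eisCoeff`. -/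
lemma tsum_eisTerm_pos {k : ℕ} (hk : 2 ≤ k) (f : Fn N) (z : ℍ) (c : ℕ+) :
    eisConst N k * ∑' d, eisTerm k (fourier f) z c d
      = ∑' m : ℕ+, (m : ℂ) ^ (k - 1) * eisCoeff f (m : ℕ) (c : ℕ) * qParamN N z ^ (c * m : ℕ) := by
  have hN : (N : ℂ) ≠ 0 := by exact_mod_cast NeZero.ne N
  have hN' : (0 : ℝ) < N := by exact_mod_cast Nat.pos_of_ne_zero (NeZero.ne N)
  have hc : (0 : ℝ) < (c : ℕ) := by exact_mod_cast c.pos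
  have hfac : ((k - 1).factorial : ℂ) ≠ 0 := by exact_mod_cast Nat.factorial_ne_zero _
  have hπ : (Real.pi : ℂ) ≠ 0 := by exact_mod_cast Real.pi_ne_zero
  have hI := Complex.I_ne_zero
  rw [tsum_eq_sum_residue (N := N) (summable_eisTerm hk _ z c)]
  have him (j : ZMod N) : 0 < (((c : ℕ) * (z : ℂ) + (j.val : ℂ)) / N).im := by
    rw [show ((c : ℕ) * (z : ℂ) + (j.val : ℂ)) / N
      = ((1 / N : ℝ) : ℂ) * (((c : ℕ) : ℝ) * (z : ℂ) + ((j.val : ℝ) : ℂ)) by push_cast; ring,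
      im_ofReal_mul, add_im, im_ofReal_mul, ofReal_im, add_zero]
    have := z.im_pos
    positivity
  have h1 (j : ZMod N) : ∑' n : ℤ, eisTerm k (fourier f) z c ((j.val : ℤ) + N * n)
      = fourier f ![((c : ℕ) : ZMod N), j] * ((N : ℂ) ^ k)⁻¹ *
        (((-2 * Real.pi * Complex.I) ^ k / (k - 1).factorial) *
          ∑' m : ℕ+, (m : ℂ) ^ (k - 1) * (qParamN N z ^ (c * m : ℕ) * ZMod.stdAddChar (j * ((m : ℕ) : ZMod N)))) := by
    have h2 := EisensteinSeries.qExpansion_identity_pnat (k := k - 1) (by omega) ⟨_, him j⟩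
    rw [show k - 1 + 1 = k by omega] at h2
    have h3 : ∀ m : ℕ+, cexp (2 * Real.pi * Complex.I * (((c : ℕ) * (z : ℂ) + (j.val : ℂ)) / N)) ^ (m : ℕ)
        = qParamN N z ^ (c * m : ℕ) * ZMod.stdAddChar (j * ((m : ℕ) : ZMod N)) := by
      intro m
      have h4 : (ZMod.stdAddChar (j * ((m : ℕ) : ZMod N)) : ℂ) = cexp (2 * Real.pi * Complex.I * (j.val : ℂ) / N) ^ (m : ℕ) := by
        rw [mul_comm, ← nsmul_eq_mul, AddChar.map_nsmul_eq_pow]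
        congr 1
        have := ZMod.stdAddChar_coe (N := N) (j.val : ℤ)
        simpa using this
      rw [h4, pow_mul, ← mul_pow, qParamN]
      congr 1
      rw [← exp_nat_mul, ← exp_add]
      congr 1
      field_simp
    simp only [h3] at h2
    rw [← h2, ← tsum_mul_left]
    refine tsum_congr fun n => ?_
    rw [eisTerm_eq (by omega)]
    have h5 : (((c : ℕ) : ℤ) : ℂ) * z + (((j.val : ℤ) + N * n : ℤ) : ℂ)
        = N * (((c : ℕ) * (z : ℂ) + (j.val : ℂ)) / N + n) := by
      push_cast
      field_simp
      ring
    rw [h5, mul_pow, mul_inv, one_div, ← mul_assoc]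
    congr 3
    simp
  simp_rw [h1]
  have hs (j : ZMod N) : Summable fun m : ℕ+ => (m : ℂ) ^ (k - 1) *
      (qParamN N z ^ (c * m : ℕ) * ZMod.stdAddChar (j * ((m : ℕ) : ZMod N))) := by
    have := (summable_prod_mul_pow (k - 1) (norm_qParamN_lt_one (N := N) z.im_pos)).prod_factor c
    refine Summable.of_norm_bounded this.norm fun m => ?_
    rw [← mul_assoc, norm_mul _ (ZMod.stdAddChar _), norm_stdAddChar, mul_one]
  have h6 (j : ZMod N) : eisConst N k * (fourier f ![((c : ℕ) : ZMod N), j] * ((N : ℂ) ^ k)⁻¹ *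
        (((-2 * Real.pi * Complex.I) ^ k / (k - 1).factorial) *
          ∑' m : ℕ+, (m : ℂ) ^ (k - 1) * (qParamN N z ^ (c * m : ℕ) * ZMod.stdAddChar (j * ((m : ℕ) : ZMod N)))))
      = ∑' m : ℕ+, ((N : ℂ)⁻¹ * fourier f ![((c : ℕ) : ZMod N), j]) *
        ((m : ℂ) ^ (k - 1) * (qParamN N z ^ (c * m : ℕ) * ZMod.stdAddChar (j * ((m : ℕ) : ZMod N)))) := by
    rw [tsum_mul_left, eisConst, show -2 * (Real.pi : ℂ) * Complex.I = -2 * Complex.I * Real.pi by ring]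
    obtain ⟨l, rfl⟩ : ∃ l, k = l + 1 := ⟨k - 1, by omega⟩
    simp only [Nat.add_sub_cancel] at *
    have : (-2 * Complex.I * (Real.pi : ℂ)) ^ (l + 1) ≠ 0 := by simp [hI, hπ]
    generalize (-2 * Complex.I * (Real.pi : ℂ)) ^ (l + 1) = B at *
    rw [pow_succ (N : ℂ)]
    field_simp
  rw [Finset.mul_sum]
  simp_rw [h6]
  rw [← Summable.tsum_finsetSum fun j _ => (hs j).mul_left _]
  refine tsum_congr fun m => ?_
  rw [← sum_fourier_mul_stdAddChar, Finset.mul_sum, Finset.mul_sum, Finset.sum_mul]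
  refine Finset.sum_congr rfl fun j _ => ?_
  ring

lemma fourier_neg (f : Fn N) (v : Fin 2 → ZMod N) : fourier f (-v) = fourier (reflect f) v := by
  rw [fourier, fourier]
  congr 1
  refine Fintype.sum_equiv (Equiv.neg _) _ _ fun w => ?_
  simp [reflect]

lemma tsum_eisTerm_neg {k : ℕ} (hk : 2 ≤ k) (f : Fn N) (z : ℍ) (c : ℤ) :
    ∑' d, eisTerm k (fourier f) z (-c) d = (-1) ^ k * ∑' d, eisTerm k (fourier (reflect f)) z c d := by
  rw [← (Equiv.neg ℤ).tsum_eq, ← tsum_mul_left]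
  refine tsum_congr fun d => ?_
  rw [eisTerm_eq (by omega), eisTerm_eq (by omega), ← fourier_neg, Equiv.neg_apply]
  have h1 : ((-c : ℤ) : ℂ) * z + ((-d : ℤ) : ℂ) = -1 * ((c : ℂ) * z + d) := by push_cast; ring
  have h2 : (![((-c : ℤ) : ZMod N), ((-d : ℤ) : ZMod N)] : Fin 2 → ZMod N)
      = -![(c : ZMod N), (d : ZMod N)] := by
    ext i; fin_cases i <;> simp
  rw [h1, h2, mul_pow, mul_inv, ← inv_pow, show (-1 : ℂ)⁻¹ = -1 by norm_num]
  ring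

/-- `f + (-1)^k f⁻`. -/
def symmetrize (k : ℕ) (f : Fn N) : Fn N := fun v => f v + (-1) ^ k * f (-v)

lemma eisCoeff_symmetrize (k : ℕ) (f : Fn N) (m c : ZMod N) :
    eisCoeff (symmetrize k f) m c = eisCoeff f m c + (-1) ^ k * eisCoeff (reflect f) m c := by
  simp only [eisCoeff, symmetrize, reflect, add_mul, Finset.sum_add_distrib, mul_add]
  congr 1
  rw [mul_left_comm, Finset.mul_sum (a := (-1 : ℂ) ^ k)]
  congr 1
  exact Finset.sum_congr rfl fun b _ => by ring

/-- The terms of the expansion of an Eisenstein series in powers of the local parameter. -/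
noncomputable def eisQTerm (k : ℕ) (h : Fn N) (q : ℂ) (p : ℕ+ × ℕ+) : ℂ :=
  (p.2 : ℂ) ^ (k - 1) * eisCoeff h (p.2 : ℕ) (p.1 : ℕ) * q ^ (p.1 * p.2 : ℕ)

lemma exists_bound_eisQTerm (k : ℕ) (h : Fn N) : ∃ M, 0 ≤ M ∧ ∀ (q : ℂ) (p : ℕ+ × ℕ+),
    ‖eisQTerm k h q p‖ ≤ M * ((p.2 : ℝ) ^ (k - 1) * ‖q‖ ^ (p.1 * p.2 : ℕ)) := by
  refine ⟨∑ m : ZMod N, ∑ c : ZMod N, ‖eisCoeff h m c‖, by positivity, fun q p => ?_⟩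
  have h1 : ‖eisCoeff h (p.2 : ℕ) (p.1 : ℕ)‖ ≤ ∑ m : ZMod N, ∑ c : ZMod N, ‖eisCoeff h m c‖ :=
    (Finset.single_le_sum (f := fun c => ‖eisCoeff h (p.2 : ℕ) c‖)
      (fun _ _ => norm_nonneg _) (Finset.mem_univ ((p.1 : ℕ) : ZMod N))).trans
    (Finset.single_le_sum (f := fun m => ∑ c : ZMod N, ‖eisCoeff h m c‖)
      (fun _ _ => by positivity) (Finset.mem_univ ((p.2 : ℕ) : ZMod N)))
  rw [eisQTerm, norm_mul, norm_mul, norm_pow, norm_pow, norm_natCast]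
  calc _ ≤ (p.2 : ℝ) ^ (k - 1) * (∑ m : ZMod N, ∑ c : ZMod N, ‖eisCoeff h m c‖)
        * ‖q‖ ^ (p.1 * p.2 : ℕ) := by gcongr
    _ = _ := by ring

lemma summable_eisQTerm (k : ℕ) (h : Fn N) {q : ℂ} (hq : ‖q‖ < 1) : Summable (eisQTerm k h q) := by
  obtain ⟨M, -, hM⟩ := exists_bound_eisQTerm k h
  have := (summable_prod_mul_pow (k - 1) (r := ‖q‖) (by simpa using hq)).mul_left M
  exact Summable.of_norm_bounded this (hM q)

/-- The inner sum with `c = 0`. -/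
noncomputable def eisConstTerm (k : ℕ) (f : Fn N) : ℂ :=
  eisConst N k * ∑' d : ℤ, fourier f ![0, (d : ZMod N)] * ((d : ℂ) ^ k)⁻¹

/-- Summability over `c` is read off from the absolutely convergent expansion in `q`, which also
covers `k = 2`, where the lattice sum is not absolutely convergent. -/
lemma summable_tsum_eisTerm {k : ℕ} (hk : 2 ≤ k) (f : Fn N) (z : ℍ) :
    Summable fun c : ℤ => ∑' d, eisTerm k (fourier f) z c d := by
  have hq := norm_qParamN_lt_one (N := N) z.im_pos
  have h (f : Fn N) : Summable fun n : ℕ => ∑' d, eisTerm k (fourier f) z ((n : ℤ) + 1) d := by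
    have h1 := (summable_eisQTerm k f hq).prod
    have h2 : Summable fun c : ℕ+ => ∑' d, eisTerm k (fourier f) z ((c : ℕ) : ℤ) d := by
      refine (h1.mul_left (eisConst N k)⁻¹).congr fun c => ?_
      rw [inv_mul_eq_iff_eq_mul₀ (eisConst_ne_zero N k), tsum_eisTerm_pos hk]
      rfl
    have h3 := (summable_pnat_iff_summable_succ
      (f := fun n : ℕ => ∑' d, eisTerm k (fourier f) z (n : ℤ) d)).1 h2
    refine h3.congr fun n => ?_
    rw [Nat.cast_succ]
  refine Summable.of_add_one_of_neg_add_one (h f) ?_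
  simp_rw [tsum_eisTerm_neg hk]
  exact (h _).mul_left _

/-- For `k > 2` absolute convergence allows iterated summation, so both cases of the definition can
be treated alike afterwards. -/
lemma eisensteinSeries_eq_iterated {k : ℕ} (hk : 2 ≤ k) (φ : Fn N) (z : ℍ) :
    eisensteinSeries k φ z = ∑' c, ∑' d, eisTerm k φ z c d := by
  rw [eisensteinSeries]
  split_ifs with h2
  · rfl
  · have hs : Summable fun p : ℤ × ℤ => eisTerm k φ z p.1 p.2 := by
      obtain ⟨M, hM0, hM⟩ := exists_bound_fn φ
      have h := summable_prod_eisSummand (k := k) (by omega) z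
      refine Summable.of_norm_bounded (h.norm.mul_left M) fun p => ?_
      rw [eisTerm_eq (by omega), norm_mul, EisensteinSeries.eisSummand, zpow_neg, zpow_natCast]
      gcongr
      · exact hM _
      · simp
    exact hs.tsum_prod

/-- The expansion of an Eisenstein series at `i∞`. -/
theorem eis_eq {k : ℕ} (hk : 2 ≤ k) (f : Fn N) (z : ℍ) :
    eis N k f z = eisConstTerm k f + ∑' p, eisQTerm k (symmetrize k f) (qParamN N z) p := by
  have hq := norm_qParamN_lt_one (N := N) z.im_pos
  have h0 : eis N k f z = eisConst N k * eisensteinSeries k (fourier f) z := rfl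
  have hs := summable_tsum_eisTerm hk f z
  have hi : Function.Injective fun c : ℕ+ => ((c : ℕ) : ℤ) := fun a b h => by
    simpa using h
  have hi' : Function.Injective fun c : ℕ+ => -((c : ℕ) : ℤ) := fun a b h => by
    simpa using h
  rw [h0, eisensteinSeries_eq_iterated hk, tsum_int_eq_zero_add_tsum_pnat hs, mul_add, mul_add,
    add_assoc]
  congr 1
  · rw [eisConstTerm]
    congr 1
    refine tsum_congr fun d => ?_
    rw [eisTerm_eq (by omega)]
    simp
  · have hs1 : Summable fun c : ℕ+ => eisConst N k * ∑' d, eisTerm k (fourier f) z ((c : ℕ) : ℤ) d :=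
      (hs.comp_injective hi).mul_left _
    have hs2 : Summable fun c : ℕ+ => eisConst N k * ∑' d, eisTerm k (fourier f) z (-((c : ℕ) : ℤ)) d :=
      (hs.comp_injective hi').mul_left _
    rw [(summable_eisQTerm k _ hq).tsum_prod, ← tsum_mul_left, ← tsum_mul_left, ← hs1.tsum_add hs2]
    refine tsum_congr fun c => ?_
    rw [tsum_eisTerm_neg hk, tsum_eisTerm_pos hk, mul_left_comm, tsum_eisTerm_pos hk,
      ← tsum_mul_left]
    have h1 := (summable_eisQTerm k f hq).prod_factor c
    have h2 := ((summable_eisQTerm k (reflect f) hq).prod_factor c).mul_left ((-1) ^ k)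
    refine (h1.tsum_add h2).symm.trans (tsum_congr fun m => ?_)
    simp only [eisQTerm, eisCoeff_symmetrize]
    ring

end EisensteinExpansion

end EisensteinDedekind

namespace EisensteinDedekind

/-! ### Eisenstein series at `i∞` -/

section EisensteinInfty

open Complex Filter Topology

variable {N : ℕ} [NeZero N]

lemma differentiableOn_tsum_eisQTerm (k : ℕ) (h : Fn N) :
    DifferentiableOn ℂ (fun q => ∑' p, eisQTerm k h q p) (Metric.ball 0 1) := by
  obtain ⟨M, hM0, hM⟩ := exists_bound_eisQTerm k h
  have key : ∀ r : ℝ, 0 < r → r < 1 →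
      DifferentiableOn ℂ (fun q => ∑' p, eisQTerm k h q p) (Metric.ball 0 r) := by
    intro r hr0 hr
    have hs : Summable fun p : ℕ+ × ℕ+ => M * ((p.2 : ℝ) ^ (k - 1) * r ^ (p.1 * p.2 : ℕ)) :=
      (summable_prod_mul_pow (k - 1) (by rwa [Real.norm_of_nonneg hr0.le])).mul_left M
    refine differentiableOn_tsum_of_summable_norm hs (fun p => ?_) Metric.isOpen_ball
      fun p q hq => (hM q p).trans ?_
    · unfold eisQTerm
      fun_prop
    · have : ‖q‖ ≤ r := by simpa using (mem_ball_zero_iff.1 hq).le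
      gcongr
  intro q hq
  have hq1 : ‖q‖ < 1 := by simpa using hq
  obtain ⟨r, h1, h2⟩ := exists_between hq1
  exact ((key r ((norm_nonneg q).trans_lt h1) h2).differentiableAt
    (Metric.isOpen_ball.mem_nhds (by simpa using h1))).differentiableWithinAt

lemma tsum_eisQTerm_zero (k : ℕ) (h : Fn N) : ∑' p, eisQTerm k h 0 p = 0 := by
  have : ∀ p : ℕ+ × ℕ+, eisQTerm k h 0 p = 0 := fun p => by
    simp [eisQTerm]
  simp [this]

lemma norm_qParamN (N : ℕ) (z : ℂ) : ‖qParamN N z‖ = Real.exp (-(2 * Real.pi / N) * z.im) := by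
  have h : (2 * Real.pi * Complex.I * z / N).re = -(2 * Real.pi / N) * z.im := by
    rw [show 2 * Real.pi * Complex.I * z / N = ((2 * Real.pi / N : ℝ) : ℂ) * (Complex.I * z) by
      push_cast; ring, re_ofReal_mul]
    simp
  rw [qParamN, norm_exp, h]

/-- The power series in `q` is differentiable and vanishes at `0`, hence is `O(q)`, and `|q| =
exp(-2π Im z / N)`. -/
lemma exists_norm_eis_sub_le {k : ℕ} (hk : 2 ≤ k) (f : Fn N) : ∃ C A : ℝ, ∀ z : ℍ, A ≤ z.im →
    ‖eis N k f z - eisConstTerm k f‖ ≤ C * Real.exp (-(2 * Real.pi / N) * z.im) := by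
  have hN : (0 : ℝ) < N := by exact_mod_cast Nat.pos_of_ne_zero (NeZero.ne N)
  have hc : 0 < 2 * Real.pi / N := by have := Real.pi_pos; positivity
  have hd : DifferentiableAt ℂ (fun q => ∑' p, eisQTerm k (symmetrize k f) q p) 0 :=
    (differentiableOn_tsum_eisQTerm k _).differentiableAt (Metric.ball_mem_nhds 0 one_pos)
  obtain ⟨C, hC⟩ := hd.isBigO_sub.bound
  simp only [tsum_eisQTerm_zero, sub_zero] at hC
  obtain ⟨ε, hε, hball⟩ := Metric.eventually_nhds_iff.1 hC
  have ht : Tendsto (fun t : ℝ => Real.exp (-(2 * Real.pi / N) * t)) atTop (𝓝 0) :=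
    Real.tendsto_exp_atBot.comp (tendsto_id.const_mul_atTop_of_neg (neg_neg_of_pos hc))
  obtain ⟨A, hA⟩ := (ht.eventually (gt_mem_nhds hε)).exists_forall_of_atTop
  refine ⟨C, A, fun z hz => ?_⟩
  rw [eis_eq hk, add_sub_cancel_left]
  have h1 : ‖qParamN N z‖ = Real.exp (-(2 * Real.pi / N) * z.im) := norm_qParamN N z
  rw [← h1]
  refine hball ?_
  rw [dist_zero_right, h1]
  exact hA _ hz

theorem isRegularAtInfty_eis {k : ℕ} (hk : 2 ≤ k) (f : Fn N) : IsRegularAtInfty (eis N k f) := by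
  have hN : (0 : ℝ) < N := by exact_mod_cast Nat.pos_of_ne_zero (NeZero.ne N)
  have hc : 0 < 2 * Real.pi / N := by have := Real.pi_pos; positivity
  refine ⟨?_, ?_⟩
  · have h1 : DifferentiableOn ℂ (fun z : ℂ => eisConstTerm k f +
        ∑' p, eisQTerm k (symmetrize k f) (qParamN N z) p) {z : ℂ | 0 < z.im} := by
      refine (differentiableOn_const _).add
        ((differentiableOn_tsum_eisQTerm k (symmetrize k f)).comp ?_ ?_)
      · unfold qParamN; fun_prop
      · intro z hz
        simpa using norm_qParamN_lt_one hz
    refine h1.congr fun z hz => ?_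
    rw [Function.comp_apply, ofComplex_apply_of_im_pos hz, eis_eq hk]
  · obtain ⟨C, A, h⟩ := exists_norm_eis_sub_le hk f
    exact ⟨_, _, hc, C, A, h⟩

lemma valueAtInfty_eis {k : ℕ} (hk : 2 ≤ k) (f : Fn N) :
    valueAtInfty (eis N k f) = eisConstTerm k f := by
  have hN : (0 : ℝ) < N := by exact_mod_cast Nat.pos_of_ne_zero (NeZero.ne N)
  have hc : 0 < 2 * Real.pi / N := by have := Real.pi_pos; positivity
  obtain ⟨C, A, h⟩ := exists_norm_eis_sub_le hk f
  exact valueAtInfty_eq_of_tendsto (tendsto_of_exp_decay hc h)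

/-- For `r ≠ 0` this is `B_h(1-x) = (-1)^h B_h(x)`. At `r = 0` odd Bernoulli numbers vanish for `h >
1`, and for `h = 1` the term `-½ δ` makes the weight zero. -/
lemma betaRat_neg {h : ℕ} (r : ZMod N) : betaRat h (-r) = (-1) ^ h * betaRat h r := by
  have hN : (N : ℚ) ≠ 0 := by exact_mod_cast NeZero.ne N
  rcases eq_or_ne r 0 with rfl | hr
  · rcases Nat.lt_or_ge h 2 with h2 | h2
    · interval_cases h
      · simp [betaRat]
      · simp [betaRat, Polynomial.bernoulli_one]
    · simp only [neg_zero, betaRat, if_neg (by omega : h ≠ 0), if_neg (by omega : h ≠ 1)]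
      simp only [ZMod.val_zero, Nat.cast_zero, zero_div, Polynomial.bernoulli_eval_zero]
      rcases Nat.even_or_odd h with he | ho
      · simp [he.neg_one_pow]
      · simp [bernoulli_eq_zero_of_odd ho (by omega)]
  · have hv : ((-r).val : ℚ) / N = 1 - (r.val : ℚ) / N := by
      have : NeZero r := ⟨hr⟩
      rw [ZMod.val_neg_of_ne_zero, Nat.cast_sub (ZMod.val_lt r).le]
      field_simp
    simp only [betaRat, hv, Polynomial.bernoulli_eval_one_sub, neg_eq_zero, if_neg hr]
    split_ifs with h0 h1
    · simp [h0]
    · simp [h1]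
    · ring

lemma beta_neg {h : ℕ} (r : ZMod N) : beta h (-r) = (-1) ^ h * beta h r := by
  rw [beta, betaRat_neg, beta]; push_cast; rfl

/-- The Fourier series of the Bernoulli polynomial, evaluated at `a/N`. -/
lemma sum_stdAddChar_div_pow {k : ℕ} (hk : 2 ≤ k) (a : ZMod N) :
    HasSum (fun d : ℤ => (ZMod.stdAddChar (a * (d : ZMod N)) : ℂ) * ((d : ℂ) ^ k)⁻¹)
      (-(2 * Real.pi * Complex.I) ^ k / k.factorial *
        (((Polynomial.bernoulli k).eval ((a.val : ℚ) / N) : ℚ) : ℂ)) := by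
  have hN : (0 : ℝ) < N := by exact_mod_cast Nat.pos_of_ne_zero (NeZero.ne N)
  have hx : ((a.val : ℝ) / N) ∈ Set.Icc (0 : ℝ) 1 :=
    ⟨by positivity, by rw [div_le_one hN]; exact_mod_cast (ZMod.val_lt a).le⟩
  have h := hasSum_one_div_pow_mul_fourier_mul_bernoulliFun hk hx
  have hB : (bernoulliFun k ((a.val : ℝ) / N) : ℂ)
      = (((Polynomial.bernoulli k).eval ((a.val : ℚ) / N) : ℚ) : ℂ) := by
    rw [bernoulliFun, show ((a.val : ℝ) / N) = algebraMap ℚ ℝ ((a.val : ℚ) / N) by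
      rw [eq_ratCast]; push_cast; rfl,
      Polynomial.eval_map_algebraMap, Polynomial.aeval_algebraMap_apply]
    simp
  rw [← hB]
  convert! h using 1
  ext d
  rw [fourier_coe_apply, mul_comm, one_div]
  congr 1
  have h2 : a * (d : ZMod N) = (((a.val : ℤ) * d : ℤ) : ZMod N) := by simp
  rw [h2, ZMod.stdAddChar_coe]
  congr 1
  push_cast
  field_simp

/-- The constant term of an Eisenstein series. -/
theorem valueAtInfty_eis_eq {k : ℕ} (hk : 2 ≤ k) (f : Fn N) :
    valueAtInfty (eis N k f) = integral₂ (reflect f) (beta k) (beta 0) := by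
  have hN : (N : ℂ) ≠ 0 := by exact_mod_cast NeZero.ne N
  rw [valueAtInfty_eis hk, eisConstTerm]
  have h1 : HasSum (fun d : ℤ => fourier f ![0, (d : ZMod N)] * ((d : ℂ) ^ k)⁻¹)
      ((N : ℂ)⁻¹ * ∑ w : Fin 2 → ZMod N, f w * (-(2 * Real.pi * Complex.I) ^ k / k.factorial *
        (((Polynomial.bernoulli k).eval (((w 0).val : ℚ) / N) : ℚ) : ℂ))) := by
    have := (hasSum_sum fun (w : Fin 2 → ZMod N) (_ : w ∈ Finset.univ) =>
      (sum_stdAddChar_div_pow hk (w 0)).mul_left (f w)).mul_left (N : ℂ)⁻¹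
    convert! this using 1
    ext d
    rw [fourier, mul_assoc, Finset.sum_mul]
    congr 1
    refine Finset.sum_congr rfl fun w _ => ?_
    simp [mul_assoc]
  rw [h1.tsum_eq, integral₂, ← mul_assoc, Finset.mul_sum]
  -- The substitution `w ↦ -w` matches `reflect`; the resulting sign of `beta k` cancels the
  -- `(-1)^k` hidden in `(-2πi)^k`.
  refine Fintype.sum_equiv (Equiv.neg _) _ _ fun w => ?_
  have h2 : beta k (w 0) = -((N : ℂ) ^ (k - 1) *
      (((Polynomial.bernoulli k).eval (((w 0).val : ℚ) / N) : ℚ) : ℂ) / k) := by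
    simp [beta, betaRat, show k ≠ 0 by omega, show k ≠ 1 by omega]
  have h3 : beta 0 (-w 1) = (N : ℂ)⁻¹ := by simp [beta, betaRat]
  have h4 : ((-1 : ℂ) ^ k) * (-1) ^ k = 1 := by rw [← mul_pow]; norm_num
  simp only [Equiv.neg_apply, reflect, neg_neg, Pi.neg_apply]
  rw [beta_neg, h2, h3, eisConst]
  have hfac : (k.factorial : ℂ) = k * ((k - 1).factorial : ℂ) := by
    rw [← Nat.mul_factorial_pred (by omega)]; push_cast; rfl
  have hf0 : ((k - 1).factorial : ℂ) ≠ 0 := by exact_mod_cast Nat.factorial_ne_zero _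
  have hk0 : (k : ℂ) ≠ 0 := by exact_mod_cast (by omega : k ≠ 0)
  have hπ : (Real.pi : ℂ) ≠ 0 := by exact_mod_cast Real.pi_ne_zero
  have hB : (2 * (Real.pi : ℂ) * Complex.I) ^ k ≠ 0 := by simp [hπ]
  have hB' : (-2 * Complex.I * (Real.pi : ℂ)) ^ k = (-1) ^ k * (2 * (Real.pi : ℂ) * Complex.I) ^ k := by
    rw [← mul_pow]; congr 1; ring
  have h5 : (-1 : ℂ) ^ k ≠ 0 := by simp
  rw [hB', hfac]
  generalize (2 * (Real.pi : ℂ) * Complex.I) ^ k = B at *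
  generalize (-1 : ℂ) ^ k = ε at *
  field_simp
  linear_combination (f w * (((Polynomial.bernoulli k).eval (((w 0).val : ℚ) / N) : ℚ) : ℂ)) * h4

end EisensteinInfty

end EisensteinDedekind

namespace EisensteinDedekind

/-! ### Modularity of Eisenstein series -/

section Modularity

open Complex Filter Topology

variable {N : ℕ} [NeZero N]

/-- The permutation `v ↦ v γ` of `ℤ²`. -/
def intVecEquiv (γ : SL(2, ℤ)) : ℤ × ℤ ≃ ℤ × ℤ where
  toFun p := (p.1 * γ 0 0 + p.2 * γ 1 0, p.1 * γ 0 1 + p.2 * γ 1 1)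
  invFun p := (p.1 * γ 1 1 - p.2 * γ 1 0, -p.1 * γ 0 1 + p.2 * γ 0 0)
  left_inv p := by
    have h := γ.det_coe
    rw [Matrix.det_fin_two] at h
    refine Prod.ext ?_ ?_
    · show (p.1 * γ 0 0 + p.2 * γ 1 0) * γ 1 1 - (p.1 * γ 0 1 + p.2 * γ 1 1) * γ 1 0 = p.1
      linear_combination p.1 * h
    · show -(p.1 * γ 0 0 + p.2 * γ 1 0) * γ 0 1 + (p.1 * γ 0 1 + p.2 * γ 1 1) * γ 0 0 = p.2
      linear_combination p.2 * h
  right_inv p := by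
    have h := γ.det_coe
    rw [Matrix.det_fin_two] at h
    refine Prod.ext ?_ ?_
    · show (p.1 * γ 1 1 - p.2 * γ 1 0) * γ 0 0 + (-p.1 * γ 0 1 + p.2 * γ 0 0) * γ 1 0 = p.1
      linear_combination p.1 * h
    · show (p.1 * γ 1 1 - p.2 * γ 1 0) * γ 0 1 + (-p.1 * γ 0 1 + p.2 * γ 0 0) * γ 1 1 = p.2
      linear_combination p.2 * h

lemma intVecEquiv_cast {N : ℕ} (γ : SL(2, ℤ)) (p : ℤ × ℤ) :
    (![((intVecEquiv γ p).1 : ZMod N), ((intVecEquiv γ p).2 : ZMod N)] : Fin 2 → ZMod N)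
      = vecMulEquiv N γ ![(p.1 : ZMod N), (p.2 : ZMod N)] := by
  ext i
  fin_cases i
  · simp [vecMulEquiv_apply_zero, intVecEquiv]
  · simp [vecMulEquiv_apply_one, intVecEquiv]

lemma denom_ne_zero_int (γ : SL(2, ℤ)) (z : ℍ) : ((γ 1 0 : ℤ) : ℂ) * z + ((γ 1 1 : ℤ) : ℂ) ≠ 0 := by
  have := denom_ne_zero_rat (toGL γ) z.im_pos
  rw [toGL_apply, toGL_apply] at this
  exact_mod_cast this

lemma coe_toGL_smul (γ : SL(2, ℤ)) (z : ℍ) : ((ratGL (toGL γ) • z : ℍ) : ℂ)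
    = (((γ 0 0 : ℤ) : ℂ) * z + ((γ 0 1 : ℤ) : ℂ)) / (((γ 1 0 : ℤ) : ℂ) * z + ((γ 1 1 : ℤ) : ℂ)) := by
  rw [coe_ratGL_smul (det_toGL_pos γ)]
  simp only [toGL_apply]
  push_cast
  rfl

lemma linear_toGL_smul (γ : SL(2, ℤ)) (z : ℍ) (x y : ℂ) :
    x * ((ratGL (toGL γ) • z : ℍ) : ℂ) + y
      = ((x * (γ 0 0 : ℤ) + y * (γ 1 0 : ℤ)) * z + (x * (γ 0 1 : ℤ) + y * (γ 1 1 : ℤ)))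
        / (((γ 1 0 : ℤ) : ℂ) * z + ((γ 1 1 : ℤ) : ℂ)) := by
  have := denom_ne_zero_int γ z
  rw [coe_toGL_smul, eq_div_iff this, add_mul, mul_assoc, div_mul_cancel₀ _ this]
  ring

lemma ratSlash_toGL {k : ℕ} (hk : 1 ≤ k) (F : ℍ → ℂ) (γ : SL(2, ℤ)) (z : ℍ) :
    ratSlash k F (toGL γ) z = F (ratGL (toGL γ) • z) *
      ((((γ 1 0 : ℤ) : ℂ) * z + ((γ 1 1 : ℤ) : ℂ)) ^ k)⁻¹ := by
  rw [ratSlash_apply hk F (det_toGL_pos γ), det_toGL]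
  simp only [toGL_apply]
  push_cast
  rw [one_pow, mul_one]

lemma eisensteinSeries_slash_of_three_le {N k : ℕ} (hk : 3 ≤ k) (φ : Fn N) (γ : SL(2, ℤ)) (z : ℍ) :
    eisensteinSeries k φ (ratGL (toGL γ) • z) *
        ((((γ 1 0 : ℤ) : ℂ) * z + ((γ 1 1 : ℤ) : ℂ)) ^ k)⁻¹
      = eisensteinSeries k (fnSlash γ φ) z := by
  rw [eisensteinSeries, eisensteinSeries, if_neg (by omega), if_neg (by omega), ← tsum_mul_right,
    ← (intVecEquiv γ).tsum_eq fun p : ℤ × ℤ => eisTerm k (fnSlash γ φ) z p.1 p.2]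
  refine tsum_congr fun p => ?_
  rw [eisTerm_eq (by omega), eisTerm_eq (by omega), intVecEquiv_cast, fnSlash_vecMulEquiv,
    linear_toGL_smul, div_pow, mul_assoc]
  have := pow_ne_zero k (denom_ne_zero_int γ z)
  congr 1
  rw [← mul_inv, div_mul_cancel₀ _ this]
  simp [intVecEquiv]

/-- The lattice `ℤ z + ℤ`. -/
noncomputable def periodPairOf (z : ℍ) : PeriodPair where
  ω₁ := z
  ω₂ := 1
  indep := by
    rw [LinearIndependent.pair_iff]
    intro s t h
    have h1 : s * z.im = 0 := by simpa using congrArg Complex.im h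
    have h2 : s = 0 := (mul_eq_zero.1 h1).resolve_right z.im_pos.ne'
    refine ⟨h2, ?_⟩
    rw [h2] at h
    simpa using h

lemma hasSum_weierstrass (z : ℍ) (w : ℂ) :
    HasSum (fun p : ℤ × ℤ => ((w + (p.1 * z + p.2)) ^ 2)⁻¹ - (((p.1 : ℂ) * z + p.2) ^ 2)⁻¹)
      ((periodPairOf z).weierstrassP w) := by
  have h := (periodPairOf z).hasSum_weierstrassP w
  rw [← ((Equiv.neg _).trans (periodPairOf z).latticeEquivProd.symm.toEquiv).hasSum_iff] at h
  convert! h using 1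
  ext p
  simp only [Function.comp_apply, Equiv.trans_apply, Equiv.neg_apply, LinearEquiv.coe_toEquiv,
    PeriodPair.latticeEquiv_symm_apply, one_div]
  simp only [periodPairOf, Prod.fst_neg, Prod.snd_neg, Int.cast_neg]
  congr 2 <;> ring

lemma weierstrass_add_period (z : ℍ) (w : ℂ) (a b : ℤ) :
    (periodPairOf z).weierstrassP (w + (a * z + b)) = (periodPairOf z).weierstrassP w := by
  have h := (periodPairOf z).weierstrassP_add_coe w ((periodPairOf z).latticeEquivProd.symm (a, b))
  rw [PeriodPair.latticeEquiv_symm_apply] at h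
  simpa [periodPairOf] using h

/-- Homogeneity of `℘`: multiplication by `cz+d` maps the lattice of `γ z` onto that of `z`. -/
lemma weierstrass_smul (γ : SL(2, ℤ)) (z : ℍ) (w : ℂ) :
    (periodPairOf (ratGL (toGL γ) • z)).weierstrassP
        (w / (((γ 1 0 : ℤ) : ℂ) * z + ((γ 1 1 : ℤ) : ℂ)))
      = (((γ 1 0 : ℤ) : ℂ) * z + ((γ 1 1 : ℤ) : ℂ)) ^ 2 * (periodPairOf z).weierstrassP w := by
  have h1 := (hasSum_weierstrass z w).mul_left ((((γ 1 0 : ℤ) : ℂ) * z + ((γ 1 1 : ℤ) : ℂ)) ^ 2)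
  rw [← (intVecEquiv γ).hasSum_iff] at h1
  refine (hasSum_weierstrass (ratGL (toGL γ) • z) _).unique ?_
  convert! h1 using 1
  ext p
  have hd := denom_ne_zero_int γ z
  rw [linear_toGL_smul, ← add_div, div_pow, div_pow, inv_div, inv_div, Function.comp_apply]
  simp only [intVecEquiv, Equiv.coe_fn_mk, div_eq_mul_inv]
  push_cast
  ring

/-- Fourier inversion at the origin: in weight two the condition `f 0 = 0` becomes a vanishing sum.
-/
lemma sum_fourier (f : Fn N) : ∑ v, fourier f v = N * f 0 := by
  have hN : (N : ℂ) ≠ 0 := by exact_mod_cast NeZero.ne N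
  have h1 (c : ZMod N) : ∑ j, fourier f ![c, j] = N * eisCoeff f 0 c := by
    rw [← sum_fourier_mul_stdAddChar]
    simp [mul_inv_cancel_left₀ hN]
  rw [sum_fn_eq]
  simp_rw [h1, eisCoeff, mul_inv_cancel_left₀ hN]
  rw [Finset.sum_comm]
  have h2 (b : ZMod N) : ∑ c, f ![-0, b] * (ZMod.stdAddChar (-(b * c)) : ℂ)
      = if b = 0 then N * f ![0, 0] else 0 := by
    rw [← Finset.mul_sum]
    have h3 : ∑ c, (ZMod.stdAddChar (-(b * c)) : ℂ) = ∑ c : ZMod N, ZMod.stdAddChar (c * -b) :=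
      Finset.sum_congr rfl fun c _ => by congr 1; ring
    rw [h3, AddChar.sum_mulShift (-b) (ZMod.isPrimitive_stdAddChar N)]
    simp only [neg_eq_zero, ZMod.card]
    split_ifs with hb
    · rw [hb, neg_zero, mul_comm]
    · simp
  simp_rw [h2]
  rw [Finset.sum_ite_eq' Finset.univ, if_pos (Finset.mem_univ _)]
  congr 2
  ext i; fin_cases i <;> rfl

/-- Since the values of `fourier f` sum to zero, the convergence terms in the series of `℘` cancel.
The point `v = 0` needs no exception, as `hasSum_weierstrass` holds there too with `0⁻¹ = 0`. -/
lemma eisensteinSeries_two (f : Fn N) (hf : f 0 = 0) (z : ℍ) :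
    eisensteinSeries 2 (fourier f) z = ((N : ℂ) ^ 2)⁻¹ * ∑ v : Fin 2 → ZMod N, fourier f v *
      (periodPairOf z).weierstrassP (((v 0).val * z + (v 1).val) / N) := by
  have hN : (N : ℂ) ≠ 0 := by exact_mod_cast NeZero.ne N
  set φ := fourier f with hφ
  have hφ0 : ∑ v, φ v = 0 := by rw [hφ, sum_fourier, hf, mul_zero]
  -- Grouping the lattice into `N × N` blocks gives a summable double series, whose iterated sum is
  -- Eisenstein's.
  set T : ℤ × ℤ → ℂ := fun p => ∑ a : ZMod N, ∑ b : ZMod N,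
    eisTerm 2 φ z ((a.val : ℤ) + N * p.1) ((b.val : ℤ) + N * p.2) with hT
  have h1 : HasSum T (((N : ℂ) ^ 2)⁻¹ * ∑ v : Fin 2 → ZMod N, φ v *
      (periodPairOf z).weierstrassP (((v 0).val * z + (v 1).val) / N)) := by
    have := (hasSum_sum fun (v : Fin 2 → ZMod N) (_ : v ∈ Finset.univ) =>
      (hasSum_weierstrass z (((v 0).val * z + (v 1).val) / N)).mul_left (φ v)).mul_left
        ((N : ℂ) ^ 2)⁻¹
    convert! this using 1
    ext p
    simp only [mul_sub, Finset.sum_sub_distrib, ← Finset.sum_mul, hφ0, zero_mul, sub_zero]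
    rw [Finset.mul_sum, sum_fn_eq, hT]
    refine Finset.sum_congr rfl fun a _ => Finset.sum_congr rfl fun b _ => ?_
    rw [eisTerm_eq (by omega), mul_left_comm, ← mul_inv, ← mul_pow]
    congr 2
    · simp
    · simp only [Matrix.cons_val_zero, Matrix.cons_val_one]
      push_cast
      field_simp
      ring
  have hI := summable_tsum_eisTerm (N := N) le_rfl f z
  have hinj (a : ZMod N) : Function.Injective fun n : ℤ => (a.val : ℤ) + N * n := by
    intro m n h
    simpa [NeZero.ne N] using h
  have hI' (a : ZMod N) : Summable fun n : ℤ => ∑' d, eisTerm 2 φ z ((a.val : ℤ) + N * n) d :=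
    hI.comp_injective (hinj a)
  rw [← h1.tsum_eq, h1.summable.tsum_prod, eisensteinSeries, if_pos rfl, tsum_eq_sum_residue (N := N) hI,
    ← Summable.tsum_finsetSum fun a _ => hI' a]
  refine tsum_congr fun n => ?_
  have hs (c : ℤ) (b : ZMod N) : Summable fun m : ℤ => eisTerm 2 φ z c ((b.val : ℤ) + N * m) :=
    (summable_eisTerm le_rfl φ z c).comp_injective (hinj b)
  simp only [hT]
  rw [Summable.tsum_finsetSum fun a _ => summable_sum fun b _ => hs _ b]
  refine Finset.sum_congr rfl fun a _ => ?_
  rw [Summable.tsum_finsetSum fun b _ => hs _ b,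
    tsum_eq_sum_residue (N := N) (summable_eisTerm le_rfl φ z _)]

lemma eisensteinSeries_slash_two (f : Fn N) (hf : f 0 = 0) (γ : SL(2, ℤ)) (z : ℍ) :
    eisensteinSeries 2 (fourier f) (ratGL (toGL γ) • z) *
        ((((γ 1 0 : ℤ) : ℂ) * z + ((γ 1 1 : ℤ) : ℂ)) ^ 2)⁻¹
      = eisensteinSeries 2 (fourier (fnSlash γ f)) z := by
  have hN : (N : ℂ) ≠ 0 := by exact_mod_cast NeZero.ne N
  rw [eisensteinSeries_two f hf, eisensteinSeries_two _ (by simpa [fnSlash] using hf), fourier_fnSlash,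
    ← (vecMulEquiv N γ).sum_comp fun v => fnSlash γ (fourier f) v *
      (periodPairOf z).weierstrassP (((v 0).val * z + (v 1).val) / N), mul_assoc, Finset.sum_mul]
  congr 1
  refine Finset.sum_congr rfl fun v _ => ?_
  have hd := denom_ne_zero_int γ z
  rw [fnSlash_vecMulEquiv, mul_assoc, linear_toGL_smul, div_right_comm, weierstrass_smul]
  congr 1
  rw [mul_comm, inv_mul_cancel_left₀ (pow_ne_zero 2 hd)]
  -- Lifting residues to `{0, …, N-1}` does not commute with `γ`. The discrepancies `s`, `t` are
  -- absorbed by the periods of `℘`.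
  obtain ⟨s, hs⟩ : ∃ s : ℤ, ((v 0).val : ℤ) * γ 0 0 + (v 1).val * γ 1 0
      = ((vecMulEquiv N γ v 0).val : ℤ) + N * s := by
    have h : ((((v 0).val : ℤ) * γ 0 0 + (v 1).val * γ 1 0 : ℤ) : ZMod N)
        = (((vecMulEquiv N γ v 0).val : ℤ) : ZMod N) := by
      simp [vecMulEquiv_apply_zero]
    obtain ⟨s, hs⟩ := (ZMod.intCast_eq_intCast_iff_dvd_sub _ _ _).1 h.symm
    exact ⟨s, by linarith⟩
  obtain ⟨t, ht⟩ : ∃ t : ℤ, ((v 0).val : ℤ) * γ 0 1 + (v 1).val * γ 1 1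
      = ((vecMulEquiv N γ v 1).val : ℤ) + N * t := by
    have h : ((((v 0).val : ℤ) * γ 0 1 + (v 1).val * γ 1 1 : ℤ) : ZMod N)
        = (((vecMulEquiv N γ v 1).val : ℤ) : ZMod N) := by
      simp [vecMulEquiv_apply_one]
    obtain ⟨s, hs⟩ := (ZMod.intCast_eq_intCast_iff_dvd_sub _ _ _).1 h.symm
    exact ⟨s, by linarith⟩
  rw [← weierstrass_add_period z
    (((vecMulEquiv N γ v 0).val * z + (vecMulEquiv N γ v 1).val) / N) s t]
  congr 1
  have hs' : ((v 0).val : ℂ) * (γ 0 0 : ℤ) + (v 1).val * (γ 1 0 : ℤ)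
      = ((vecMulEquiv N γ v 0).val : ℂ) + N * s := by exact_mod_cast hs
  have ht' : ((v 0).val : ℂ) * (γ 0 1 : ℤ) + (v 1).val * (γ 1 1 : ℤ)
      = ((vecMulEquiv N γ v 1).val : ℂ) + N * t := by exact_mod_cast ht
  rw [hs', ht']
  field_simp
  ring

/-- Eisenstein series are equivariant under `SL₂(ℤ)`. -/
theorem ratSlash_eis {k : ℕ} (hk : 2 ≤ k) (f : Fn' N k) (γ : SL(2, ℤ)) :
    ratSlash k (eis N k f.1) (toGL γ) = eis N k (fnSlash γ f.1) := by
  funext z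
  rw [ratSlash_toGL (by omega), eis, eis, mul_assoc]
  congr 1
  rcases hk.eq_or_lt with rfl | h3
  · exact eisensteinSeries_slash_two f.1 (f.2 rfl) γ z
  · rw [eisensteinSeries_slash_of_three_le h3, fourier_fnSlash]

/-- Any `g` factors as `γ u` with `γ ∈ SL₂(ℤ)` and `u` upper triangular: `γ` permutes Eisenstein
series and `u` preserves `i∞`. -/
theorem isRegular_eis {k : ℕ} (hk : 2 ≤ k) (f : Fn' N k) : IsRegular k (eis N k f.1) := by
  intro g hg
  obtain ⟨γ, hγ⟩ := exists_smul_infty_eq (g • OnePoint.infty)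
  set u := (toGL γ)⁻¹ * g with hu
  have hgu : g = toGL γ * u := by rw [hu, mul_inv_cancel_left]
  have hud : 0 < u.det.val := det_mul_pos (det_inv_pos (det_toGL_pos γ)) hg
  have huI : u • (OnePoint.infty : OnePoint ℚ) = OnePoint.infty := by
    rw [hu, mul_smul, ← hγ, inv_smul_smul]
  have hu10 : u 1 0 = 0 := by
    rw [OnePoint.smul_infty_eq_ite] at huI
    by_contra hne
    rw [if_neg hne] at huI
    exact OnePoint.coe_ne_infty _ huI
  rw [hgu, ratSlash_mul, ratSlash_eis hk]
  exact (isRegularAtInfty_eis hk _).ratSlash_of_upper (by omega) hud hu10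

theorem exists_modularForm_eis {k : ℕ} (hk : 2 ≤ k) (f : Fn' N k) :
    ∃ G : ModularForm ((CongruenceSubgroup.Gamma N).map (Matrix.SpecialLinearGroup.mapGL ℝ)) (k : ℤ),
      ⇑G = eis N k f.1 := by
  have hslash (γ : SL(2, ℤ)) : eis N k f.1 ∣[(k : ℤ)] γ = eis N k (fnSlash γ f.1) := by
    rw [← ratSlash_eis hk, ratSlash, ModularForm.SL_slash]
    congr 1
    ext i j
    simp [toGL]
  refine ⟨⟨⟨eis N k f.1, ?_⟩, ?_, ?_⟩, rfl⟩
  · rintro _ ⟨γ, hγ, rfl⟩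
    have h1 := hslash γ
    have h2 : fnSlash γ f.1 = f.1 := by
      funext v
      have h3 : matMod N γ⁻¹ = 1 := by
        have := CongruenceSubgroup.Gamma_mem'.1 ((CongruenceSubgroup.Gamma N).inv_mem hγ)
        exact congrArg Subtype.val this
      rw [fnSlash_apply, h3, Matrix.vecMul_one]
    rw [h2] at h1
    exact h1
  · exact UpperHalfPlane.mdifferentiable_iff.2 (isRegularAtInfty_eis hk f.1).holo
  · intro c hc
    rw [Subgroup.IsArithmetic.isCusp_iff_isCusp_SL2Z] at hc
    rw [OnePoint.isBoundedAt_iff_forall_SL2Z hc]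
    intro γ _
    show UpperHalfPlane.IsBoundedAtImInfty (eis N k f.1 ∣[(k : ℤ)] γ)
    rw [hslash]
    exact (isRegularAtInfty_eis hk _).tendsto.isBigO_one ℝ

/-! ### Linearity of Eisenstein series -/

lemma fourier_add (f g : Fn N) : fourier (f + g) = fourier f + fourier g := by
  funext v
  simp [fourier, add_mul, Finset.sum_add_distrib, mul_add]

lemma fourier_smul (c : ℂ) (f : Fn N) : fourier (c • f) = c • fourier f := by
  funext v
  simp only [fourier, Pi.smul_apply, smul_eq_mul, Finset.mul_sum]
  exact Finset.sum_congr rfl fun w _ => by ring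

lemma eis_add {k : ℕ} (hk : 2 ≤ k) (f g : Fn N) : eis N k (f + g) = eis N k f + eis N k g := by
  funext z
  have h (c : ℤ) : ∑' d, eisTerm k (fourier (f + g)) z c d
      = ∑' d, eisTerm k (fourier f) z c d + ∑' d, eisTerm k (fourier g) z c d := by
    rw [← (summable_eisTerm hk _ z c).tsum_add (summable_eisTerm hk _ z c)]
    refine tsum_congr fun d => ?_
    rw [eisTerm_eq (by omega), eisTerm_eq (by omega), eisTerm_eq (by omega), fourier_add,
      Pi.add_apply, add_mul]
  rw [Pi.add_apply, eis, eis, eis, eisensteinSeries_eq_iterated hk, eisensteinSeries_eq_iterated hk,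
    eisensteinSeries_eq_iterated hk, ← mul_add,
    ← (summable_tsum_eisTerm hk f z).tsum_add (summable_tsum_eisTerm hk g z)]
  simp_rw [h]

lemma eis_smul {k : ℕ} (hk : 2 ≤ k) (c : ℂ) (f : Fn N) : eis N k (c • f) = c • eis N k f := by
  funext z
  rw [Pi.smul_apply, eis, eis, eisensteinSeries_eq_iterated hk, eisensteinSeries_eq_iterated hk,
    smul_eq_mul, mul_left_comm c]
  congr 1
  rw [← tsum_mul_left]
  refine tsum_congr fun a => ?_
  rw [← tsum_mul_left]
  refine tsum_congr fun d => ?_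
  rw [eisTerm_eq (by omega), eisTerm_eq (by omega), fourier_smul, Pi.smul_apply, smul_eq_mul, mul_assoc]

end Modularity

end EisensteinDedekind

namespace EisensteinDedekind

/-! ### Values of Hurwitz zeta functions at non-positive integers -/

section HurwitzValues

open Complex Filter Topology HurwitzZeta

/-- The mean value inequality is used twice: the first-order Taylor remainder at `0` is bounded by
`M`, and two such remainders occur. -/
lemma norm_interpolation_le {φ φ' φ'' : ℝ → ℂ} {M : ℝ}
    (h1 : ∀ t ∈ Set.Icc (0 : ℝ) 1, HasDerivAt φ (φ' t) t)
    (h2 : ∀ t ∈ Set.Icc (0 : ℝ) 1, HasDerivAt φ' (φ'' t) t)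
    (hM : ∀ t ∈ Set.Icc (0 : ℝ) 1, ‖φ'' t‖ ≤ M) {x : ℝ} (hx : x ∈ Set.Icc (0 : ℝ) 1) :
    ‖φ x - x * φ 1 - (1 - x) * φ 0‖ ≤ 2 * M := by
  have hM0 : 0 ≤ M := (norm_nonneg _).trans (hM 0 (by simp))
  have h3 : ∀ t ∈ Set.Icc (0 : ℝ) 1, ‖φ' t - φ' 0‖ ≤ M := fun t ht => by
    have := norm_image_sub_le_of_norm_deriv_le_segment' (fun y hy => (h2 y hy).hasDerivWithinAt)
      (fun y hy => hM y ⟨hy.1, hy.2.le⟩) t ht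
    refine this.trans ?_
    rw [sub_zero]
    exact mul_le_of_le_one_right hM0 ht.2
  have h4 : ∀ t ∈ Set.Icc (0 : ℝ) 1, ‖φ t - φ 0 - t * φ' 0‖ ≤ M := fun t ht => by
    have h5 : ∀ y ∈ Set.Icc (0 : ℝ) 1, HasDerivAt (fun y : ℝ => φ y - y * φ' 0) (φ' y - φ' 0) y := by
      intro y hy
      have := (h1 y hy).fun_sub ((ofRealCLM.hasDerivAt (x := y)).mul_const (φ' 0))
      simpa using this
    have := norm_image_sub_le_of_norm_deriv_le_segment' (fun y hy => (h5 y hy).hasDerivWithinAt)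
      (fun y hy => h3 y ⟨hy.1, hy.2.le⟩) t ht
    rw [sub_zero] at this
    refine le_trans (le_of_eq ?_) (this.trans (mul_le_of_le_one_right hM0 ht.2))
    congr 1
    simp
    ring
  have h6 : φ x - x * φ 1 - (1 - x) * φ 0
      = (φ x - φ 0 - x * φ' 0) - x * (φ 1 - φ 0 - ((1 : ℝ) : ℂ) * φ' 0) := by
    push_cast; ring
  rw [h6, two_mul]
  refine (norm_sub_le _ _).trans (add_le_add (h4 x hx) ?_)
  rw [norm_mul, norm_real, Real.norm_of_nonneg hx.1]
  exact (mul_le_of_le_one_left (norm_nonneg _) hx.2).trans (h4 1 (by simp))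

/-- The error of linear interpolation of `t ↦ (n + 1 + t)^{-s}` on `[0, 1]`. -/
noncomputable def interpolationError (x : ℝ) (n : ℕ) (s : ℂ) : ℂ :=
  ((n : ℂ) + 1 + x) ^ (-s) - x * ((n : ℂ) + 1 + (1 : ℝ)) ^ (-s)
    - (1 - x) * ((n : ℂ) + 1 + (0 : ℝ)) ^ (-s)

/-- The second derivative is `s(s+1)(n+1+t)^{-s-2}`, where `‖s‖ ‖s+1‖ ≤ 3·4`; doubling gives `24`.
The exponent `-3/2` makes the series summable past `Re s = 0`. -/
lemma norm_interpolationError_le {x : ℝ} (hx : x ∈ Set.Icc (0 : ℝ) 1) (n : ℕ) {s : ℂ}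
    (hs : -1 / 2 < s.re) (hs' : ‖s‖ < 3) :
    ‖interpolationError x n s‖ ≤ 24 * ((n : ℝ) + 1) ^ (-(3 / 2) : ℝ) := by
  have hd (r : ℂ) : ∀ t ∈ Set.Icc (0 : ℝ) 1,
      HasDerivAt (fun t : ℝ => ((n : ℂ) + 1 + t) ^ r) (r * ((n : ℂ) + 1 + t) ^ (r - 1)) t := by
    intro t ht
    have h0 : ((n : ℂ) + 1 + t) ∈ slitPlane := by
      left
      have : 0 ≤ t := ht.1
      simp
      positivity
    have := (((hasDerivAt_id (t : ℂ)).const_add ((n : ℂ) + 1)).cpow_const (c := r) h0).comp_ofReal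
    simpa using this
  have h := norm_interpolation_le (M := 12 * ((n : ℝ) + 1) ^ (-(3 / 2) : ℝ)) (hd (-s))
    (fun t ht => (hd (-s - 1) t ht).const_mul (-s)) (fun t ht => ?_) hx
  · rw [← mul_assoc] at h
    norm_num at h
    simpa [interpolationError] using h
  · have ht0 : 0 ≤ t := ht.1
    have hpos : (0 : ℝ) < (n : ℝ) + 1 + t := by positivity
    have h1 : ‖((n : ℂ) + 1 + t) ^ (-s - 1 - 1)‖ ≤ ((n : ℝ) + 1) ^ (-(3 / 2) : ℝ) := by
      rw [show ((n : ℂ) + 1 + t) = (((n : ℝ) + 1 + t : ℝ) : ℂ) by push_cast; ring,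
        norm_cpow_eq_rpow_re_of_pos hpos]
      calc ((n : ℝ) + 1 + t) ^ ((-s - 1 - 1 : ℂ).re) ≤ ((n : ℝ) + 1 + t) ^ (-(3 / 2) : ℝ) := by
            refine Real.rpow_le_rpow_of_exponent_le (by linarith [(n.cast_nonneg : (0 : ℝ) ≤ n)]) ?_
            simp; linarith
        _ ≤ ((n : ℝ) + 1) ^ (-(3 / 2) : ℝ) :=
            Real.rpow_le_rpow_of_nonpos (by positivity) (by linarith) (by norm_num)
    have h2 : ‖-s‖ ≤ 3 := by rw [norm_neg]; exact hs'.le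
    have h3 : ‖-s - 1‖ ≤ 4 := (norm_sub_le _ _).trans (by rw [norm_one]; linarith)
    rw [norm_mul, norm_mul, ← mul_assoc]
    have h4 : ‖-s‖ * ‖-s - 1‖ ≤ 12 := by nlinarith [norm_nonneg (-s), norm_nonneg (-s - 1)]
    gcongr

/-- The weights `x` and `1 - x` add up to one copy of `ζ`. The shifted sum lacks its first term `1`,
hence the correction `x`. -/
lemma hurwitzZeta_sub_riemannZeta_of_one_lt_re {x : ℝ} (hx : x ∈ Set.Ioo (0 : ℝ) 1) {s : ℂ}
    (hs : 1 < s.re) : hurwitzZeta x s - hurwitzZeta 0 s - (x : ℂ) ^ (-s) + x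
      = ∑' n, interpolationError x n s := by
  have hx0 : (x : ℂ) ≠ 0 := by exact_mod_cast hx.1.ne'
  have h1 : HasSum (fun n : ℕ => ((n : ℂ) + 1 + x) ^ (-s)) (hurwitzZeta x s - (x : ℂ) ^ (-s)) := by
    have := (hasSum_nat_add_iff' 1).2 (hasSum_hurwitzZeta_of_one_lt_re ⟨hx.1.le, hx.2.le⟩ hs)
    simpa [cpow_neg] using this
  have h2 : HasSum (fun n : ℕ => ((n : ℂ) + 1 + (0 : ℝ)) ^ (-s)) (hurwitzZeta 0 s) := by
    have := hasSum_hurwitzZeta_of_one_lt_re (a := 1) ⟨zero_le_one, le_rfl⟩ hs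
    rw [show ((1 : ℝ) : UnitAddCircle) = 0 from AddCircle.coe_period 1] at this
    simpa [cpow_neg] using this
  have h3 : HasSum (fun n : ℕ => ((n : ℂ) + 1 + (1 : ℝ)) ^ (-s)) (hurwitzZeta 0 s - 1) := by
    have := (hasSum_nat_add_iff' 1).2 h2
    simpa [add_assoc] using this
  have h4 := (h1.sub (h3.mul_left (x : ℂ))).sub (h2.mul_left (1 - (x : ℂ)))
  rw [show (∑' n, interpolationError x n s) = _ from h4.tsum_eq]
  ring

/-- The value of the Hurwitz zeta function at `0`. -/
theorem hurwitzZeta_apply_zero {x : ℝ} (hx : x ∈ Set.Ioo (0 : ℝ) 1) :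
    hurwitzZeta x 0 = 1 / 2 - x := by
  have hx0 : (x : ℂ) ≠ 0 := by exact_mod_cast hx.1.ne'
  -- A convex region containing `2`, where the series are explicit, and the target `0`.
  set U : Set ℂ := {s | -1 / 2 < s.re} ∩ Metric.ball 0 3 with hU
  have hUo : IsOpen U := (isOpen_lt continuous_const Complex.continuous_re).inter Metric.isOpen_ball
  have hUc : IsPreconnected U :=
    ((convex_halfSpace_re_gt _).inter (convex_ball _ _)).isPreconnected
  have hf : DifferentiableOn ℂ
      (fun s => hurwitzZeta x s - hurwitzZeta 0 s - (x : ℂ) ^ (-s) + x) U := by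
    refine Differentiable.differentiableOn ?_
    refine ((differentiable_hurwitzZeta_sub_hurwitzZeta x 0).sub ?_).add_const _
    exact fun s => (differentiableAt_id.neg).const_cpow (Or.inl hx0)
  have hs : Summable fun n : ℕ => 24 * ((n : ℝ) + 1) ^ (-(3 / 2) : ℝ) := by
    have h := (summable_nat_add_iff 1).2 (Real.summable_nat_rpow.2 (show (-(3 / 2) : ℝ) < -1 by norm_num))
    exact_mod_cast h.mul_left 24
  have hg : DifferentiableOn ℂ (fun s => ∑' n, interpolationError x n s) U := by
    refine differentiableOn_tsum_of_summable_norm hs (fun n => ?_) hUo fun n s hs =>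
      norm_interpolationError_le ⟨hx.1.le, hx.2.le⟩ n hs.1 (by simpa using hs.2)
    have hb (t : ℝ) (ht : 0 ≤ t) : Differentiable ℂ fun s : ℂ => ((n : ℂ) + 1 + t) ^ (-s) := by
      have h0 : ((n : ℂ) + 1 + t) ≠ 0 := by
        have : (0 : ℝ) < (n : ℝ) + 1 + t := by positivity
        exact_mod_cast this.ne'
      exact fun s => (differentiableAt_id.neg).const_cpow (Or.inl h0)
    unfold interpolationError
    exact (((hb x hx.1.le).sub ((hb 1 zero_le_one).const_mul _)).sub
      ((hb 0 le_rfl).const_mul _)).differentiableOn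
  have h2 : (2 : ℂ) ∈ U := by rw [hU]; constructor <;> simp <;> norm_num
  have h0 : (0 : ℂ) ∈ U := by rw [hU]; constructor <;> norm_num
  have heq := (hf.analyticOnNhd hUo).eqOn_of_preconnected_of_eventuallyEq (hg.analyticOnNhd hUo) hUc h2
    (by
      filter_upwards [(isOpen_lt continuous_const Complex.continuous_re).mem_nhds
        (show (2 : ℂ) ∈ {s : ℂ | 1 < s.re} by simp)] with s hs
      exact hurwitzZeta_sub_riemannZeta_of_one_lt_re hx hs) h0
  -- At `s = 0` a constant is interpolated exactly, so only `ζ(0) = -1/2`, `x^0 = 1` and `x` remain.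
  have hz : ∀ n, interpolationError x n 0 = 0 := fun n => by simp [interpolationError]
  simp only [hz, tsum_zero, neg_zero, cpow_zero, hurwitzZeta_zero, riemannZeta_zero] at heq
  linear_combination heq

/-! ### Zeta functions of residue classes -/

variable {N : ℕ} [NeZero N]

/-- The `L`-function `∑_{n ≡ a} n^{-s}`. -/
noncomputable def residueZeta (a : ZMod N) (s : ℂ) : ℂ := ZMod.LFunction (Pi.single a 1) s

lemma residueZeta_eq (a : ZMod N) (s : ℂ) :
    residueZeta a s = (N : ℂ) ^ (-s) * hurwitzZeta (ZMod.toAddCircle a) s := by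
  simp [residueZeta, ZMod.LFunction, Pi.single_apply]

lemma LFunction_eq_sum_residueZeta (Φ : ZMod N → ℂ) (s : ℂ) :
    ZMod.LFunction Φ s = ∑ a, Φ a * residueZeta a s := by
  simp only [residueZeta_eq, ZMod.LFunction, Finset.mul_sum]
  exact Finset.sum_congr rfl fun a _ => by ring

lemma differentiableAt_residueZeta (a : ZMod N) {s : ℂ} (hs : s ≠ 1) :
    DifferentiableAt ℂ (residueZeta a) s :=
  ZMod.differentiableAt_LFunction _ s (Or.inl hs)

/-- The weight `β_1(0)` was normalized to `0`, whereas `ζ(0) = -1/2`. This one discrepancy is the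
source of all `β'` terms. -/
lemma residueZeta_one_sub (b : ZMod N) {n : ℕ} (hn : 1 ≤ n) :
    residueZeta b (1 - n) = beta n b - if n = 1 ∧ b = 0 then 1 / 2 else 0 := by
  have hN : (N : ℂ) ≠ 0 := by exact_mod_cast NeZero.ne N
  have hN' : (0 : ℝ) < N := by exact_mod_cast Nat.pos_of_ne_zero (NeZero.ne N)
  have hx : ((b.val : ℝ) / N) ∈ Set.Icc (0 : ℝ) 1 :=
    ⟨by positivity, by rw [div_le_one hN']; exact_mod_cast (ZMod.val_lt b).le⟩
  rw [residueZeta_eq, ZMod.toAddCircle_apply]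
  rcases hn.eq_or_lt with rfl | h2
  · simp only [Nat.cast_one, sub_self, neg_zero, cpow_zero, one_mul, true_and]
    rcases eq_or_ne b 0 with rfl | hb
    · simp [beta, betaRat, Polynomial.bernoulli_one, hurwitzZeta_zero, riemannZeta_zero]
      norm_num
    · have hv : 0 < b.val := Nat.pos_of_ne_zero (by simpa using hb)
      rw [hurwitzZeta_apply_zero ⟨by positivity, by
        rw [div_lt_one hN']; exact_mod_cast ZMod.val_lt b⟩]
      rw [beta, betaRat, if_neg one_ne_zero, if_pos rfl, if_neg hb, if_neg hb, Polynomial.bernoulli_one]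
      simp only [Polynomial.eval_sub, Polynomial.eval_X, Polynomial.eval_C]
      push_cast
      ring
  · obtain ⟨m, rfl⟩ : ∃ m, n = m + 1 := ⟨n - 1, by omega⟩
    rw [show (1 : ℂ) - ((m + 1 : ℕ) : ℂ) = -(m : ℂ) by push_cast; ring,
      hurwitzZeta_neg_nat (by omega) hx, neg_neg, cpow_natCast]
    have h3 : Polynomial.eval (((b.val : ℝ) / N : ℝ) : ℂ)
        (Polynomial.map (algebraMap ℚ ℂ) (Polynomial.bernoulli (m + 1)))
        = (((Polynomial.bernoulli (m + 1)).eval ((b.val : ℚ) / N) : ℚ) : ℂ) := by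
      rw [show (((b.val : ℝ) / N : ℝ) : ℂ) = algebraMap ℚ ℂ ((b.val : ℚ) / N) by
        rw [eq_ratCast]; push_cast; rfl, Polynomial.eval_map_algebraMap,
        Polynomial.aeval_algebraMap_apply]
      simp
    rw [h3]
    simp only [beta, betaRat, if_neg (by omega : m + 1 ≠ 0), if_neg (by omega : m + 1 ≠ 1),
      if_neg (by omega : ¬ (m + 1 = 1 ∧ b = 0)), Nat.add_sub_cancel]
    push_cast
    ring

end HurwitzValues

end EisensteinDedekind

namespace EisensteinDedekind

/-! ### The completed `L`-function of an Eisenstein series -/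

section LFunctionEis

open Complex Filter Topology

variable {N : ℕ} [NeZero N]

lemma hasSum_LFunction_pnat (Φ : ZMod N → ℂ) {w : ℂ} (hw : 1 < w.re) :
    HasSum (fun m : ℕ+ => Φ (m : ℕ) * ((m : ℕ) : ℂ) ^ (-w)) (ZMod.LFunction Φ w) := by
  have h1 : HasSum (LSeries.term (fun n : ℕ => Φ n) w) (ZMod.LFunction Φ w) := by
    rw [ZMod.LFunction_eq_LSeries Φ hw]
    exact (ZMod.LSeriesSummable_of_one_lt_re Φ hw).hasSum
  have h2 := (PNat.coe_injective.hasSum_iff (f := LSeries.term (fun n : ℕ => Φ n) w) fun n hn => by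
    have : n = 0 := by
      by_contra h0
      exact hn ⟨⟨n, Nat.pos_of_ne_zero h0⟩, rfl⟩
    rw [this, LSeries.term_zero]).2 h1
  convert! h2 using 1
  ext m
  rw [Function.comp_apply, LSeries.term_of_ne_zero m.ne_zero, cpow_neg, div_eq_mul_inv]

/-- The `L`-function `∑ exp(-2πi b c / N) c^{-s}`. -/
noncomputable def charZeta (b : ZMod N) (s : ℂ) : ℂ :=
  ZMod.LFunction (fun c => ZMod.stdAddChar (-(b * c))) s

lemma hasSum_residueZeta_mul_charZeta (a b : ZMod N) {w s : ℂ} (hw : 1 < w.re) (hs : 1 < s.re) :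
    HasSum (fun p : ℕ+ × ℕ+ => (ZMod.stdAddChar (-(b * ((p.1 : ℕ) : ZMod N))) * ((p.1 : ℕ) : ℂ) ^ (-s)) *
      ((Pi.single a 1 : ZMod N → ℂ) ((p.2 : ℕ) : ZMod N) * ((p.2 : ℕ) : ℂ) ^ (-w)))
      (charZeta b s * residueZeta a w) := by
  have hA : HasSum (fun m : ℕ+ => (ZMod.stdAddChar (-(b * ((m : ℕ) : ZMod N))) : ℂ) *
      ((m : ℕ) : ℂ) ^ (-s)) (charZeta b s) :=
    hasSum_LFunction_pnat (fun c => (ZMod.stdAddChar (-(b * c)) : ℂ)) hs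
  have hB : HasSum (fun m : ℕ+ => (Pi.single a 1 : ZMod N → ℂ) ((m : ℕ) : ZMod N) *
      ((m : ℕ) : ℂ) ^ (-w)) (residueZeta a w) :=
    hasSum_LFunction_pnat (Pi.single a 1 : ZMod N → ℂ) hw
  have hS := summable_mul_of_summable_norm hA.summable.norm hB.summable.norm
  have h := hA.mul hB hS
  exact h

lemma eisCoeff_eq_sum (h : Fn N) (m c : ZMod N) : eisCoeff h m c = (N : ℂ)⁻¹ * ∑ a, ∑ b,
    h ![-a, b] * (ZMod.stdAddChar (-(b * c)) * (Pi.single a 1 : ZMod N → ℂ) m) := by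
  rw [eisCoeff]
  congr 1
  refine ((Finset.sum_eq_single m (fun a _ ha => ?_) (by simp)).trans ?_).symm
  · simp [ha.symm]
  · simp

omit [NeZero N] in
lemma qParamN_pow (n : ℕ) (t : ℝ) : qParamN N (Complex.I * t) ^ n
    = ((Real.exp (-(2 * Real.pi / N * n) * t) : ℝ) : ℂ) := by
  rw [qParamN, ← exp_nat_mul, ofReal_exp]
  congr 1
  push_cast
  ring_nf
  simp

omit [NeZero N] in
lemma cpow_exponent (c m : ℕ+) (s : ℂ) : ((((2 * Real.pi / N * (c * m : ℕ) : ℝ)) : ℂ) ^ s)⁻¹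
    = (2 * Real.pi : ℂ) ^ (-s) * (N : ℂ) ^ s * (((c : ℕ) : ℂ) ^ (-s) * ((m : ℕ) : ℂ) ^ (-s)) := by
  have hπ : (0 : ℝ) ≤ 2 * Real.pi := by have := Real.pi_pos; positivity
  have hN : (0 : ℝ) ≤ (N : ℝ)⁻¹ := by positivity
  have h1 : (2 * Real.pi / N * (c * m : ℕ) : ℝ) = (2 * Real.pi) * (N : ℝ)⁻¹ * (((c : ℕ) : ℝ) * ((m : ℕ) : ℝ)) := by
    push_cast; ring
  rw [h1, ofReal_mul, mul_cpow_ofReal_nonneg (by positivity) (by positivity), ofReal_mul,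
    mul_cpow_ofReal_nonneg hπ hN, ofReal_mul ((c : ℕ) : ℝ),
    mul_cpow_ofReal_nonneg (by positivity) (by positivity)]
  have h2 : (((N : ℝ)⁻¹ : ℝ) : ℂ) ^ s = ((N : ℂ) ^ s)⁻¹ := by
    rw [ofReal_inv, ofReal_natCast, inv_cpow _ _ (by
      rw [natCast_arg]; exact Real.pi_pos.ne)]
  rw [h2, cpow_neg, cpow_neg, cpow_neg]
  push_cast
  simp only [mul_inv, inv_inv]

/-- The completed `L`-function of `Eis_k(f)` in the domain of absolute convergence. -/
lemma Λ_eis_of_lt_re {k : ℕ} (hk : 2 ≤ k) (f : Fn' N k) {s : ℂ} (hs : (k : ℝ) < s.re) :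
    (periodPair (by omega : 1 ≤ k) (isRegular_eis hk f)).Λ s
      = (N : ℂ) ^ (s - 1) * (2 * Real.pi : ℂ) ^ (-s) * Complex.Gamma s *
        ∑ a, ∑ b, symmetrize k f.1 ![-a, b] * (charZeta b s * residueZeta a (s - k + 1)) := by
  have hN0 : (N : ℂ) ≠ 0 := by exact_mod_cast NeZero.ne N
  have hN : (0 : ℝ) < N := by exact_mod_cast Nat.pos_of_ne_zero (NeZero.ne N)
  have hk2 : (2 : ℝ) ≤ k := by exact_mod_cast hk
  have hs1 : 1 < s.re := by linarith
  have hw : 1 < (s - k + 1).re := by simp; linarith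
  set P := periodPair (by omega : 1 ≤ k) (isRegular_eis hk f) with hP
  set h := symmetrize k f.1 with hh
  set A : ℕ+ × ℕ+ → ℂ := fun p => (p.2 : ℂ) ^ (k - 1) * eisCoeff h (p.2 : ℕ) (p.1 : ℕ) with hA
  have hterm (p : ℕ+ × ℕ+) : A p * ((((2 * Real.pi / N * (p.1 * p.2 : ℕ) : ℝ)) : ℂ) ^ s)⁻¹
      = ((N : ℂ) ^ (s - 1) * (2 * Real.pi : ℂ) ^ (-s)) * ∑ a, ∑ b, h ![-a, b] *
        ((ZMod.stdAddChar (-(b * ((p.1 : ℕ) : ZMod N))) * ((p.1 : ℕ) : ℂ) ^ (-s)) *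
        ((Pi.single a 1 : ZMod N → ℂ) ((p.2 : ℕ) : ZMod N) * ((p.2 : ℕ) : ℂ) ^ (-(s - k + 1)))) := by
    have hm : ((p.2 : ℕ) : ℂ) ≠ 0 := by exact_mod_cast p.2.ne_zero
    have h1 : ((p.2 : ℕ) : ℂ) ^ (-(s - k + 1)) = ((p.2 : ℕ) : ℂ) ^ (k - 1) * ((p.2 : ℕ) : ℂ) ^ (-s) := by
      rw [← cpow_natCast, ← cpow_add _ _ hm]
      congr 1
      push_cast [Nat.cast_sub (by omega : 1 ≤ k)]
      ring
    rw [cpow_exponent, hA]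
    simp only
    rw [eisCoeff_eq_sum, h1, cpow_sub _ _ hN0, cpow_one]
    simp only [Finset.mul_sum, Finset.sum_mul]
    refine Finset.sum_congr rfl fun a _ => Finset.sum_congr rfl fun b _ => ?_
    field_simp
  have hsum : HasSum (fun p => Complex.Gamma s * A p * ((((2 * Real.pi / N * (p.1 * p.2 : ℕ) : ℝ)) : ℂ) ^ s)⁻¹)
      ((N : ℂ) ^ (s - 1) * (2 * Real.pi : ℂ) ^ (-s) * Complex.Gamma s *
        ∑ a, ∑ b, h ![-a, b] * (charZeta b s * residueZeta a (s - k + 1))) := by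
    have := (hasSum_sum fun (a : ZMod N) (_ : a ∈ Finset.univ) =>
      hasSum_sum fun (b : ZMod N) (_ : b ∈ Finset.univ) =>
        (hasSum_residueZeta_mul_charZeta a b hw hs1).mul_left (h ![-a, b])).mul_left
          ((N : ℂ) ^ (s - 1) * (2 * Real.pi : ℂ) ^ (-s) * Complex.Gamma s)
    convert! this using 1
    ext p
    rw [mul_assoc, hterm]
    ring
  have hmellin := hasSum_mellin (a := A) (p := fun p : ℕ+ × ℕ+ => 2 * Real.pi / N * (p.1 * p.2 : ℕ))
    (F := fun t => P.f t - P.f₀) (s := s) (fun p => Or.inr (by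
      have := Real.pi_pos
      have h1 : (0 : ℝ) < (p.1 * p.2 : ℕ) := by exact_mod_cast Nat.mul_pos p.1.pos p.2.pos
      positivity)) (by linarith) (fun t ht => ?_) ?_
  · rw [← (P.hasMellin (s := s) hs).2]
    refine hmellin.unique ?_
    simpa only [div_eq_mul_inv] using hsum
  · have him : 0 < (Complex.I * (t : ℂ)).im := by simpa using ht
    have h1 : P.f t - P.f₀ = ∑' p, eisQTerm k h (qParamN N (Complex.I * t)) p := by
      simp only [hP, periodPair]
      rw [valueAtInfty_eis hk, ofComplex_apply_of_im_pos him, eis_eq hk, add_sub_cancel_left]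
    rw [h1]
    convert! (summable_eisQTerm k h (norm_qParamN_lt_one (N := N) him)).hasSum using 1
    ext p
    rw [eisQTerm, qParamN_pow]
  · have h1 := hsum.summable.norm
    have hΓ : Complex.Gamma s ≠ 0 := Gamma_ne_zero_of_re_pos (by linarith)
    refine (h1.mul_left ‖Complex.Gamma s‖⁻¹).congr fun p => ?_
    have h2 : (0 : ℝ) < 2 * Real.pi / N * (p.1 * p.2 : ℕ) := by
      have := Real.pi_pos
      have h1 : (0 : ℝ) < (p.1 * p.2 : ℕ) := by exact_mod_cast Nat.mul_pos p.1.pos p.2.pos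
      positivity
    rw [norm_mul, norm_mul, norm_inv, norm_cpow_eq_rpow_re_of_pos h2, ← mul_assoc, ← mul_assoc,
      inv_mul_cancel₀ (norm_ne_zero_iff.2 hΓ), one_mul, div_eq_mul_inv ‖A p‖]

lemma dft_single (b : ZMod N) :
    ZMod.dft (Pi.single b 1 : ZMod N → ℂ) = fun c => ZMod.stdAddChar (-(b * c)) := by
  ext c
  rw [ZMod.dft_apply, Finset.sum_eq_single b]
  · simp
  · intro a _ ha; simp [ha]
  · simp

/-- The functional equation of the Hurwitz zeta function, solved for the periodic zeta function. -/
lemma residueZeta_one_sub_sub (b : ZMod N) {s : ℂ} (hs : 1 < s.re) :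
    cexp (Real.pi * Complex.I * s / 2) * residueZeta b (1 - s)
        - cexp (-Real.pi * Complex.I * s / 2) * residueZeta (-b) (1 - s)
      = (cexp (Real.pi * Complex.I * s) - cexp (-Real.pi * Complex.I * s)) *
        ((N : ℂ) ^ (s - 1) * (2 * Real.pi : ℂ) ^ (-s) * Complex.Gamma s * charZeta b s) := by
  have h1 : ∀ n : ℕ, s ≠ -n := fun n h => by
    rw [h] at hs; simp at hs; linarith [(n.cast_nonneg : (0 : ℝ) ≤ n)]
  have h2 : s ≠ 1 := fun h => by rw [h] at hs; simp at hs
  have hneg (b : ZMod N) : (fun x => (Pi.single b 1 : ZMod N → ℂ) (-x)) = Pi.single (-b) 1 := by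
    ext x; simp [Pi.single_apply, neg_eq_iff_eq_neg]
  have h3 (b : ZMod N) := ZMod.LFunction_one_sub (Pi.single b 1 : ZMod N → ℂ) h1 (Or.inr h2)
  simp only [hneg, dft_single] at h3
  have e1 : cexp (Real.pi * Complex.I * s) = cexp (Real.pi * Complex.I * s / 2) * cexp (Real.pi * Complex.I * s / 2) := by
    rw [← exp_add]; ring_nf
  have e2 : cexp (-Real.pi * Complex.I * s) = cexp (-Real.pi * Complex.I * s / 2) * cexp (-Real.pi * Complex.I * s / 2) := by
    rw [← exp_add]; ring_nf
  -- The functional equations for `b` and `-b` are linear in `charZeta b` and `charZeta (-b)`; the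
  -- combination chosen eliminates the second.
  have h4 := h3 b
  have h5 := h3 (-b)
  rw [neg_neg] at h5
  rw [residueZeta, residueZeta, h4, h5, e1, e2, charZeta]
  ring

/-- The right hand side of the functional equation. -/
noncomputable def hurwitzSum (k : ℕ) (h : Fn N) (s : ℂ) : ℂ :=
  ∑ a, ∑ b, h ![-a, b] * (residueZeta a (s - k + 1) *
    (cexp (Real.pi * Complex.I * s / 2) * residueZeta b (1 - s)
        - cexp (-Real.pi * Complex.I * s / 2) * residueZeta (-b) (1 - s)))

lemma hasDerivAt_hurwitzSum (k : ℕ) (h : Fn N) {s : ℂ} (h0 : s ≠ 0) (hk : s ≠ k) :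
    HasDerivAt (hurwitzSum k h) (∑ a, ∑ b, h ![-a, b] * (deriv (residueZeta a) (s - k + 1) *
      (cexp (Real.pi * Complex.I * s / 2) * residueZeta b (1 - s)
        - cexp (-Real.pi * Complex.I * s / 2) * residueZeta (-b) (1 - s)) +
      residueZeta a (s - k + 1) * (Real.pi * Complex.I / 2 *
        (cexp (Real.pi * Complex.I * s / 2) * residueZeta b (1 - s)
        + cexp (-Real.pi * Complex.I * s / 2) * residueZeta (-b) (1 - s)) -
        (cexp (Real.pi * Complex.I * s / 2) * deriv (residueZeta b) (1 - s)
        - cexp (-Real.pi * Complex.I * s / 2) * deriv (residueZeta (-b)) (1 - s))))) s := by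
  have hz (a : ZMod N) : HasDerivAt (fun s => residueZeta a (s - k + 1))
      (deriv (residueZeta a) (s - k + 1)) s := by
    have h1 : s - k + 1 ≠ 1 := by
      rw [Ne, add_eq_right, sub_eq_zero]; exact hk
    have := (differentiableAt_residueZeta a h1).hasDerivAt.comp s
      (((hasDerivAt_id s).sub_const (k : ℂ)).add_const 1)
    simpa using! this
  have hy (b : ZMod N) : HasDerivAt (fun s => residueZeta b (1 - s))
      (-deriv (residueZeta b) (1 - s)) s := by
    have h1 : 1 - s ≠ 1 := by rw [Ne, sub_eq_self]; exact h0
    have := (differentiableAt_residueZeta b h1).hasDerivAt.comp s ((hasDerivAt_id s).const_sub 1)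
    simpa using! this
  have he (c : ℂ) : HasDerivAt (fun s => cexp (c * s / 2)) (c / 2 * cexp (c * s / 2)) s := by
    have := (((hasDerivAt_id s).const_mul c).div_const 2).cexp
    simpa [mul_comm] using! this
  unfold hurwitzSum
  refine HasDerivAt.fun_sum fun a _ => HasDerivAt.fun_sum fun b _ => ?_
  convert! ((hz a).fun_mul (((he (Real.pi * Complex.I)).fun_mul (hy b)).fun_sub
    ((he (-Real.pi * Complex.I)).fun_mul (hy (-b))))).const_mul (h ![-a, b]) using 1
  ring

/-- The functional equation, in the form of an identity between meromorphic functions. -/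
lemma Λ_eis_eq_hurwitzSum {k : ℕ} (hk : 2 ≤ k) (f : Fn' N k) {s : ℂ} (h0 : s ≠ 0) (hsk : s ≠ k) :
    (cexp (Real.pi * Complex.I * s) - cexp (-Real.pi * Complex.I * s)) *
      (periodPair (by omega : 1 ≤ k) (isRegular_eis hk f)).Λ s = hurwitzSum k (symmetrize k f.1) s := by
  set P := periodPair (by omega : 1 ≤ k) (isRegular_eis hk f) with hP
  -- Only `0` and `k` can be poles of either side. The complement of a finite set in `ℂ` is
  -- connected, so the identity extends from `Re s > k`.
  set U : Set ℂ := {0, (k : ℂ)}ᶜ with hU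
  have hUo : IsOpen U := (Set.toFinite _).isClosed.isOpen_compl
  have hUc : IsPreconnected U := by
    refine (Set.Countable.isConnected_compl_of_one_lt_rank ?_ (Set.toFinite _).countable).isPreconnected
    rw [rank_real_complex]; exact Nat.one_lt_ofNat
  have hmem {s : ℂ} : s ∈ U ↔ s ≠ 0 ∧ s ≠ k := by simp [hU]
  have hL : DifferentiableOn ℂ (fun s => (cexp (Real.pi * Complex.I * s) - cexp (-Real.pi * Complex.I * s)) *
      P.Λ s) U := by
    intro s hs
    refine DifferentiableAt.differentiableWithinAt (DifferentiableAt.fun_mul (by fun_prop) ?_)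
    exact P.differentiableAt_Λ (Or.inl (hmem.1 hs).1) (Or.inl (by simpa [hP, periodPair] using (hmem.1 hs).2))
  have hR : DifferentiableOn ℂ (hurwitzSum k (symmetrize k f.1)) U := fun s hs =>
    (hasDerivAt_hurwitzSum k _ (hmem.1 hs).1 (hmem.1 hs).2).differentiableAt.differentiableWithinAt
  have hk0 : ((k : ℂ) + 1) ∈ U := by
    rw [hmem]
    refine ⟨?_, by simp⟩
    exact_mod_cast (Nat.succ_ne_zero k)
  refine (hL.analyticOnNhd hUo).eqOn_of_preconnected_of_eventuallyEq (hR.analyticOnNhd hUo) hUc hk0 ?_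
    (hmem.2 ⟨h0, hsk⟩)
  filter_upwards [(isOpen_lt continuous_const Complex.continuous_re).mem_nhds
        (show ((k : ℂ) + 1) ∈ {s : ℂ | (k : ℝ) < s.re} by simp)] with s hs
  have hs1 : 1 < s.re := by
    have : (2 : ℝ) ≤ k := by exact_mod_cast hk
    have : (k : ℝ) < s.re := hs
    linarith
  rw [Λ_eis_of_lt_re hk f hs, hurwitzSum]
  simp only [Finset.mul_sum]
  refine Finset.sum_congr rfl fun a _ => Finset.sum_congr rfl fun b _ => ?_
  rw [residueZeta_one_sub_sub b hs1]
  ring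

end LFunctionEis

end EisensteinDedekind

namespace EisensteinDedekind

/-! ### The values of the completed `L`-function at integers -/

section IntegerValues

open Complex Filter Topology

variable {N : ℕ} [NeZero N]

lemma integral₂_eq (f : Fn N) (μ ν : ZMod N → ℂ) :
    integral₂ f μ ν = ∑ a, ∑ b, f ![a, b] * μ a * ν b := by
  rw [integral₂, sum_fn_eq]
  simp

omit [NeZero N] in
lemma symmetrize_neg {k : ℕ} (f : Fn N) (a b : ZMod N) :
    symmetrize k f ![-a, -b] = (-1) ^ k * symmetrize k f ![a, b] := by
  have h : (![-a, -b] : Fin 2 → ZMod N) = -![a, b] := by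
    ext i; fin_cases i <;> rfl
  have h2 : ((-1 : ℂ) ^ k) * (-1) ^ k = 1 := by rw [← mul_pow]; norm_num
  rw [h, symmetrize, symmetrize, neg_neg, mul_add, ← mul_assoc, h2]
  ring

lemma sum_sum_neg (F : ZMod N → ZMod N → ℂ) : ∑ a, ∑ b, F (-a) (-b) = ∑ a, ∑ b, F a b :=
  (Equiv.sum_comp (Equiv.neg (ZMod N)) fun a => ∑ b, F a (-b)).trans
    (Finset.sum_congr rfl fun a _ => Equiv.sum_comp (Equiv.neg (ZMod N)) (F a))

/-- The contribution of the Bernoulli distributions. -/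
lemma sum_symmetrize_beta (n m : ℕ) (f : Fn N) :
    ∑ a, ∑ b, symmetrize (n + m) f ![-a, b] * (beta m a * beta n b)
      = 2 * (-1) ^ n * integral₂ (reflect f) (beta m) (beta n) := by
  have h1 : ∑ a : ZMod N, ∑ b : ZMod N, f ![-a, b] * (beta m a * beta n b)
      = (-1) ^ n * integral₂ (reflect f) (beta m) (beta n) := by
    rw [integral₂_eq, Finset.mul_sum]
    refine Finset.sum_congr rfl fun a _ => ?_
    rw [← Equiv.sum_comp (Equiv.neg (ZMod N)), Finset.mul_sum]
    refine Finset.sum_congr rfl fun b _ => ?_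
    rw [Equiv.neg_apply, beta_neg, reflect, Matrix.neg_cons, Matrix.neg_cons, Matrix.neg_empty]
    ring
  have h2 : ∑ a : ZMod N, ∑ b : ZMod N, f (-![-a, b]) * (beta m a * beta n b)
      = (-1) ^ m * integral₂ (reflect f) (beta m) (beta n) := by
    rw [integral₂_eq, Finset.mul_sum, ← Equiv.sum_comp (Equiv.neg (ZMod N))]
    refine Finset.sum_congr rfl fun a _ => ?_
    rw [Finset.mul_sum]
    refine Finset.sum_congr rfl fun b _ => ?_
    rw [Equiv.neg_apply, beta_neg, reflect, neg_neg]
    ring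
  have h3 : ((-1 : ℂ) ^ m) * (-1) ^ m = 1 := by rw [← mul_pow]; norm_num
  simp only [symmetrize, add_mul, Finset.sum_add_distrib, mul_assoc ((-1 : ℂ) ^ (n + m)),
    ← Finset.mul_sum]
  rw [h1, h2, pow_add]
  linear_combination ((-1) ^ n * integral₂ (reflect f) (beta m) (beta n)) * h3

/-- The parity of `β_r` cancels everything but the correction at `r = 1`, `b = 0`. -/
lemma sub_neg_of_eq_beta {r : ℕ} {X : ZMod N → ℂ}
    (hX : ∀ b, X b = beta r b - if r = 1 ∧ b = 0 then 1 / 2 else 0) (b : ZMod N) :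
    X b - (-1) ^ r * X (-b) = -if r = 1 ∧ b = 0 then 1 else 0 := by
  have hsq : ((-1 : ℂ) ^ r) * (-1) ^ r = 1 := by rw [← mul_pow]; norm_num
  rw [hX, hX, beta_neg]
  simp only [neg_eq_zero]
  split_ifs with h
  · rw [h.1]; ring
  · linear_combination (-beta r b) * hsq

lemma add_neg_of_eq_beta {r : ℕ} {X : ZMod N → ℂ}
    (hX : ∀ b, X b = beta r b - if r = 1 ∧ b = 0 then 1 / 2 else 0) (b : ZMod N) :
    X b + (-1) ^ r * X (-b) = 2 * beta r b := by
  have hsq : ((-1 : ℂ) ^ r) * (-1) ^ r = 1 := by rw [← mul_pow]; norm_num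
  rw [hX, hX, beta_neg]
  simp only [neg_eq_zero]
  split_ifs with h
  · rw [h.1]; ring
  · linear_combination beta r b * hsq

/-- Each derivative (`Zd` or `Y'`) ends up multiplied by an antisymmetrized value of the other
factor, which by `sub_neg_of_eq_beta` vanishes unless its index is `1`, and is then supported at
`0`. `Zd` and `Y'` stay arbitrary since nothing about the derivatives is used. -/
lemma sum_symmetrize_hurwitz (n m : ℕ) (f : Fn N) (Zd Y' : ZMod N → ℂ) (c : ℂ)
    {Y Z : ZMod N → ℂ} (hY : ∀ b, Y b = beta n b - if n = 1 ∧ b = 0 then 1 / 2 else 0)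
    (hZ : ∀ a, Z a = beta m a - if m = 1 ∧ a = 0 then 1 / 2 else 0) :
    ∑ a, ∑ b, symmetrize (n + m) f ![-a, b] * (Zd a * (Y b - (-1) ^ n * Y (-b)) +
        Z a * (c * (Y b + (-1) ^ n * Y (-b)) - (Y' b - (-1) ^ n * Y' (-b))))
      = 4 * c * (-1) ^ n * integral₂ (reflect f) (beta m) (beta n)
        - (if n = 1 then ∑ a, symmetrize (n + m) f ![-a, 0] * Zd a else 0)
        + (if m = 1 then ∑ b, symmetrize (n + m) f ![0, b] * Y' b else 0) := by
  have hbeta := sum_symmetrize_beta n m f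
  have hneg (a b : ZMod N) : symmetrize (n + m) f ![a, -b]
      = (-1) ^ (n + m) * symmetrize (n + m) f ![-a, b] := by
    rw [← symmetrize_neg, neg_neg]
  generalize symmetrize (n + m) f = h at *
  have hsq (r : ℕ) : ((-1 : ℂ) ^ r) * (-1) ^ r = 1 := by rw [← mul_pow]; norm_num
  have e1 : ∑ a, ∑ b, h ![-a, b] * (Zd a * (Y b - (-1) ^ n * Y (-b)))
      = -if n = 1 then ∑ a, h ![-a, 0] * Zd a else 0 := by
    simp only [sub_neg_of_eq_beta hY]
    split_ifs with hn
    · simp [hn]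
    · simp [hn]
  have e2 : ∑ a, ∑ b, h ![-a, b] * (Z a * (c * (Y b + (-1) ^ n * Y (-b))))
      = 4 * c * (-1) ^ n * integral₂ (reflect f) (beta m) (beta n) := by
    -- For `m = 1` the functions `h(0, ·)` and `β_n` have opposite parity, so the correction to `Z`
    -- pairs to zero with `β_n`.
    have h0 : ∑ a : ZMod N, ∑ b : ZMod N, h ![-a, b] *
        ((if m = 1 ∧ a = 0 then 1 / 2 else 0) * beta n b) = 0 := by
      by_cases hm : m = 1
      · subst hm
        have h1 : ∑ b : ZMod N, h ![0, b] * beta n b = 0 := by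
          have h2 := Equiv.sum_comp (Equiv.neg (ZMod N)) fun b => h ![0, b] * beta n b
          simp only [Equiv.neg_apply, hneg, neg_zero, beta_neg] at h2
          have h3 (b : ZMod N) : (-1) ^ (n + 1) * h ![0, b] * ((-1) ^ n * beta n b)
              = -(h ![0, b] * beta n b) := by
            rw [pow_succ]; linear_combination (-(h ![0, b] * beta n b)) * hsq n
          simp only [h3, Finset.sum_neg_distrib] at h2
          linear_combination (-1 / 2) * h2
        rw [Finset.sum_eq_single 0 (fun a _ ha => by simp [ha]) (by simp)]
        simp only [and_self, if_true, neg_zero]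
        calc _ = 1 / 2 * ∑ b : ZMod N, h ![0, b] * beta n b := by
              rw [Finset.mul_sum]; exact Finset.sum_congr rfl fun b _ => by ring
          _ = 0 := by rw [h1, mul_zero]
      · simp [hm]
    calc _ = 2 * c * (∑ a, ∑ b, h ![-a, b] * (beta m a * beta n b) -
          ∑ a : ZMod N, ∑ b : ZMod N, h ![-a, b] *
            ((if m = 1 ∧ a = 0 then 1 / 2 else 0) * beta n b)) := by
          simp only [← Finset.sum_sub_distrib, Finset.mul_sum]
          refine Finset.sum_congr rfl fun a _ => Finset.sum_congr rfl fun b _ => ?_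
          rw [add_neg_of_eq_beta hY, hZ]; ring
      _ = _ := by rw [h0, hbeta]; ring
  have e3 : ∑ a, ∑ b, h ![-a, b] * (Z a * (Y' b - (-1) ^ n * Y' (-b)))
      = -if m = 1 then ∑ b, h ![0, b] * Y' b else 0 := by
    have h1 : ∑ a, ∑ b, h ![-a, b] * (Z a * Y' (-b))
        = ∑ a, ∑ b, (-1) ^ (n + m) * h ![-a, b] * (Z (-a) * Y' b) := by
      rw [← sum_sum_neg]
      simp only [hneg, neg_neg]
    calc _ = ∑ a, ∑ b, h ![-a, b] * (Z a * Y' b) - (-1) ^ n * ∑ a, ∑ b, h ![-a, b] * (Z a * Y' (-b)) := by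
          simp only [← Finset.sum_sub_distrib, Finset.mul_sum]
          exact Finset.sum_congr rfl fun a _ => Finset.sum_congr rfl fun b _ => by ring
      _ = ∑ a, ∑ b, h ![-a, b] * Y' b * (Z a - (-1) ^ m * Z (-a)) := by
          rw [h1]
          simp only [← Finset.sum_sub_distrib, Finset.mul_sum]
          refine Finset.sum_congr rfl fun a _ => Finset.sum_congr rfl fun b _ => ?_
          rw [pow_add]
          linear_combination (-((-1) ^ m * h ![-a, b] * (Z (-a) * Y' b))) * hsq n
      _ = _ := by
          simp only [sub_neg_of_eq_beta hZ]
          rw [Finset.sum_comm]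
          split_ifs with hm
          · simp [hm]
          · simp [hm]
  calc _ = ∑ a, ∑ b, h ![-a, b] * (Zd a * (Y b - (-1) ^ n * Y (-b)))
        + ∑ a, ∑ b, h ![-a, b] * (Z a * (c * (Y b + (-1) ^ n * Y (-b))))
        - ∑ a, ∑ b, h ![-a, b] * (Z a * (Y' b - (-1) ^ n * Y' (-b))) := by
        simp only [← Finset.sum_add_distrib, ← Finset.sum_sub_distrib]
        exact Finset.sum_congr rfl fun a _ => Finset.sum_congr rfl fun b _ => by ring
    _ = _ := by rw [e1, e2, e3]; ring

lemma cexp_pi_mul_I_mul_nat (n : ℕ) : cexp (Real.pi * Complex.I * n) = (-1) ^ n ∧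
    cexp (-Real.pi * Complex.I * n) = (-1) ^ n ∧ cexp (Real.pi * Complex.I * n / 2) = Complex.I ^ n ∧
    cexp (-Real.pi * Complex.I * n / 2) = (-1) ^ n * Complex.I ^ n := by
  refine ⟨?_, ?_, ?_, ?_⟩
  · rw [mul_comm, exp_nat_mul, exp_pi_mul_I]
  · rw [mul_comm, exp_nat_mul, neg_mul, exp_neg, exp_pi_mul_I]; norm_num
  · rw [show (Real.pi * Complex.I * n / 2 : ℂ) = n * (Real.pi / 2 * Complex.I) by ring, exp_nat_mul,
      exp_pi_div_two_mul_I]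
  · rw [show (-Real.pi * Complex.I * n / 2 : ℂ) = n * (-Real.pi / 2 * Complex.I) by ring, exp_nat_mul,
      exp_neg_pi_div_two_mul_I, neg_pow]

/-- The critical values of the completed `L`-function of an Eisenstein series. -/
theorem Λ_eis_natCast {k : ℕ} (hk : 2 ≤ k) (f : Fn' N k) {n m : ℕ} (hn : 1 ≤ n) (hm : 1 ≤ m)
    (hnm : n + m = k) :
    2 * Real.pi * Complex.I * (-1) ^ n *
        (periodPair (by omega : 1 ≤ k) (isRegular_eis hk f)).Λ (n : ℂ)
      = Complex.I ^ n * (2 * Real.pi * Complex.I * (-1) ^ n *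
          integral₂ (reflect f.1) (beta m) (beta n)
        - (if n = 1 then ∑ a, symmetrize k f.1 ![-a, 0] * deriv (residueZeta a) (1 - m) else 0)
        + (if m = 1 then ∑ b, symmetrize k f.1 ![0, b] * deriv (residueZeta b) (1 - n) else 0)) := by
  set P := periodPair (by omega : 1 ≤ k) (isRegular_eis hk f) with hP
  have h0 : (n : ℂ) ≠ 0 := by exact_mod_cast (by omega : n ≠ 0)
  have hnk : (n : ℂ) ≠ k := by exact_mod_cast (by omega : n ≠ k)
  obtain ⟨e1, e2, e3, e4⟩ := cexp_pi_mul_I_mul_nat n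
  have hΛ : DifferentiableAt ℂ P.Λ n := P.differentiableAt_Λ (Or.inl h0) (Or.inl hnk)
  have he (c : ℂ) : HasDerivAt (fun s => cexp (c * s)) (c * cexp (c * n)) n := by
    have := ((hasDerivAt_id (n : ℂ)).const_mul c).cexp
    simpa [mul_comm] using! this
  have hL := ((he (Real.pi * Complex.I)).fun_sub (he (-Real.pi * Complex.I))).fun_mul hΛ.hasDerivAt
  have hR := hasDerivAt_hurwitzSum k (symmetrize k f.1) h0 hnk
  have heq : (fun s => (cexp (Real.pi * Complex.I * s) - cexp (-Real.pi * Complex.I * s)) * P.Λ s)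
      =ᶠ[𝓝 (n : ℂ)] hurwitzSum k (symmetrize k f.1) := by
    filter_upwards [isOpen_ne.mem_nhds h0, isOpen_ne.mem_nhds hnk] with s h1 h2
    exact Λ_eis_eq_hurwitzSum hk f h1 h2
  have h1 := hL.unique (hR.congr_of_eventuallyEq heq)
  -- The exponential factor vanishes at `n`, so the derivative of `Λ` drops out and `2πi (-1)^n
  -- Λ(n)` remains.
  rw [e1, e2, e3, e4, sub_self, zero_mul, add_zero] at h1
  have hs : (n : ℂ) - k + 1 = 1 - m := by rw [← hnm]; push_cast; ring
  rw [hs] at h1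
  have h2 := sum_symmetrize_hurwitz n m f.1 (fun a => deriv (residueZeta a) (1 - m))
    (fun b => deriv (residueZeta b) (1 - n)) (Real.pi * Complex.I / 2)
    (fun b => residueZeta_one_sub b hn) (fun a => residueZeta_one_sub a hm)
  rw [hnm] at h2
  have h3 : 2 * Real.pi * Complex.I * (-1) ^ n * P.Λ n
      = Complex.I ^ n * ∑ a, ∑ b, symmetrize k f.1 ![-a, b] * (deriv (residueZeta a) (1 - m) *
          (residueZeta b (1 - n) - (-1) ^ n * residueZeta (-b) (1 - n)) +
        residueZeta a (1 - m) * (Real.pi * Complex.I / 2 *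
          (residueZeta b (1 - n) + (-1) ^ n * residueZeta (-b) (1 - n)) -
          (deriv (residueZeta b) (1 - n) - (-1) ^ n * deriv (residueZeta (-b)) (1 - n)))) := by
    rw [Finset.mul_sum]
    simp only [Finset.mul_sum (Finset.univ) (fun b : ZMod N => _) (Complex.I ^ n)]
    refine Eq.trans ?_ (h1.trans (Finset.sum_congr rfl fun a _ => Finset.sum_congr rfl fun b _ => ?_))
    · ring
    · ring
  rw [h3, h2]
  ring

/-! ### The distributions `β'` -/

lemma betaPrime_eq {p : ℕ} (hp : 1 ≤ p) (r : ZMod N) :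
    betaPrime p r = 1 / (-2 * Complex.I * Real.pi) * ∑ j, (ZMod.stdAddChar (j * r) +
      (-1) ^ (p + 1) * ZMod.stdAddChar (-(j * r))) * deriv (residueZeta j) (1 - p) := by
  have hp1 : (1 - p : ℂ) ≠ 1 := by
    rw [Ne, sub_eq_self]; exact_mod_cast (by omega : p ≠ 0)
  rw [betaPrime, betaPrimeIntegral, dft_single]
  congr 1
  have h : (ZMod.LFunction fun n : ZMod N => (ZMod.stdAddChar (-(r * -n)) : ℂ) +
      (-1) ^ (p + 1) * ZMod.stdAddChar (-(r * n))) = fun s => ∑ j, (ZMod.stdAddChar (j * r) +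
      (-1) ^ (p + 1) * ZMod.stdAddChar (-(j * r))) * residueZeta j s := by
    ext s
    rw [LFunction_eq_sum_residueZeta]
    refine Finset.sum_congr rfl fun j _ => ?_
    rw [mul_neg, neg_neg, mul_comm r j]
  rw [h]
  exact (HasDerivAt.fun_sum fun j _ =>
    (differentiableAt_residueZeta j hp1).hasDerivAt.const_mul _).deriv

lemma betaPrime_neg {p : ℕ} (hp : 1 ≤ p) (r : ZMod N) :
    betaPrime p (-r) = (-1) ^ (p + 1) * betaPrime p r := by
  have hsq : ((-1 : ℂ) ^ (p + 1)) * (-1) ^ (p + 1) = 1 := by rw [← mul_pow]; norm_num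
  rw [betaPrime_eq hp, betaPrime_eq hp, mul_left_comm]
  congr 1
  rw [Finset.mul_sum]
  refine Finset.sum_congr rfl fun j _ => ?_
  rw [mul_neg, neg_neg]
  linear_combination (-(ZMod.stdAddChar (-(j * r)) * deriv (residueZeta j) (1 - p))) * hsq

lemma sum_eisCoeff (f : Fn N) (m j : ZMod N) :
    ∑ c, eisCoeff f m c * ZMod.stdAddChar (j * c) = f ![-m, j] := by
  have hN : (N : ℂ) ≠ 0 := by exact_mod_cast NeZero.ne N
  simp only [eisCoeff, mul_assoc, Finset.sum_mul, ← Finset.mul_sum]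
  rw [Finset.sum_comm]
  have h1 (b c : ZMod N) : (ZMod.stdAddChar (-(b * c)) : ℂ) * ZMod.stdAddChar (j * c)
      = ZMod.stdAddChar (c * (j - b)) := by
    rw [← AddChar.map_add_eq_mul]; congr 1; ring
  simp only [h1, ← Finset.mul_sum, AddChar.sum_mulShift _ (ZMod.isPrimitive_stdAddChar N)]
  rw [Finset.sum_eq_single j (fun b _ hb => by simp [sub_eq_zero, hb.symm]) (by simp)]
  simp only [sub_self, if_true, ZMod.card]
  field_simp

/-- Fourier inversion: the constant weight in the first variable restricts `f` to an axis. This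
matches the one-variable sums left over in `Λ_eis_natCast`. -/
lemma sum_fourier_left (f : Fn N) (j : ZMod N) :
    ∑ a, ∑ b, fourier f ![a, b] * (N : ℂ)⁻¹ * ZMod.stdAddChar (j * b) = f ![-j, 0] := by
  rw [← sum_eisCoeff f j 0]
  refine Finset.sum_congr rfl fun a _ => ?_
  rw [← sum_fourier_mul_stdAddChar, Finset.mul_sum, zero_mul, AddChar.map_zero_eq_one, mul_one]
  refine Finset.sum_congr rfl fun b _ => ?_
  rw [mul_comm j]; ring

lemma sum_fourier_right (f : Fn N) (j : ZMod N) :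
    ∑ a, ∑ b, fourier f ![a, b] * ZMod.stdAddChar (j * a) * (N : ℂ)⁻¹ = f ![0, j] := by
  have h := sum_eisCoeff f 0 j
  rw [neg_zero] at h
  rw [← h]
  refine Finset.sum_congr rfl fun a _ => ?_
  rw [← sum_fourier_mul_stdAddChar, Finset.mul_sum, Finset.sum_mul]
  refine Finset.sum_congr rfl fun b _ => ?_
  rw [mul_zero, AddChar.map_zero_eq_one]; ring

omit [NeZero N] in
lemma beta_zero (r : ZMod N) : beta 0 r = (N : ℂ)⁻¹ := by
  simp [beta, betaRat]

lemma integral₂_fourier_beta_zero_betaPrime {p : ℕ} (hp : 1 ≤ p) (f : Fn N) :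
    integral₂ (fourier f) (beta 0) (betaPrime p) = 1 / (-2 * Complex.I * Real.pi) *
      ∑ a, symmetrize (p + 1) f ![-a, 0] * deriv (residueZeta a) (1 - p) := by
  have h (j : ZMod N) : symmetrize (p + 1) f ![-j, 0]
      = ∑ a, ∑ b, fourier f ![a, b] * (N : ℂ)⁻¹ * (ZMod.stdAddChar (j * b) +
        (-1) ^ (p + 1) * ZMod.stdAddChar (-(j * b))) := by
    have h1 := sum_fourier_left f (-j)
    simp only [neg_mul] at h1
    have h2 : (-![-j, 0] : Fin 2 → ZMod N) = ![- -j, 0] := by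
      ext i; fin_cases i <;> simp
    rw [symmetrize, h2, ← h1, ← sum_fourier_left f j, Finset.mul_sum, ← Finset.sum_add_distrib]
    refine Finset.sum_congr rfl fun a _ => ?_
    rw [Finset.mul_sum, ← Finset.sum_add_distrib]
    exact Finset.sum_congr rfl fun b _ => by ring
  simp only [h, integral₂_eq, betaPrime_eq hp, beta_zero, Finset.mul_sum, Finset.sum_mul]
  symm
  rw [Finset.sum_comm]
  refine Finset.sum_congr rfl fun a _ => ?_
  rw [Finset.sum_comm]
  exact Finset.sum_congr rfl fun b _ => Finset.sum_congr rfl fun j _ => by ring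

lemma integral₂_fourier_betaPrime_beta_zero {p : ℕ} (hp : 1 ≤ p) (f : Fn N) :
    integral₂ (fourier f) (betaPrime p) (beta 0) = 1 / (-2 * Complex.I * Real.pi) *
      ∑ b, symmetrize (p + 1) f ![0, b] * deriv (residueZeta b) (1 - p) := by
  have h (j : ZMod N) : symmetrize (p + 1) f ![0, j]
      = ∑ a, ∑ b, fourier f ![a, b] * (ZMod.stdAddChar (j * a) +
        (-1) ^ (p + 1) * ZMod.stdAddChar (-(j * a))) * (N : ℂ)⁻¹ := by
    have h1 := sum_fourier_right f (-j)
    simp only [neg_mul] at h1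
    have h2 : (-![0, j] : Fin 2 → ZMod N) = ![0, -j] := by
      ext i; fin_cases i <;> simp
    rw [symmetrize, h2, ← h1, ← sum_fourier_right f j, Finset.mul_sum, ← Finset.sum_add_distrib]
    refine Finset.sum_congr rfl fun a _ => ?_
    rw [Finset.mul_sum, ← Finset.sum_add_distrib]
    exact Finset.sum_congr rfl fun b _ => by ring
  simp only [h, integral₂_eq, betaPrime_eq hp, beta_zero, Finset.mul_sum, Finset.sum_mul]
  symm
  rw [Finset.sum_comm]
  refine Finset.sum_congr rfl fun a _ => ?_
  rw [Finset.sum_comm]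
  exact Finset.sum_congr rfl fun b _ => Finset.sum_congr rfl fun j _ => by ring

/-- The coefficients of `Per(Eis_k(f))({∞, 0})`. -/
theorem neg_I_pow_mul_Λ_eis {k : ℕ} (hk : 2 ≤ k) (f : Fn' N k) {j : ℕ} (hj : j + 2 ≤ k) :
    -Complex.I ^ (j + 1) * (periodPair (by omega : 1 ≤ k) (isRegular_eis hk f)).Λ ((j + 1 : ℕ) : ℂ)
      = (-1) ^ j * integral₂ (reflect f.1) (beta (k - 1 - j)) (beta (j + 1))
        + (if j = k - 2 then integral₂ (fourier f.1) (betaPrime (k - 1)) (beta 0) else 0)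
        - (if j = 0 then integral₂ (fourier f.1) (beta 0) (betaPrime (k - 1)) else 0) := by
  have h := Λ_eis_natCast hk f (n := j + 1) (m := k - 1 - j) (by omega) (by omega) (by omega)
  generalize (periodPair (by omega : 1 ≤ k) (isRegular_eis hk f)).Λ ((j + 1 : ℕ) : ℂ) = L at h ⊢
  -- The index `n = j + 1` equals `1` at the monomial `y^{k-2}`, and `m = k - 1 - j` equals `1` at
  -- `x^{k-2}`; for `k = 2` both occur together.
  have e1 : (if j + 1 = 1 then ∑ a, symmetrize k f.1 ![-a, 0] *
        deriv (residueZeta a) (1 - (k - 1 - j : ℕ)) else 0)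
      = -2 * Complex.I * Real.pi *
        (if j = 0 then integral₂ (fourier f.1) (beta 0) (betaPrime (k - 1)) else 0) := by
    by_cases h0 : j = 0
    · subst h0
      rw [if_pos rfl, if_pos rfl, integral₂_fourier_beta_zero_betaPrime (by omega),
        Nat.sub_add_cancel (by omega : 1 ≤ k), Nat.sub_zero]
      field_simp
    · rw [if_neg (by omega), if_neg h0, mul_zero]
  have e2 : (if k - 1 - j = 1 then ∑ b, symmetrize k f.1 ![0, b] *
        deriv (residueZeta b) (1 - (j + 1 : ℕ)) else 0)
      = -2 * Complex.I * Real.pi *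
        (if j = k - 2 then integral₂ (fourier f.1) (betaPrime (k - 1)) (beta 0) else 0) := by
    by_cases h0 : j = k - 2
    · have h1 : j + 1 = k - 1 := by omega
      rw [if_pos (by omega), if_pos h0, integral₂_fourier_betaPrime_beta_zero (by omega),
        Nat.sub_add_cancel (by omega : 1 ≤ k), h1]
      field_simp
    · rw [if_neg (by omega), if_neg h0, mul_zero]
  rw [e1, e2] at h
  have hI : Complex.I ^ (j + 1) * Complex.I ^ (j + 1) = (-1) ^ (j + 1) := by
    rw [← mul_pow, I_mul_I]
  have hsq : ((-1 : ℂ) ^ (j + 1)) * (-1) ^ (j + 1) = 1 := by rw [← mul_pow]; norm_num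
  have h2 : (2 * Real.pi * Complex.I : ℂ) ≠ 0 := by
    simp [Real.pi_ne_zero]
  refine mul_left_cancel₀ h2 ?_
  generalize (if j = 0 then _ else (0 : ℂ)) = A at *
  generalize (if j = k - 2 then _ else (0 : ℂ)) = B at *
  generalize integral₂ (reflect f.1) (beta (k - 1 - j)) (beta (j + 1)) = J at *
  generalize Complex.I ^ (j + 1) = u at *
  have hj1 : (-1 : ℂ) ^ j = -(-1) ^ (j + 1) := by rw [pow_succ]; ring
  rw [hj1]
  generalize (-1 : ℂ) ^ (j + 1) = e at *
  linear_combination (-u * e) * h + (2 * Real.pi * Complex.I) * (u * L - (e * J + A - B)) * hsq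
    - (2 * Real.pi * Complex.I) * (e * J + A - B) * e * hI

end IntegerValues

end EisensteinDedekind

namespace EisensteinDedekind

/-! ### The period homomorphism of Eisenstein series -/

section PeriodsEis

open Finset

variable {N : ℕ} [NeZero N]

theorem isEquivariant_Psi {k : ℕ} (hk : 2 ≤ k) : IsEquivariant (Psi N k) := by
  intro γ f
  ext1 δ
  rw [homSlash_apply, Psi, Psi, ← per_ratSlash hk (isRegular_eis hk f) (det_toGL_pos γ),
    ratSlash_eis hk]
  rfl

theorem isLinearMap_Psi {k : ℕ} (hk : 2 ≤ k) : IsLinearMap ℂ (Psi N k) where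
  map_add f g := by
    rw [Psi, Submodule.coe_add, eis_add hk, per_add (isRegular_eis hk f) (isRegular_eis hk g)]
    rfl
  map_smul c f := by
    rw [Psi, Submodule.coe_smul, eis_smul hk, per_smul (isRegular_eis hk f)]
    rfl

theorem Psi_symbolInftyZero {k : ℕ} (hk : 2 ≤ k) (f : Fn' N k) :
    (Psi N k f symbolInftyZero : MvPolynomial (Fin 2) ℂ) =
      ∑ j ∈ range (k - 1),
        MvPolynomial.C ((-1) ^ j * ((k - 2).choose j : ℂ) *
            integral₂ (reflect f.1) (beta (k - 1 - j)) (beta (j + 1))) *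
          (MvPolynomial.X 0 ^ j * MvPolynomial.X 1 ^ (k - 2 - j))
      + MvPolynomial.C (integral₂ (fourier f.1) (betaPrime (k - 1)) (beta 0)) *
          MvPolynomial.X 0 ^ (k - 2)
      - MvPolynomial.C (integral₂ (fourier f.1) (beta 0) (betaPrime (k - 1))) *
          MvPolynomial.X 1 ^ (k - 2) := by
  rw [Psi, per_symbolInftyZero hk (isRegular_eis hk f)]
  set A := integral₂ (fourier f.1) (betaPrime (k - 1)) (beta 0)
  set B := integral₂ (fourier f.1) (beta 0) (betaPrime (k - 1))
  have h1 : MvPolynomial.C A * MvPolynomial.X 0 ^ (k - 2) = ∑ j ∈ range (k - 1),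
      if j = k - 2 then MvPolynomial.C (((k - 2).choose j : ℂ) * A) *
        (MvPolynomial.X (R := ℂ) (0 : Fin 2) ^ j * MvPolynomial.X 1 ^ (k - 2 - j)) else 0 := by
    rw [sum_ite_eq' (range (k - 1)), if_pos (mem_range.2 (by omega))]
    simp
  have h2 : MvPolynomial.C B * MvPolynomial.X 1 ^ (k - 2) = ∑ j ∈ range (k - 1),
      if j = 0 then MvPolynomial.C (((k - 2).choose j : ℂ) * B) *
        (MvPolynomial.X (R := ℂ) (0 : Fin 2) ^ j * MvPolynomial.X 1 ^ (k - 2 - j)) else 0 := by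
    rw [sum_ite_eq' (range (k - 1)), if_pos (mem_range.2 (by omega))]
    simp
  rw [h1, h2, ← Finset.sum_add_distrib, ← Finset.sum_sub_distrib]
  change (∑ j ∈ range (k - 1), _ : MvPolynomial (Fin 2) ℂ) = _
  refine Finset.sum_congr rfl fun j hj => ?_
  have := mem_range.1 hj
  beta_reduce
  rw [neg_I_pow_mul_Λ_eis hk f (by omega)]
  split_ifs <;> simp only [map_mul, map_add, map_sub, map_zero] <;> ring

lemma mul_Psi_symbolAtInfty {k : ℕ} (hk : 2 ≤ k) (f : Fn' N k) (r : ℚ) :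
    MvPolynomial.X 0 * (Psi N k f (symbolAtInfty r) : MvPolynomial (Fin 2) ℂ) =
      MvPolynomial.C (1 / ((k : ℂ) - 1) * integral₂ (reflect f.1) (beta k) (beta 0)) *
        ((MvPolynomial.C (r : ℂ) * MvPolynomial.X 0 + MvPolynomial.X 1) ^ (k - 1)
          - MvPolynomial.X 1 ^ (k - 1)) := by
  rw [Psi, mul_per_symbolAtInfty hk (isRegular_eis hk f), valueAtInfty_eis_eq hk]

/-! ### Rationality of the periods up to a coboundary -/

/-- Homogeneity of `Q` is inherited from `P`, as base change kills no coefficient. -/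
lemma mem_range_vBaseChange {k : ℕ} {P : V k ℂ} {Q : MvPolynomial (Fin 2) ℚ}
    (h : (P : MvPolynomial (Fin 2) ℂ) = MvPolynomial.map (algebraMap ℚ ℂ) Q) :
    P ∈ LinearMap.range (vBaseChange k) := by
  have hQ : Q.IsHomogeneous (k - 2) := by
    intro d hd
    refine P.2 (d := d) ?_
    rw [h, MvPolynomial.coeff_map]
    exact (map_ne_zero _).2 hd
  exact ⟨⟨Q, hQ⟩, Subtype.ext h.symm⟩

lemma exists_rat_integral₂_beta {f : Fn N} (hf : IsRationalFn f) (m n : ℕ) :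
    ∃ q : ℚ, integral₂ (reflect f) (beta m) (beta n) = (q : ℂ) := by
  choose g hg using hf
  refine ⟨∑ v, g (-v) * betaRat m (v 0) * betaRat n (v 1), ?_⟩
  rw [integral₂]
  push_cast
  exact sum_congr rfl fun v _ => by rw [reflect, hg]; rfl

lemma Psi_symbolAtInfty_mem_range {k : ℕ} (hk : 2 ≤ k) (f : Fn' N k) (r : ℚ)
    (hf : IsRationalFn f.1) : Psi N k f (symbolAtInfty r) ∈ LinearMap.range (vBaseChange k) := by
  obtain ⟨q, hq⟩ := exists_rat_integral₂_beta hf k 0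
  -- The quotient by `x` is explicit: a geometric sum for the difference of `(k-1)`-st powers, whose
  -- bases differ by `rx`.
  refine mem_range_vBaseChange (Q := MvPolynomial.C (1 / ((k : ℚ) - 1) * q) * (MvPolynomial.C r *
    ∑ i ∈ range (k - 1), (MvPolynomial.C r * MvPolynomial.X 0 + MvPolynomial.X 1) ^ i *
      MvPolynomial.X 1 ^ (k - 1 - 1 - i))) ?_
  refine mul_left_cancel₀ (MvPolynomial.X_ne_zero (R := ℂ) (0 : Fin 2)) ?_
  rw [mul_Psi_symbolAtInfty hk, hq, ← (Commute.all _ _).geom_sum₂_mul]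
  simp only [map_mul, map_sum, map_pow, map_add, MvPolynomial.map_C, MvPolynomial.map_X,
    add_sub_cancel_right, eq_ratCast]
  push_cast
  ring

/-! ### The correcting coboundary -/

lemma integral₂_fourier_fnSlash (f : Fn N) (γ : SL(2, ℤ)) (φ : ZMod N → ℂ) :
    integral₂ (fourier (fnSlash γ f)) φ (beta 0)
      = ∑ w, fourier f w * φ (w 0 * (γ 0 0 : ℤ) + w 1 * (γ 1 0 : ℤ)) * (N : ℂ)⁻¹ := by
  rw [integral₂, ← (vecMulEquiv N γ).sum_comp]
  refine sum_congr rfl fun w _ => ?_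
  rw [fourier_fnSlash, fnSlash_vecMulEquiv, vecMulEquiv_apply_zero, beta_zero]

/-- The polynomial `c x^{k-2}`. -/
noncomputable def monomialX (k : ℕ) (c : ℂ) : V k ℂ :=
  ⟨MvPolynomial.C c * MvPolynomial.X 0 ^ (k - 2), (MvPolynomial.isHomogeneous_X_pow _ _).C_mul _⟩

lemma vAct_monomialX (k : ℕ) (g : GL (Fin 2) ℚ) (c : ℂ) :
    (vAct k ℂ g (monomialX k c) : MvPolynomial (Fin 2) ℂ) = MvPolynomial.C c *
      (MvPolynomial.C (g 1 1 : ℂ) * MvPolynomial.X 0 - MvPolynomial.C (g 1 0 : ℂ) * MvPolynomial.X 1)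
        ^ (k - 2) := by
  simp [vAct, monomialX, substHom]

/-- The coboundary which removes the transcendental terms from `Ψ_k`. -/
noncomputable def correction (k : ℕ) (f : Fn' N k) : V k ℂ :=
  monomialX k (integral₂ (fourier f.1) (betaPrime (k - 1)) (beta 0))

/-- The stabilizer of `∞` consists of the matrices `±(1 b; 0 1)`. Translations do not change the
first coordinate, and `β_0` is constant in the second. The sign acts by `(-1)^{k-2}` both on
`x^{k-2}` and on `β'_{k-1}`. -/
lemma correction_fnSlash {k : ℕ} (hk : 2 ≤ k) (γ : SL(2, ℤ)) (f : Fn' N k)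
    (hγ : toGL γ • (OnePoint.infty : OnePoint ℚ) = OnePoint.infty) :
    correction k (fnSlash' γ f) = vAct k ℂ (toGL γ) (correction k f) := by
  rw [OnePoint.smul_infty_eq_self_iff, toGL_apply, Int.cast_eq_zero] at hγ
  have hdet : γ 0 0 * γ 1 1 = 1 := by
    have := γ.det_coe
    rwa [Matrix.det_fin_two, hγ, mul_zero, sub_zero] at this
  apply Subtype.ext
  rw [correction, correction, vAct_monomialX, toGL_apply, toGL_apply, hγ, monomialX]
  simp only [fnSlash', integral₂_fourier_fnSlash, hγ]
  rcases Int.eq_one_or_neg_one_of_mul_eq_one' hdet with ⟨h0, h1⟩ | ⟨h0, h1⟩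
  · simp [h0, h1, integral₂, beta_zero]
  · have h2 (r : ZMod N) : betaPrime (k - 1) (-r) = (-1) ^ (k - 2) * betaPrime (k - 1) r := by
      rw [betaPrime_neg (by omega), show k - 1 + 1 = k - 2 + 2 by omega, pow_add]
      norm_num
    have h3 : (-MvPolynomial.X 0 : MvPolynomial (Fin 2) ℂ) ^ (k - 2)
        = MvPolynomial.C ((-1) ^ (k - 2)) * MvPolynomial.X 0 ^ (k - 2) := by
      rw [neg_pow]; simp
    simp [h0, h1, integral₂, beta_zero, h2, h3, -map_pow, -map_neg]
    simp only [sum_mul]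
    exact sum_congr rfl fun v _ => by ring

/-- `S` exchanges the two `β'` integrals and `S⁻¹` turns `x^{k-2}` into `y^{k-2}`. The added
boundary is therefore the exact negative of the two `β'` terms, and only Bernoulli sums remain. -/
lemma Psi_symbolInftyZero_add_mem_range {k : ℕ} (hk : 2 ≤ k) (f : Fn' N k) (hf : IsRationalFn f.1) :
    Psi N k f symbolInftyZero + (vAct k ℂ (toGL ModularGroup.S⁻¹)
      (correction k (fnSlash' ModularGroup.S f)) - correction k f)
        ∈ LinearMap.range (vBaseChange k) := by
  choose q hq using fun m n => exists_rat_integral₂_beta hf m n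
  refine mem_range_vBaseChange (Q := ∑ j ∈ range (k - 1),
        MvPolynomial.C ((-1) ^ j * ((k - 2).choose j : ℚ) * q (k - 1 - j) (j + 1)) *
          (MvPolynomial.X 0 ^ j * MvPolynomial.X 1 ^ (k - 2 - j))) ?_
  obtain ⟨-, h1, h2⟩ := toGL_S_inv_apply
  have h3 : integral₂ (fourier (fnSlash ModularGroup.S f.1)) (betaPrime (k - 1)) (beta 0)
      = integral₂ (fourier f.1) (beta 0) (betaPrime (k - 1)) := by
    rw [integral₂_fourier_fnSlash, integral₂]
    refine sum_congr rfl fun w _ => ?_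
    rw [beta_zero]
    simp [ModularGroup.S]
    ring
  rw [Submodule.coe_add, Submodule.coe_sub, Psi_symbolInftyZero hk, correction, vAct_monomialX,
    toGL, map_inv, h1, h2, correction, monomialX]
  simp only [fnSlash', h3, hq, map_sum, map_mul, map_pow, MvPolynomial.map_X, MvPolynomial.map_C,
    map_neg, map_one, map_natCast]
  simp

end PeriodsEis

end EisensteinDedekind

theorem mainTheorem6 (N : ℕ) [NeZero N] (k : ℕ) (hk : 2 ≤ k) :
    -- `Eis_k` takes values in modular forms of weight `k` for `Γ(N)`
    (∀ f : Fn' N k,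
      ∃ G : ModularForm
          ((CongruenceSubgroup.Gamma N).map (Matrix.SpecialLinearGroup.mapGL ℝ)) (k : ℤ),
        ⇑G = eis N k f.1) ∧
    -- the characteristic property of `Per` at the Eisenstein series `Eis_k(f)`
    (∀ (f : Fn' N k) (g : GL (Fin 2) ℚ), 0 < g.det.val → ∀ τ : UpperHalfPlane,
      Psi N k f (bracket zInfty (g⁻¹ • zInfty)) = eichlerDefect k (eis N k f.1) g τ) ∧
    -- `Ψ_k` is a homomorphism of `SL₂(ℤ)`-modules
    IsLinearMap ℂ (Psi N k) ∧
    IsEquivariant (Psi N k) ∧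
    -- the value at `{∞, 0}`
    (∀ f : Fn' N k,
      (Psi N k f symbolInftyZero : MvPolynomial (Fin 2) ℂ) =
        ∑ j ∈ Finset.range (k - 1),
          MvPolynomial.C ((-1) ^ j * ((k - 2).choose j : ℂ) *
              integral₂ (reflect f.1) (beta (k - 1 - j)) (beta (j + 1))) *
            (MvPolynomial.X 0 ^ j * MvPolynomial.X 1 ^ (k - 2 - j))
        + MvPolynomial.C (integral₂ (fourier f.1) (betaPrime (k - 1)) (beta 0)) *
            MvPolynomial.X 0 ^ (k - 2)
        - MvPolynomial.C (integral₂ (fourier f.1) (beta 0) (betaPrime (k - 1))) *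
            MvPolynomial.X 1 ^ (k - 2)) ∧
    -- the value at `[0, r]_∞`, multiplied by `x`
    (∀ (f : Fn' N k) (r : ℚ),
      MvPolynomial.X 0 * (Psi N k f (symbolAtInfty r) : MvPolynomial (Fin 2) ℂ) =
        MvPolynomial.C (1 / ((k : ℂ) - 1) * integral₂ (reflect f.1) (beta k) (beta 0)) *
          ((MvPolynomial.C (r : ℂ) * MvPolynomial.X 0 + MvPolynomial.X 1) ^ (k - 1)
            - MvPolynomial.X 1 ^ (k - 1))) ∧
    -- these values determine `Ψ_k` among the `SL₂(ℤ)`-equivariant maps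
    (∀ Φ : Fn' N k → (Xi0 →+ V k ℂ), IsEquivariant Φ →
      (∀ f : Fn' N k, Φ f symbolInftyZero = Psi N k f symbolInftyZero) →
      (∀ (f : Fn' N k) (r : ℚ), Φ f (symbolAtInfty r) = Psi N k f (symbolAtInfty r)) →
      Φ = Psi N k) ∧
    -- rationality of the class of `Ψ_k(f)` for `ℚ`-valued `Γ`-invariant `f`
    (∀ (Γ : Subgroup (Matrix.SpecialLinearGroup (Fin 2) ℤ)), CongruenceSubgroup.Gamma N ≤ Γ →
      ∀ f : Fn' N k, (∀ v, ∃ q : ℚ, f.1 v = (q : ℂ)) → (∀ γ ∈ Γ, fnSlash γ f.1 = f.1) →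
        ∃ h : IsGammaInvariant Γ k ℂ (Psi N k f), ∀ Z : InfCusp,
          h1Class Γ k ℂ Z (Psi N k f) h ∈ Set.range (h1BaseChange Γ k)) := by
  refine ⟨exists_modularForm_eis hk,
    fun f g hg τ => per_bracket_eq_eichlerDefect hk (isRegular_eis hk f) hg τ, isLinearMap_Psi hk,
    isEquivariant_Psi hk, Psi_symbolInftyZero hk, mul_Psi_symbolAtInfty hk,
    fun Φ hΦ h0 hr => eq_of_isEquivariant hΦ (isEquivariant_Psi hk) h0 hr, ?_⟩
  intro Γ _ f hf hΓ
  refine ⟨isGammaInvariant_of_isEquivariant (isEquivariant_Psi hk) hΓ, fun Z => ?_⟩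
  exact h1Class_mem_range (isEquivariant_Psi hk) (correction_fnSlash hk)
    (Psi_symbolInftyZero_add_mem_range hk) (Psi_symbolAtInfty_mem_range hk) Γ f hf hΓ _ Z
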